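/- Let $F$ be a number field with ring of integers $\mathcal{O}$, $G=PGL_2$, $p$ a prime number, $n\ge 1$, and $R=\mathbb{Z}/p^n$. For a prime $\mathfrak{v}$ of $F$ put $G_\mathfrak{v}=G(F_\mathfrak{v})$ and let $K_\mathfrak{v}\subseteq G_\mathfrak{v}$ be the image of $GL_2(\mathcal{O}_\mathfrak{v})$. Let $\mathfrak{n}\subseteq\mathcal{O}$ be a non-zero ideal, let $\mathfrak{p}\mid p$ be a prime dividing $\mathfrak{n}$ exactly once, and let $\mathfrak{q}\nmid p\,\mathfrak{n}$ be a prime. (The main case is that $\mathfrak{n}=\mathfrak{f}_\pi$ is the conductor of an automorphic representation $\pi$ of $G$.) Let $\epsilon\colon G(F\otimes\mathbb{R})\to\{\pm1\}$ be a locally constant character. *Coefficients.* Let $\mathrm{St}_\mathfrak{p}(A)=C^0(\mathbb{P}^1(F_\mathfrak{p}),A)/A$ (locally constant functions modulo constants). For finite sets $S_0\subseteq S$ of primes with $S_0\in\{\emptyset,\{\mathfrak{p}\}\}$ and an open compact subgroup $K\subseteq G(\mathbb{A}^{S,\infty})$, let $\mathcal{A}(K,S_0)^S$ be the space of functions $\Phi\colon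 G(\mathbb{A}^{S,\infty})\to \mathrm{Hom}_\mathbb{Z}(\mathrm{St}_{S_0},R)$ with $\Phi(ak)=\Phi(a)$ for $k\in K$, where $\mathrm{St}_\emptyset=\mathbb{Z}$ and $\mathrm{St}_{\{\mathfrak{p}\}}=\mathrm{St}_\mathfrak{p}(\mathbb{Z})$. The group $G(F)$ acts on $\mathcal{A}(K,S_0)^S(\epsilon)$ by $(\gamma\Phi)(a)=\epsilon(\gamma)\,\Phi(\gamma^{-1}a)\circ\gamma^{-1}$. Put $$MS^*(K,S_0)^{S,\epsilon}=\bigoplus_{m\ge0}H^m\bigl(G(F),\mathcal{A}(K,S_0)^S(\epsilon)\bigr),\qquad MS^*(\mathfrak{n},S_0)^{S,\epsilon}=MS^*(K_0(\mathfrak{n})^S,S_0)^{S,\epsilon},$$ where $K_0(\mathfrak{n})^S\subseteq G(\mathbb{A}^{S,\infty})$ is the image of the integral invertible matrices which are upper triangular modulo $\mathfrak{n}$; the superscript $S$ is omitted if $S=\emptyset$. *Derived Hecke operators.* Let $x\in G_\mathfrak{q}/K_\mathfrak{q}$ with representative $g_x\in G_\mathfrak{q}$, put $K_{\mathfrak{q},x}=K_\mathfrak{q}\cap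 g_xK_\mathfrak{q}g_x^{-1}$, and let $\alpha\in H^i(K_{\mathfrak{q},x},R)$ (continuous cohomology); such a pair $(x,\alpha)$ is a derived Hecke operator of degree $i$. Suppose $\mathfrak{q}\notin S$ and let $K_x\subseteq K_0(\mathfrak{n})^S$ be the subgroup of elements whose component at $\mathfrak{q}$ lies in $K_{\mathfrak{q},x}$. The image of $\alpha$ under $$H^i(K_{\mathfrak{q},x},R)\to H^i(K_x,R)\cong H^i\bigl(G(\mathbb{A}^{S,\infty}),\mathcal{A}(K_x,\emptyset)^S\bigr)\to H^i\bigl(G(F),\mathcal{A}(K_x,\emptyset)^S\bigr)$$ (inflation, Shapiro's lemma, restriction) is again denoted by $\alpha$. The operator $h_{x,\alpha}$ on $MS^*(\mathfrak{n},S_0)^{S,\epsilon}$ is the composite $$MS^*(\mathfrak{n},S_0)^{S,\epsilon}\xrightarrow{\ \mathrm{res}_x\ }MS^*(K_x,S_0)^{S,\epsilon}\xrightarrow{\ \cup\,\alpha\ }MS^*(K_x,S_0)^{S,\epsilon}\xrightarrow{\ \mathrm{cores}_x\ }MS^*(\mathfrak{n},S_0)^{S,\epsilon},$$ where $\mathrm{res}_x$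 is induced by right translation $\Phi\mapsto\Phi(\,\cdot\,g_x)$, the cup product is formed with respect to pointwise multiplication, and $\mathrm{cores}_x$ is induced by $\Phi\mapsto\sum_{k\in K_0(\mathfrak{n})^S/K_x}\Phi(\,\cdot\,k)$. Let $h'_{x,\alpha}$ be the operator defined in the same way, except that $\mathrm{res}_x$ is induced by the inclusion $\mathcal{A}(K_0(\mathfrak{n})^S,S_0)^S\subseteq\mathcal{A}(K_x,S_0)^S$. *Cup product with $b_{\bar\ell}$.* Let $\bar\ell\colon F_\mathfrak{p}^*\to R$ be a locally constant homomorphism. Let $\tilde{\mathcal{E}}(\bar\ell)$ be the set of pairs $(\Phi,r)$ of a locally constant function $\Phi\colon GL_2(F_\mathfrak{p})\to R$ and $r\in R$ with $\Phi\bigl(g\begin{pmatrix}t_1&u\\0&t_2\end{pmatrix}\bigr)=\Phi(g)+r\,\bar\ell(t_1)$ for all $g\in GL_2(F_\mathfrak{p})$, $t_1,t_2\in F_\mathfrak{p}^*$, $u\in F_\mathfrak{p}$, with $GL_2(F_\mathfrak{p})$ acting by left translation on $\Phi$, and let $\mathcal{E}(\bar\ell)$ be its quotient by the pairs $(\Phi,0)$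 with $\Phi$ constant. Let $b_{\bar\ell}$ be the restriction to $H^1(G(F),\mathrm{St}_\mathfrak{p}(R))$ of the class in $H^1(G_\mathfrak{p},\mathrm{St}_\mathfrak{p}(R))$ of the exact sequence of $R[G_\mathfrak{p}]$-modules $$0\to\mathrm{St}_\mathfrak{p}(R)\to\mathcal{E}(\bar\ell)\to R\to0,\qquad f\mapsto\bigl(g\mapsto f(g\cdot\infty),\,0\bigr),\quad(\Phi,r)\mapsto r$$ (the image of $1\in R$ under the connecting homomorphism). Cup product with $b_{\bar\ell}$, with respect to the pairing $\mathrm{Hom}_\mathbb{Z}(\mathrm{St}_\mathfrak{p}(\mathbb{Z}),R)\times\mathrm{St}_\mathfrak{p}(R)\to R$, gives $$c_{\bar\ell}\colon MS^*(\mathfrak{n},\{\mathfrak{p}\})^{\{\mathfrak{p}\},\epsilon}\to MS^*(\mathfrak{n},\emptyset)^{\{\mathfrak{p}\},\epsilon},\qquad m\mapsto m\cup b_{\bar\ell}.$$ *Evaluation.* For a vector $v\in\mathrm{St}_\mathfrak{p}(\mathbb{Z})$ fixed by the Iwahori subgroup of $G_\mathfrak{p}$ (the image of the matrices in $GL_2(\mathcal{O}_\mathfrak{p})$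 which are upper triangular modulo $\mathfrak{p}$), let $$\mathrm{ev}_v\colon MS^*(\mathfrak{n},\{\mathfrak{p}\})^{\{\mathfrak{p}\},\epsilon}\to MS^*(\mathfrak{n},\emptyset)^{\epsilon}$$ be induced by $\Phi\mapsto\bigl(a\mapsto\Phi(a^{\mathfrak{p}})(a_\mathfrak{p}v)\bigr)$, where $a_\mathfrak{p}$ is the component of $a$ at $\mathfrak{p}$ and $a^\mathfrak{p}$ its part away from $\mathfrak{p}$. **Claim.** For every derived Hecke operator $(x,\alpha)$ of degree $i$ at $\mathfrak{q}$: (a) for every locally constant homomorphism $\bar\ell\colon F_\mathfrak{p}^*\to\mathbb{Z}/p^n$ and all $m\in MS^*(\mathfrak{n},\{\mathfrak{p}\})^{\{\mathfrak{p}\},\epsilon}$, $$c_{\bar\ell}\bigl(h_{x,\alpha}(m)\bigr)=(-1)^i\,h_{x,\alpha}\bigl(c_{\bar\ell}(m)\bigr);$$ (b) for every Iwahori-fixed $v\in\mathrm{St}_\mathfrak{p}(\mathbb{Z})$ and all $m\in MS^*(\mathfrak{n},\{\mathfrak{p}\})^{\{\mathfrak{p}\},\epsilon}$, $$\mathrm{ev}_v\bigl(h_{x,\alpha}(m)\bigr)=h_{x,\alpha}\bigl(\mathrm{ev}_v(m)\bigr).$$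 Both statements also hold with $h'_{x,\alpha}$ in place of $h_{x,\alpha}$. -/

import Mathlib

open CategoryTheory IsDedekindDomain NumberField
open scoped MatrixGroups LinearAlgebra.Projectivization RestrictedProduct

namespace DHecke

section Cohomology
universe u
variable {k G : Type u} [CommRing k] [Group G]

/-- The differential on inhomogeneous `i`-cochains, as a linear map. -/
noncomputable def dCoch (A : Rep.{u} k G) (i : ℕ) :
    ((Fin i → G) → A) →ₗ[k] ((Fin (i + 1) → G) → A) :=
  (inhomogeneousCochains.d A i).hom

/-- The inhomogeneous `i`-cocycles, as functions. -/
noncomputable def cocyc (A : Rep.{u} k G) (i : ℕ) : Submodule k ((Fin i → G) → A) :=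
  LinearMap.ker (dCoch A i)

theorem d_of_mem_cocyc (A : Rep.{u} k G) (i : ℕ) :
    ModuleCat.ofHom (cocyc A i).subtype ≫
      (groupCohomology.inhomogeneousCochains A).d i (i + 1) = 0 := by
  ext x
  have : dCoch A i x.1 = 0 := x.2
  rw [dCoch] at this
  simp only [CochainComplex.of_d]
  exact congr_fun this _

/-- Inhomogeneous cocycles, as elements of the kernel object of the differential. -/
noncomputable def toCocycles (A : Rep.{u} k G) (i : ℕ) :
    cocyc A i →ₗ[k] groupCohomology.cocycles A i :=
  ((groupCohomology.inhomogeneousCochains A).liftCycles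
    (ModuleCat.ofHom (cocyc A i).subtype) (i + 1) (by simp) (d_of_mem_cocyc A i)).hom

theorem iCocycles_toCocycles (A : Rep.{u} k G) (i : ℕ) (x : cocyc A i) :
    groupCohomology.iCocycles A i (toCocycles A i x) = x.1 :=
  congr($(HomologicalComplex.liftCycles_i (groupCohomology.inhomogeneousCochains A)
    (ModuleCat.ofHom (cocyc A i).subtype) (i + 1) (by simp) (d_of_mem_cocyc A i)) x)

theorem iCocycles_injective (A : Rep.{u} k G) (i : ℕ) :
    Function.Injective (groupCohomology.iCocycles A i) :=
  (ModuleCat.mono_iff_injective (groupCohomology.iCocycles A i)).1 inferInstance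

/-- The cohomology class of an inhomogeneous cocycle. -/
noncomputable def cohMk (A : Rep.{u} k G) (i : ℕ) : cocyc A i →ₗ[k] groupCohomology A i :=
  (groupCohomology.π A i).hom ∘ₗ toCocycles A i

theorem cohMk_surjective (A : Rep.{u} k G) (i : ℕ) : Function.Surjective (cohMk A i) := by
  intro x
  induction x using groupCohomology_induction_on with
  | h z =>
    have hz : groupCohomology.iCocycles A i z ∈ cocyc A i := by
      have := (groupCohomology.inhomogeneousCochains A).iCycles_d i (i + 1)
      rw [groupCohomology.inhomogeneousCochains.d_def] at this
      exact congr($this z)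
    refine ⟨⟨_, hz⟩, congr_arg (groupCohomology.π A i) ?_⟩
    exact iCocycles_injective A i (iCocycles_toCocycles A i _)

theorem cohMk_d (A : Rep.{u} k G) (i : ℕ) (f : (Fin i → G) → A)
    (h : dCoch A i f ∈ cocyc A (i + 1)) : cohMk A (i + 1) ⟨dCoch A i f, h⟩ = 0 := by
  have h1 := (groupCohomology.inhomogeneousCochains A).toCycles_comp_homologyπ i (i + 1)
  have h2 := congr($h1 f)
  rw [ModuleCat.comp_apply] at h2
  refine Eq.trans (congr_arg (groupCohomology.π A (i + 1)) ?_) h2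
  apply iCocycles_injective A (i + 1)
  rw [iCocycles_toCocycles, ← ModuleCat.comp_apply,
    HomologicalComplex.toCycles_i, groupCohomology.inhomogeneousCochains.d_def]
  rfl

/-- The inhomogeneous `i`-coboundaries. -/
noncomputable def cobdry (A : Rep.{u} k G) : (i : ℕ) → Submodule k ((Fin i → G) → A)
  | 0 => ⊥
  | i + 1 => LinearMap.range (dCoch A i)

theorem cohMk_eq_zero_iff (A : Rep.{u} k G) (i : ℕ) (x : cocyc A i) :
    cohMk A i x = 0 ↔ x.1 ∈ cobdry A i := by
  have key : ∀ (j : ℕ), (ComplexShape.up ℕ).prev i = j → cohMk A i x = 0 →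
      ∃ y, (groupCohomology.inhomogeneousCochains A).d j i y = x.1 := by
    intro j hj hx
    have hex := ShortComplex.exact_of_g_is_cokernel
      (ShortComplex.mk ((groupCohomology.inhomogeneousCochains A).toCycles j i)
        (groupCohomology.π A i) ((groupCohomology.inhomogeneousCochains A).toCycles_comp_homologyπ j i))
      ((groupCohomology.inhomogeneousCochains A).homologyIsCokernel j i hj)
    obtain ⟨y, hy⟩ := (ShortComplex.moduleCat_exact_iff _).1 hex _ hx
    refine ⟨y, ?_⟩
    have h3 := congr(groupCohomology.iCocycles A i $hy)
    dsimp only at h3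
    rw [← ModuleCat.comp_apply, HomologicalComplex.toCycles_i] at h3
    exact h3.trans (iCocycles_toCocycles A i x)
  constructor
  · intro hx
    cases i with
    | zero =>
      obtain ⟨y, hy⟩ := key 0 (by simp) hx
      rw [HomologicalComplex.shape _ _ _ (by simp)] at hy
      have h0 : x.1 = 0 := hy.symm
      rw [h0]
      exact (⊥ : Submodule k ((Fin 0 → G) → A)).zero_mem
    | succ i =>
      obtain ⟨y, hy⟩ := key i (by simp) hx
      rw [groupCohomology.inhomogeneousCochains.d_def] at hy
      exact ⟨y, hy⟩
  · intro hx
    cases i with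
    | zero =>
      have : x = 0 := Subtype.ext ((Submodule.mem_bot k).1 hx)
      rw [this, map_zero]
    | succ i =>
      obtain ⟨x, hx'⟩ := x
      obtain ⟨y, rfl⟩ := hx
      exact cohMk_d A i y hx'

/-- A linear map on cocycles which vanishes on coboundaries descends to cohomology. -/
noncomputable def cohDesc (A : Rep.{u} k G) (i : ℕ) {M : Type*} [AddCommGroup M] [Module k M]
    (L : cocyc A i →ₗ[k] M) (hL : ∀ x : cocyc A i, x.1 ∈ cobdry A i → L x = 0) :
    groupCohomology A i →ₗ[k] M :=
  (LinearMap.ker (cohMk A i)).liftQ L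
    (fun x hx => hL x ((cohMk_eq_zero_iff A i x).1 (LinearMap.mem_ker.1 hx))) ∘ₗ
    ((cohMk A i).quotKerEquivOfSurjective (cohMk_surjective A i)).symm.toLinearMap

@[simp] theorem cohDesc_cohMk (A : Rep.{u} k G) (i : ℕ) {M : Type*} [AddCommGroup M] [Module k M]
    (L : cocyc A i →ₗ[k] M) (hL : ∀ x : cocyc A i, x.1 ∈ cobdry A i → L x = 0) (x : cocyc A i) :
    cohDesc A i L hL (cohMk A i x) = L x := by
  have : ((cohMk A i).quotKerEquivOfSurjective (cohMk_surjective A i)).symm (cohMk A i x)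
      = Submodule.Quotient.mk x := by
    rw [LinearEquiv.symm_apply_eq]; rfl
  simp only [cohDesc, LinearMap.comp_apply, LinearEquiv.coe_coe, this]
  exact Submodule.liftQ_apply _ _ _

/-- The cup product of inhomogeneous cochains with respect to a bilinear pairing `β`:
`(f ∪ g)(x₁, …, xᵢ₊ⱼ) = β (f(x₁, …, xᵢ)) (x₁ ⋯ xᵢ • g(xᵢ₊₁, …, xᵢ₊ⱼ))`. -/
noncomputable def cupCoch {A B C : Rep.{u} k G} (β : A →ₗ[k] B →ₗ[k] C) (i j : ℕ) :
    ((Fin i → G) → A) →ₗ[k] ((Fin j → G) → B) →ₗ[k] ((Fin (i + j) → G) → C) :=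
  LinearMap.mk₂ k
    (fun f g x => β (f fun a => x (Fin.castAdd j a))
      (B.ρ (List.ofFn fun a : Fin i => x (Fin.castAdd j a)).prod (g fun b => x (Fin.natAdd i b))))
    (fun f f' g => by ext x; simp) (fun c f g => by ext x; simp)
    (fun f g g' => by ext x; simp) (fun c f g => by ext x; simp)

section Leibniz

def cN (m : ℕ) (y : ℕ → G) (a : ℕ) : G :=
  if a < m then y a else if a = m then y a * y (a + 1) else y (a + 1)

def pN (y : ℕ → G) (m : ℕ) : G := (List.ofFn fun a : Fin m => y a).prod

theorem exists_nat_ext {n : ℕ} (x : Fin n → G) :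
    ∃ y : ℕ → G, x = fun a : Fin n => y a :=
  ⟨fun a => if h : a < n then x ⟨a, h⟩ else 1, by ext a; simp⟩

theorem pN_succ (y : ℕ → G) (m : ℕ) : pN y (m + 1) = pN y m * y m := by
  simp only [pN, List.ofFn_succ', List.concat_eq_append, List.prod_append, List.prod_singleton]
  rfl

theorem pN_succ' (y : ℕ → G) (m : ℕ) :
    pN y (m + 1) = y 0 * pN (fun a => y (a + 1)) m := by
  simp [pN, List.ofFn_succ]

theorem pN_cN_of_lt (y : ℕ → G) (m l : ℕ) (h : l < m) :
    pN (cN l y) m = pN y (m + 1) := by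
  induction m with
  | zero => omega
  | succ m ih =>
    rcases Nat.lt_or_ge l m with h' | h'
    · rw [pN_succ, ih h', pN_succ y (m + 1)]
      simp [cN, h'.ne', Nat.not_lt.2 h'.le]
    · obtain rfl : l = m := by omega
      have : pN (cN l y) l = pN y l := by
        unfold pN; congr 2; ext a; simp [cN, a.2]
      rw [pN_succ, this, pN_succ y (l + 1), pN_succ y l]
      simp [cN, mul_assoc]

theorem pN_cN_of_ge (y : ℕ → G) (m l : ℕ) (h : m ≤ l) :
    pN (cN l y) m = pN y m := by
  unfold pN; congr 2; ext a; simp [cN, lt_of_lt_of_le a.2 h]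

theorem contractNth_nat {n : ℕ} (j : Fin (n + 1)) (y : ℕ → G) :
    Fin.contractNth j (· * ·) (fun a : Fin (n + 1) => y a) = fun a : Fin n => cN j y a := by
  ext a
  simp only [Fin.contractNth, cN]
  rfl

theorem dCoch_nat (A : Rep.{u} k G) {i : ℕ} (f : (Fin i → G) → A) (y : ℕ → G) :
    dCoch A i f (fun a => y a) = A.ρ (y 0) (f fun a => y (a + 1)) +
      ∑ m ∈ Finset.range (i + 1), (-1 : k) ^ (m + 1) • f (fun a => cN m y a) := by
  rw [dCoch, inhomogeneousCochains.d_hom_apply]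
  congr 1
  rw [← Fin.sum_univ_eq_sum_range (fun m => (-1 : k) ^ (m + 1) • f (fun a => cN m y a))]
  simp_rw [contractNth_nat]

theorem cupCoch_nat {A B C : Rep.{u} k G} (β : A →ₗ[k] B →ₗ[k] C) {i j : ℕ}
    (f : (Fin i → G) → A) (g : (Fin j → G) → B) (y : ℕ → G) :
    cupCoch β i j f g (fun a => y a) =
      β (f fun a => y a) (B.ρ (pN y i) (g fun b => y (i + b))) := rfl

theorem leibniz {A B C : Rep.{u} k G} (β : A →ₗ[k] B →ₗ[k] C)
    (hβ : ∀ g a b, C.ρ g (β a b) = β (A.ρ g a) (B.ρ g b)) {i j : ℕ}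
    (f : (Fin i → G) → A) (g : (Fin j → G) → B) (y : ℕ → G) :
    dCoch C (i + j) (cupCoch β i j f g) (fun a => y a) =
      β (dCoch A i f fun a => y a) (B.ρ (pN y (i + 1)) (g fun b => y (i + 1 + b))) +
      (-1 : k) ^ i • β (f fun a => y a) (B.ρ (pN y i) (dCoch B j g fun b => y (i + b))) := by
  have hd := dCoch_nat B g (fun b => y (i + b))
  rw [dCoch_nat, dCoch_nat, hd, cupCoch_nat β f g (fun a => y (a + 1)), hβ, ← Module.End.mul_apply,
    ← map_mul, ← pN_succ', add_assoc i j 1, Finset.sum_range_add, Finset.sum_range_succ _ i]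
  have e1 : ∀ m ∈ Finset.range i, (-1 : k) ^ (m + 1) • cupCoch β i j f g (fun a => cN m y a) =
      (-1 : k) ^ (m + 1) • β (f fun a => cN m y a)
        (B.ρ (pN y (i + 1)) (g fun b => y (i + 1 + b))) := by
    intro m hm
    have hm := Finset.mem_range.1 hm
    rw [cupCoch_nat, pN_cN_of_lt y i m hm]
    congr 5
    ext b
    simp only [cN]
    rw [if_neg (by omega), if_neg (by omega)]
    congr 1; omega
  have e2 : ∀ m ∈ Finset.range (j + 1),
      (-1 : k) ^ (i + m + 1) • cupCoch β i j f g (fun a => cN (i + m) y a) =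
      (-1 : k) ^ i • (-1 : k) ^ (m + 1) • β (f fun a => y a)
        (B.ρ (pN y i) (g fun b => cN m (fun b => y (i + b)) b)) := by
    intro m hm
    rw [cupCoch_nat, pN_cN_of_ge y i (i + m) (by omega), smul_smul, ← pow_add]
    have h1 : (fun a : Fin i => cN (i + m) y a) = fun a : Fin i => y a :=
      funext fun a => if_pos (by omega)
    have h2 : (fun b : Fin j => cN (i + m) y (i + b)) =
        fun b : Fin j => cN m (fun b => y (i + b)) b := funext fun b => by simp [cN, add_assoc]
    rw [h1, h2, add_assoc]
  rw [Finset.sum_congr rfl e1, Finset.sum_congr rfl e2]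
  have e3 : (f fun a => cN i y a) = f fun a => y a := by
    congr 1; ext a; simp [cN, a.2]
  rw [e3]
  have e4 : (B.ρ (pN y i)) (B.ρ (y (i + 0)) (g fun a => y (i + (a + 1)))) =
      B.ρ (pN y (i + 1)) (g fun b => y (i + 1 + b)) := by
    rw [← Module.End.mul_apply, ← map_mul, pN_succ]
    congr 2
    ext b
    congr 1; omega
  have e5 : (fun a : Fin j => y (i + a + 1)) = fun b : Fin j => y (i + 1 + b) := by
    ext b; congr 1; omega
  simp only [map_add, LinearMap.add_apply, map_sum, map_smul, LinearMap.sum_apply,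
    LinearMap.smul_apply, smul_add, Finset.smul_sum, e4, e5, pow_succ (-1 : k) i]
  simp only [mul_neg, mul_one, neg_smul]
  abel

theorem cupCoch_mem_cocyc {A B C : Rep.{u} k G} (β : A →ₗ[k] B →ₗ[k] C)
    (hβ : ∀ g a b, C.ρ g (β a b) = β (A.ρ g a) (B.ρ g b)) {i j : ℕ}
    (f : cocyc A i) (g : cocyc B j) : cupCoch β i j f.1 g.1 ∈ cocyc C (i + j) := by
  refine LinearMap.mem_ker.2 (funext fun x => ?_)
  obtain ⟨y, rfl⟩ := exists_nat_ext x
  have hf : dCoch A i f.1 = 0 := f.2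
  have hg : dCoch B j g.1 = 0 := g.2
  rw [leibniz β hβ, hf, hg]
  simp

theorem mem_cobdry_of {C : Rep.{u} k G} {n m : ℕ} (h : m + 1 = n) (f : (Fin m → G) → C)
    (x : (Fin n → G) → C)
    (hx : ∀ y : ℕ → G, x (fun a => y a) = dCoch C m f (fun a => y a)) : x ∈ cobdry C n := by
  subst h
  refine ⟨f, funext fun z => ?_⟩
  obtain ⟨y, rfl⟩ := exists_nat_ext z
  exact (hx y).symm

theorem cupCoch_mem_cobdry_left {A B C : Rep.{u} k G} (β : A →ₗ[k] B →ₗ[k] C)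
    (hβ : ∀ g a b, C.ρ g (β a b) = β (A.ρ g a) (B.ρ g b)) {i j : ℕ}
    (f : cocyc A i) (g : cocyc B j) (hf : f.1 ∈ cobdry A i) :
    cupCoch β i j f.1 g.1 ∈ cobdry C (i + j) := by
  obtain ⟨f, hf'⟩ := f
  cases i with
  | zero =>
    have : f = 0 := hf
    subst this
    simp only [map_zero, LinearMap.zero_apply]
    exact Submodule.zero_mem _
  | succ i =>
    obtain ⟨f, rfl⟩ := hf
    refine mem_cobdry_of (by omega : i + j + 1 = i + 1 + j) (cupCoch β i j f g.1) _ fun y => ?_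
    have hg : dCoch B j g.1 = 0 := g.2
    rw [leibniz β hβ, hg, cupCoch_nat]
    simp

theorem cupCoch_mem_cobdry_right {A B C : Rep.{u} k G} (β : A →ₗ[k] B →ₗ[k] C)
    (hβ : ∀ g a b, C.ρ g (β a b) = β (A.ρ g a) (B.ρ g b)) {i j : ℕ}
    (f : cocyc A i) (g : cocyc B j) (hg : g.1 ∈ cobdry B j) :
    cupCoch β i j f.1 g.1 ∈ cobdry C (i + j) := by
  obtain ⟨g, hg'⟩ := g
  cases j with
  | zero =>
    have : g = 0 := hg
    subst this
    simp only [map_zero]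
    exact Submodule.zero_mem _
  | succ j =>
    obtain ⟨g, rfl⟩ := hg
    refine mem_cobdry_of (add_assoc i j 1) ((-1 : k) ^ i • cupCoch β i j f.1 g) _ fun y => ?_
    have hf : dCoch A i f.1 = 0 := f.2
    rw [map_smul, Pi.smul_apply, leibniz β hβ, hf, cupCoch_nat]
    simp [smul_smul, ← mul_pow]

end Leibniz

/-- The cup product `Hⁱ(G, A) × Hʲ(G, B) → Hⁱ⁺ʲ(G, C)` induced by a `G`-equivariant bilinear
pairing `β : A × B → C`. -/
noncomputable def cup {A B C : Rep.{u} k G} (β : A →ₗ[k] B →ₗ[k] C)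
    (hβ : ∀ g a b, C.ρ g (β a b) = β (A.ρ g a) (B.ρ g b)) (i j : ℕ) :
    groupCohomology A i →ₗ[k] groupCohomology B j →ₗ[k] groupCohomology C (i + j) :=
  cohDesc A i
    (LinearMap.flip (cohDesc B j
      (LinearMap.mk₂ k
        (fun g f => cohMk C (i + j) ⟨cupCoch β i j f.1 g.1, cupCoch_mem_cocyc β hβ f g⟩)
        (fun g g' f => by rw [← map_add]; congr 1; ext1; simp)
        (fun c g f => by rw [← map_smul]; congr 1; ext1; simp)
        (fun g f f' => by rw [← map_add]; congr 1; ext1; simp)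
        (fun c g f => by rw [← map_smul]; congr 1; ext1; simp))
      (fun g hg => LinearMap.ext fun f =>
        (cohMk_eq_zero_iff C _ _).2 (cupCoch_mem_cobdry_right β hβ f g hg))))
    (fun f hf => LinearMap.ext fun b => by
      obtain ⟨g, rfl⟩ := cohMk_surjective B j b
      rw [LinearMap.flip_apply, cohDesc_cohMk]
      exact (cohMk_eq_zero_iff C _ _).2 (cupCoch_mem_cobdry_left β hβ f g hf))

theorem cup_cohMk {A B C : Rep.{u} k G} (β : A →ₗ[k] B →ₗ[k] C)
    (hβ : ∀ g a b, C.ρ g (β a b) = β (A.ρ g a) (B.ρ g b)) {i j : ℕ}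
    (f : cocyc A i) (g : cocyc B j) :
    cup β hβ i j (cohMk A i f) (cohMk B j g) =
      cohMk C (i + j) ⟨cupCoch β i j f.1 g.1, cupCoch_mem_cocyc β hβ f g⟩ := by
  rw [cup, cohDesc_cohMk, LinearMap.flip_apply, cohDesc_cohMk]
  rfl

end Cohomology
end DHecke

namespace DHecke
section ContCompare

variable {k K : Type} [CommRing k] [TopologicalSpace k] [IsTopologicalRing k]
  [Group K] [TopologicalSpace K] [IsTopologicalGroup K]

/-- The trivial representation of a topological group `K` on `k`. -/
abbrev trivTop (k K : Type) [CommRing k] [TopologicalSpace k] [IsTopologicalRing k]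
    [Group K] [TopologicalSpace K] [IsTopologicalGroup K] : TopRep.{0} k K :=
  TopRep.of (ContRepresentation.trivial k K k)

/-- A nested continuous function `σ ∈ C(K, C(K, …))`, as a function of `m` variables. -/
def evN : (m : ℕ) → (TopRep.resolutionX (trivTop k K) m) →ₗ[k] ((Fin m → K) → k)
  | 0 => { toFun := fun v _ => v, map_add' := fun _ _ => rfl, map_smul' := fun _ _ => rfl }
  | m + 1 =>
    { toFun := fun (σ : C(K, TopRep.resolutionX (trivTop k K) m)) h =>
        evN m (σ (h 0)) (Fin.tail h)
      map_add' := fun σ τ => funext fun h =>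
        congr_fun ((evN m).map_add (σ (h 0)) (τ (h 0))) (Fin.tail h)
      map_smul' := fun c σ => funext fun h =>
        congr_fun ((evN m).map_smul c (σ (h 0))) (Fin.tail h) }

theorem evN_succ (m : ℕ) (σ : C(K, TopRep.resolutionX (trivTop k K) m)) (h : Fin (m + 1) → K) :
    evN (m + 1) σ h = evN m (σ (h 0)) (Fin.tail h) := rfl

theorem evN_ρ (m : ℕ) (σ : TopRep.resolutionX (trivTop k K) m) (g : K) (h : Fin m → K) :
    evN m ((TopRep.resolutionX (trivTop k K) m).ρ g σ) h = evN m σ (fun a => g⁻¹ * h a) := by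
  induction m with
  | zero => rfl
  | succ m ih =>
    exact ih (ContinuousMap.toFun σ (g⁻¹ * h 0)) (Fin.tail h)

theorem evN_d (m : ℕ) (σ : TopRep.resolutionX (trivTop k K) m) (h : Fin (m + 1) → K) :
    evN (m + 1) ((TopRep.d (trivTop k K) m).hom σ) h =
      ∑ j : Fin (m + 1), (-1 : k) ^ (j : ℕ) * evN m σ (h ∘ j.succAbove) := by
  induction m with
  | zero => simp [TopRep.d_zero]; rfl
  | succ m ih =>
    have h1 : evN (m + 2) ((TopRep.d (trivTop k K) (m + 1)).hom σ) h =
        evN (m + 1) σ (Fin.tail h) -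
        evN (m + 1) ((TopRep.d (trivTop k K) m).hom (ContinuousMap.toFun σ (h 0)))
          (Fin.tail h) := by
      rw [TopRep.hom_d_succ]
      exact congr_fun ((evN (k := k) (K := K) (m + 1)).map_sub
        (TopRep.resolutionX (trivTop k K) (m + 1) |>.ρ.coind₁ι σ (h 0))
        ((TopRep.d (trivTop k K) m).hom (ContinuousMap.toFun σ (h 0)))) _
    rw [h1, ih, Fin.sum_univ_succ (n := m + 1), sub_eq_add_neg, ← Finset.sum_neg_distrib]
    congr 1
    · simp; rfl
    · refine Finset.sum_congr rfl fun j _ => ?_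
      have : evN (m + 1) σ (h ∘ j.succ.succAbove) =
          evN m (ContinuousMap.toFun σ (h 0)) (Fin.tail h ∘ j.succAbove) := by
        change evN m (ContinuousMap.toFun σ (h (j.succ.succAbove 0)))
          (Fin.tail (h ∘ j.succ.succAbove)) = _
        rw [Fin.succ_succAbove_zero]
        refine congr_arg (evN m _) (funext fun a => ?_)
        simp [Fin.tail]
      rw [this]
      simp [pow_succ]

/-- The inhomogeneous cochain `(g₁, …, gᵢ) ↦ σ(1, g₁, g₁g₂, …, g₁⋯gᵢ)` attached to a homogeneous
continuous cochain `σ`. -/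
def inhom (i : ℕ) : TopRep.resolutionX (trivTop k K) (i + 1) →ₗ[k] ((Fin i → K) → k) :=
  (LinearMap.funLeft k k fun g : Fin i → K => Fin.partialProd g) ∘ₗ evN (i + 1)

theorem inhom_d (i : ℕ) (σ : TopRep.resolutionX (trivTop k K) (i + 1))
    (hσ : ∀ g, (TopRep.resolutionX (trivTop k K) (i + 1)).ρ g σ = σ) :
    inhom (i + 1) ((TopRep.d (trivTop k K) (i + 1)).hom σ) =
      dCoch (Rep.trivial k K k) i (inhom i σ) := by
  ext g
  simp only [inhom, LinearMap.comp_apply, LinearMap.funLeft_apply]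
  rw [evN_d, dCoch, inhomogeneousCochains.d_hom_apply, Fin.sum_univ_succ]
  congr 1
  · have h1 := evN_ρ (i + 1) σ (g 0) (Fin.partialProd g ∘ Fin.succAbove 0)
    rw [hσ] at h1
    rw [h1]
    simp only [Fin.val_zero, pow_zero, one_mul]
    refine congr_arg (evN (i + 1) σ) (funext fun a => ?_)
    simp only [Function.comp_apply, Fin.zero_succAbove, Fin.partialProd_succ', inv_mul_cancel_left]
    rfl
  · refine Finset.sum_congr rfl fun j _ => ?_
    rw [← Fin.partialProd_contractNth]
    rfl

/-- The comparison map from homogeneous continuous cochains to inhomogeneous cochains. -/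
noncomputable def contCompareCochain (k K : Type) [CommRing k] [TopologicalSpace k]
    [IsTopologicalRing k] [Group K] [TopologicalSpace K] [IsTopologicalGroup K] :
    ((forget₂ (TopModuleCat.{0} k) (ModuleCat k)).mapHomologicalComplex (.up ℕ)).obj
      (TopRep.homogeneousCochains (trivTop k K)) ⟶
    groupCohomology.inhomogeneousCochains (Rep.trivial k K k) where
  f i := ModuleCat.ofHom (inhom i ∘ₗ
    ((TopRep.resolutionX (trivTop k K) (i + 1)).ρ.invariants).subtype)
  comm' i j hij := by
    obtain rfl : i + 1 = j := hij
    refine ModuleCat.hom_ext (LinearMap.ext fun σ => ?_)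
    rw [groupCohomology.inhomogeneousCochains.d_def]
    have h2 := TopRep.homogeneousCochains.d_apply (trivTop k K) i σ
    have h1 := inhom_d i σ.1 σ.2
    refine h1.symm.trans ?_
    rw [← h2]
    rfl

/-- The natural map `Hⁱ_cont(K, k) → Hⁱ(K, k)` which forgets that cochains are continuous. -/
noncomputable def contCompare (k K : Type) [CommRing k] [TopologicalSpace k]
    [IsTopologicalRing k] [Group K] [TopologicalSpace K] [IsTopologicalGroup K] (i : ℕ) :
    continuousCohomology i (trivTop k K) →ₗ[k] groupCohomology (Rep.trivial k K k) i :=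
  ((ShortComplex.mapHomologyIso ((TopRep.homogeneousCochains (trivTop k K)).sc i)
      (forget₂ (TopModuleCat.{0} k) (ModuleCat k))).inv ≫
    HomologicalComplex.homologyMap (contCompareCochain k K) i).hom
end ContCompare
end DHecke

namespace DHecke
section FunctionSpaces

variable {𝒢 H : Type} [Group 𝒢] [Group H]
variable {W : Type} [AddCommGroup W]

/-- The space of functions `Φ : 𝒢 → Hom_ℤ(W, R)` which are right invariant under `K`. -/
def fnSpace (R : Type) [CommRing R] (W : Type) [AddCommGroup W] (K : Subgroup 𝒢) :
    Submodule R (𝒢 → (W →ₗ[ℤ] R)) where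
  carrier := {Φ | ∀ a, ∀ k ∈ K, Φ (a * k) = Φ a}
  zero_mem' _ _ _ := rfl
  add_mem' hΦ hΨ a k hk := by simp [hΦ a k hk, hΨ a k hk]
  smul_mem' c Φ hΦ a k hk := by simp [hΦ a k hk]

variable {R : Type} [CommRing R]

/-- The action of `H` on `fnSpace R W K` through `δ : H → 𝒢`, the representation `ρ` of `H` on `W`
and the sign character `ε`: `(γ • Φ)(a) = ε(γ) Φ(δ(γ)⁻¹ a) ∘ ρ(γ⁻¹)`. -/
def fnAction (R : Type) [CommRing R] (δ : H →* 𝒢) (K : Subgroup 𝒢) (ρ : Representation ℤ H W)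
    (ε : H →* ℤˣ) : Representation R H (fnSpace R W K) where
  toFun γ :=
    { toFun := fun Φ => ⟨fun a => (ε γ : ℤ) • (Φ.1 ((δ γ)⁻¹ * a) ∘ₗ ρ γ⁻¹), fun a k hk => by
        beta_reduce; rw [← mul_assoc, Φ.2 _ k hk]⟩
      map_add' := fun Φ Ψ => by ext; simp
      map_smul' := fun c Φ => by ext; simp [mul_left_comm] }
  map_one' := by ext; simp
  map_mul' γ γ' := by
    ext
    simp [mul_assoc, mul_smul]

/-- `fnSpace R W K` as a representation of `H`. -/
abbrev fnRep (R : Type) [CommRing R] (δ : H →* 𝒢) (K : Subgroup 𝒢) (ρ : Representation ℤ H W)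
    (ε : H →* ℤˣ) : Rep.{0} R H :=
  Rep.of (fnAction R δ K ρ ε)

theorem fnAction_apply (δ : H →* 𝒢) (K : Subgroup 𝒢) (ρ : Representation ℤ H W)
    (ε : H →* ℤˣ) (γ : H) (Φ : fnSpace R W K) (a : 𝒢) (w : W) :
    (fnAction R δ K ρ ε γ Φ).1 a w = (ε γ : ℤ) • Φ.1 ((δ γ)⁻¹ * a) (ρ γ⁻¹ w) := rfl

/-- Right translation `Φ ↦ Φ(· y)`, from right `K`-invariant to right `K'`-invariant functions,
where `y⁻¹ K' y ⊆ K`. -/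
def fnTrans (δ : H →* 𝒢) {K K' : Subgroup 𝒢} (ρ : Representation ℤ H W) (ε : H →* ℤˣ)
    (y : 𝒢) (hy : ∀ k ∈ K', y⁻¹ * k * y ∈ K) : fnRep R δ K ρ ε ⟶ fnRep R δ K' ρ ε :=
  Rep.ofHom
    { toFun := fun Φ => ⟨fun a => Φ.1 (a * y), fun a k hk => by
        beta_reduce; rw [← Φ.2 (a * y) _ (hy k hk)]; group⟩
      map_add' := fun _ _ => rfl
      map_smul' := fun _ _ => rfl
      isIntertwining' := fun γ => by
        ext Φ
        simp [fnAction_apply, mul_assoc] }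

/-- The sum over the right translations by representatives of the cosets `K / K'`, from right
`K'`-invariant functions to right `K`-invariant functions. -/
noncomputable def fnCores (δ : H →* 𝒢) {K K' : Subgroup 𝒢} (ρ : Representation ℤ H W)
    (ε : H →* ℤˣ) [Fintype (K ⧸ K'.subgroupOf K)] : fnRep R δ K' ρ ε ⟶ fnRep R δ K ρ ε :=
  Rep.ofHom
    { toFun := fun Φ => ⟨fun a => ∑ c : K ⧸ K'.subgroupOf K, Φ.1 (a * (c.out : K)), by
        intro a k hk
        refine Fintype.sum_equiv (MulAction.toPerm (⟨k, hk⟩ : K)) _ _ fun c => ?_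
        have h1 : (k * (c.out : K) : 𝒢)⁻¹ * ((((⟨k, hk⟩ : K) • c).out : K) : 𝒢) ∈ K' := by
          have : (((⟨k, hk⟩ : K) * c.out : K) : K ⧸ K'.subgroupOf K) =
              (((⟨k, hk⟩ : K) • c).out : K) := by
            rw [QuotientGroup.out_eq', ← smul_eq_mul, ← MulAction.Quotient.smul_coe,
              QuotientGroup.out_eq']
          exact Subgroup.mem_subgroupOf.1 (QuotientGroup.eq.1 this)
        rw [← Φ.2 _ _ h1]
        simp [mul_assoc]⟩
      map_add' := fun _ _ => by ext; simp [Finset.sum_add_distrib]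
      map_smul' := fun _ _ => by ext; simp [Finset.mul_sum]
      isIntertwining' := fun γ => by
        ext Φ
        simp [fnAction_apply, mul_assoc, Finset.smul_sum] }

/-- The pointwise product of a `Hom_ℤ(W, R)`-valued and an `R`-valued function, where an `R`-valued
function is regarded as a function with values in `Hom_ℤ(ℤ, R) = R`. -/
def fnMul (δ : H →* 𝒢) (K : Subgroup 𝒢) (ρ : Representation ℤ H W) (ε : H →* ℤˣ) :
    fnRep R δ K ρ ε →ₗ[R] fnRep R δ K (.trivial ℤ H ℤ) 1 →ₗ[R] fnRep R δ K ρ ε :=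
  LinearMap.mk₂ R
    (fun (Φ : fnSpace R W K) (Ψ : fnSpace R ℤ K) =>
      (⟨fun a => Ψ.1 a 1 • Φ.1 a, fun a k hk => by
        beta_reduce; rw [Φ.2 a k hk, Ψ.2 a k hk]⟩ : fnSpace R W K))
    (fun Φ Φ' Ψ => by ext; simp)
    (fun c Φ Ψ => by ext; simp [mul_left_comm])
    (fun Φ Ψ Ψ' => by ext; simp [add_mul])
    (fun c Φ Ψ => by ext; simp [mul_assoc])

theorem fnMul_equivariant (δ : H →* 𝒢) (K : Subgroup 𝒢) (ρ : Representation ℤ H W)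
    (ε : H →* ℤˣ) (γ : H) (Φ : fnRep R δ K ρ ε) (Ψ : fnRep R δ K (.trivial ℤ H ℤ) 1) :
    (fnRep R δ K ρ ε).ρ γ (fnMul δ K ρ ε Φ Ψ) =
      fnMul δ K ρ ε ((fnRep R δ K ρ ε).ρ γ Φ) ((fnRep R δ K (.trivial ℤ H ℤ) 1).ρ γ Ψ) := by
  refine Subtype.ext (funext fun a => LinearMap.ext fun w => ?_)
  change (ε γ : ℤ) • (Ψ.1 ((δ γ)⁻¹ * a) 1 * Φ.1 ((δ γ)⁻¹ * a) (ρ γ⁻¹ w)) =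
    (((1 : H →* ℤˣ) γ : ℤˣ) : ℤ) • Ψ.1 ((δ γ)⁻¹ * a) 1 *
      ((ε γ : ℤ) • Φ.1 ((δ γ)⁻¹ * a) (ρ γ⁻¹ w))
  simp [mul_left_comm]

/-- Restriction of representations from `𝒢` to `H` for spaces of `R`-valued functions. -/
def fnRes (R : Type) [CommRing R] (δ : H →* 𝒢) (K : Subgroup 𝒢) :
    Rep.res δ (fnRep R (MonoidHom.id 𝒢) K (.trivial ℤ 𝒢 ℤ) 1) ⟶
      fnRep R δ K (.trivial ℤ H ℤ) 1 :=
  Rep.ofHom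
    { toFun := fun Φ => Φ
      map_add' := fun _ _ => rfl
      map_smul' := fun _ _ => rfl
      isIntertwining' := fun _ => rfl }

end FunctionSpaces

section Shapiro

variable {𝒢 : Type} [Group 𝒢] {R : Type} [CommRing R]

theorem mul_out_mem (K : Subgroup 𝒢) (h : 𝒢) :
    h * ((h⁻¹ : 𝒢) : 𝒢 ⧸ K).out ∈ K := by
  have : ((h⁻¹ : 𝒢) : 𝒢 ⧸ K) = ((((h⁻¹ : 𝒢) : 𝒢 ⧸ K).out : 𝒢) : 𝒢 ⧸ K) :=
    (QuotientGroup.out_eq' _).symm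
  simpa using QuotientGroup.eq.1 this

/-- A left `K`-equivariant map `𝒢 → K` which is the identity on `K`. -/
noncomputable def shapT (K : Subgroup 𝒢) (h : 𝒢) : K :=
  ⟨h * ((h⁻¹ : 𝒢) : 𝒢 ⧸ K).out, mul_out_mem K h⟩ *
    (⟨1 * ((1⁻¹ : 𝒢) : 𝒢 ⧸ K).out, mul_out_mem K 1⟩ : K)⁻¹

theorem shapT_mul (K : Subgroup 𝒢) (k : K) (h : 𝒢) : shapT K (k * h) = k * shapT K h := by
  have : (((k * h : 𝒢)⁻¹ : 𝒢) : 𝒢 ⧸ K) = ((h⁻¹ : 𝒢) : 𝒢 ⧸ K) := by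
    rw [QuotientGroup.eq]; simp
  simp only [shapT, this]
  ext
  simp [mul_assoc]

theorem shapT_coe (K : Subgroup 𝒢) (k : K) : shapT K (k : 𝒢) = k := by
  have h1 : shapT K 1 = 1 := by simp [shapT]
  have := shapT_mul K k 1
  rwa [mul_one, h1, mul_one] at this

/-- On cochains, the inverse of the isomorphism of Shapiro's lemma:
`(g₁, …, gᵢ) ↦ (a ↦ c(…, T(a⁻¹ g₁ ⋯ gⱼ₋₁)⁻¹ T(a⁻¹ g₁ ⋯ gⱼ), …))` with `T = shapT K`. -/
noncomputable def shapCoch (K : Subgroup 𝒢) (i : ℕ) :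
    ((Fin i → K) → R) →ₗ[R]
      ((Fin i → 𝒢) → fnRep R (MonoidHom.id 𝒢) K (.trivial ℤ 𝒢 ℤ) 1) where
  toFun c g := (⟨fun a => LinearMap.toSpanSingleton ℤ R (c fun j =>
      (shapT K (a⁻¹ * Fin.partialProd g j.castSucc))⁻¹ *
        shapT K (a⁻¹ * Fin.partialProd g j.succ)), fun a k hk => by
      have : ∀ x : 𝒢, shapT K ((a * k)⁻¹ * x) = (⟨k, hk⟩ : K)⁻¹ * shapT K (a⁻¹ * x) := by
        intro x
        rw [← shapT_mul]
        congr 1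
        simp [mul_assoc]
      simp only [this]
      simp [mul_assoc]⟩ : fnSpace R ℤ K)
  map_add' c c' := by ext; simp
  map_smul' r c := by ext; simp

theorem partialProd_nat (y : ℕ → 𝒢) (n : ℕ) (j : Fin (n + 1)) :
    Fin.partialProd (fun a : Fin n => y a) j = pN y j := by
  induction j using Fin.induction with
  | zero => simp [pN]
  | succ j ih => rw [Fin.partialProd_succ, ih, Fin.val_succ, pN_succ]; rfl

/-- The arguments in `shapCoch`, for sequences. -/
noncomputable def shapSeq (K : Subgroup 𝒢) (a : 𝒢) (y : ℕ → 𝒢) (m : ℕ) : K :=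
  (shapT K (a⁻¹ * pN y m))⁻¹ * shapT K (a⁻¹ * pN y (m + 1))

theorem shapCoch_nat (K : Subgroup 𝒢) (i : ℕ) (c : (Fin i → K) → R) (y : ℕ → 𝒢) (a : 𝒢) (z : ℤ) :
    (shapCoch K i c (fun j => y j)).1 a z = z • c (fun j => shapSeq K a y j) := by
  change z • c (fun j => (shapT K (a⁻¹ * Fin.partialProd (fun j : Fin i => y j) j.castSucc))⁻¹ *
    shapT K (a⁻¹ * Fin.partialProd (fun j : Fin i => y j) j.succ)) = _
  simp only [shapSeq, partialProd_nat]
  rfl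

theorem shapSeq_cN (K : Subgroup 𝒢) (a : 𝒢) (y : ℕ → 𝒢) (m : ℕ) :
    shapSeq K a (cN m y) = cN m (shapSeq K a y) := by
  funext b
  simp only [shapSeq, cN]
  rcases lt_trichotomy b m with h | h | h
  · rw [if_pos h, pN_cN_of_ge y _ _ h.le, pN_cN_of_ge y _ _ h]
  · subst h
    rw [if_neg (lt_irrefl _), if_pos rfl, pN_cN_of_ge y _ _ le_rfl,
      pN_cN_of_lt y _ _ (Nat.lt_succ_self _)]
    group
  · rw [if_neg h.not_gt, if_neg h.ne', pN_cN_of_lt y _ _ h, pN_cN_of_lt y _ _ (h.trans (Nat.lt_succ_self _))]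

theorem shapCoch_d (K : Subgroup 𝒢) (i : ℕ) (c : (Fin i → K) → R) :
    dCoch (fnRep R (MonoidHom.id 𝒢) K (.trivial ℤ 𝒢 ℤ) 1) i (shapCoch K i c) =
      shapCoch K (i + 1) (dCoch (Rep.trivial R K R) i c) := by
  funext g
  obtain ⟨y, rfl⟩ := exists_nat_ext g
  refine Subtype.ext (funext fun a => LinearMap.ext fun z => ?_)
  let E : fnSpace R ℤ K →ₗ[R] R :=
    { toFun := fun Φ => Φ.1 a z, map_add' := fun _ _ => rfl, map_smul' := fun _ _ => rfl }
  have h0 : ∀ m, shapSeq K ((y 0)⁻¹ * a) (fun b => y (b + 1)) m = shapSeq K a y (m + 1) := by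
    intro m
    simp only [shapSeq, pN_succ' y]
    simp [mul_assoc]
  have h1 : E ((fnRep R (MonoidHom.id 𝒢) K (.trivial ℤ 𝒢 ℤ) 1).ρ (y 0)
      (shapCoch K i c fun j => y (j + 1))) = z • c fun j => shapSeq K a y (j + 1) := by
    simp_rw [← h0]
    rw [← shapCoch_nat K i c (fun b => y (b + 1)) ((y 0)⁻¹ * a) z]
    exact one_smul ℤ _
  have h2 := congr_arg E (dCoch_nat (fnRep R (MonoidHom.id 𝒢) K (.trivial ℤ 𝒢 ℤ) 1)
    (shapCoch K i c) y)
  rw [shapCoch_nat]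
  refine h2.trans ?_
  rw [dCoch_nat]
  rw [map_add, map_sum, h1, smul_add, Finset.smul_sum]
  congr 1
  refine Finset.sum_congr rfl fun m _ => ?_
  rw [map_smul, smul_comm, ← shapSeq_cN, ← shapCoch_nat K i c (cN m y) a z]
  rfl

theorem shapCoch_mem (K : Subgroup 𝒢) (i : ℕ) (c : (Fin i → K) → R)
    (hc : c ∈ cocyc (Rep.trivial R K R) i) :
    shapCoch K i c ∈ cocyc (fnRep R (MonoidHom.id 𝒢) K (.trivial ℤ 𝒢 ℤ) 1) i := by
  refine LinearMap.mem_ker.2 ?_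
  rw [shapCoch_d, LinearMap.mem_ker.1 hc, map_zero]

/-- The inverse `Hⁱ(K, R) → Hⁱ(𝒢, {Φ : 𝒢 → R right K-invariant})` of the isomorphism of Shapiro's
lemma. -/
noncomputable def shapiro (K : Subgroup 𝒢) (i : ℕ) :
    groupCohomology (Rep.trivial R K R) i →ₗ[R]
      groupCohomology (fnRep R (MonoidHom.id 𝒢) K (.trivial ℤ 𝒢 ℤ) 1) i :=
  cohDesc _ i (cohMk _ i ∘ₗ (shapCoch K i).restrict (p := cocyc (Rep.trivial R K R) i)
      (q := cocyc (fnRep R (MonoidHom.id 𝒢) K (.trivial ℤ 𝒢 ℤ) 1) i) (shapCoch_mem K i))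
    (fun c hc => by
      rw [LinearMap.comp_apply, cohMk_eq_zero_iff]
      obtain ⟨c, hc'⟩ := c
      cases i with
      | zero =>
        have : c = 0 := hc
        subst this
        exact (Submodule.mem_bot R).2 (map_zero _)
      | succ i =>
        obtain ⟨b, rfl⟩ := hc
        exact ⟨shapCoch K i b, shapCoch_d K i b⟩)

/-- Evaluation at `1`, as a morphism of representations of `K`. -/
def fnEvalOne (K : Subgroup 𝒢) :
    Rep.res K.subtype (fnRep R (MonoidHom.id 𝒢) K (.trivial ℤ 𝒢 ℤ) 1) ⟶ Rep.trivial R K R :=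
  Rep.ofHom
    { toFun := fun (Φ : fnSpace R ℤ K) => Φ.1 1 1
      map_add' := fun _ _ => rfl
      map_smul' := fun _ _ => rfl
      isIntertwining' := fun γ => by
        refine LinearMap.ext fun (Φ : fnSpace R ℤ K) => ?_
        change (((1 : 𝒢 →* ℤˣ) (γ : 𝒢) : ℤˣ) : ℤ) • Φ.1 ((γ : 𝒢)⁻¹ * 1) 1 = Φ.1 1 1
        rw [MonoidHom.one_apply, Units.val_one, one_smul, mul_one, ← one_mul (γ : 𝒢)⁻¹,
          Φ.2 1 _ (K.inv_mem γ.2)] }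

theorem map_mem_cocyc {k G H : Type} [CommRing k] [Group G] [Group H] {A : Rep.{0} k H}
    {B : Rep.{0} k G} (f : G →* H) (φ : Rep.res f A ⟶ B) (i : ℕ) (x : cocyc A i) :
    (fun g : Fin i → G => φ.hom (x.1 (f ∘ g))) ∈ cocyc B i := by
  have h1 := (groupCohomology.cochainsMap f φ).comm i (i + 1)
  rw [groupCohomology.inhomogeneousCochains.d_def,
    groupCohomology.inhomogeneousCochains.d_def] at h1
  have h2 := congr($h1 x.1)
  have h3 : dCoch A i x.1 = 0 := x.2
  refine LinearMap.mem_ker.2 (h2.trans ?_)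
  refine (congr_arg ((groupCohomology.cochainsMap f φ).f (i + 1)) h3).trans ?_
  exact map_zero ((groupCohomology.cochainsMap f φ).f (i + 1)).hom

theorem map_cohMk {k G H : Type} [CommRing k] [Group G] [Group H] {A : Rep.{0} k H}
    {B : Rep.{0} k G} (f : G →* H) (φ : Rep.res f A ⟶ B) (i : ℕ) (x : cocyc A i) :
    groupCohomology.map f φ i (cohMk A i x) =
      cohMk B i ⟨fun g => φ.hom (x.1 (f ∘ g)), map_mem_cocyc f φ i x⟩ := by
  have h1 := congr($(groupCohomology.π_map f φ i) (toCocycles A i x))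
  refine h1.trans (congr_arg (groupCohomology.π B i) ?_)
  apply iCocycles_injective B i
  have h2 := congr($(HomologicalComplex.cyclesMap_i (groupCohomology.cochainsMap f φ) i)
    (toCocycles A i x))
  rw [iCocycles_toCocycles]
  refine h2.trans ?_
  rw [ModuleCat.comp_apply]
  exact congr_arg ((groupCohomology.cochainsMap f φ).f i) (iCocycles_toCocycles A i x)

/-- `shapiro` is right inverse to the map of Shapiro's lemma, which restricts to `K` and evaluates
at `1`. -/
theorem map_shapiro (K : Subgroup 𝒢) (i : ℕ) (x : groupCohomology (Rep.trivial R K R) i) :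
    groupCohomology.map K.subtype (fnEvalOne K) i (shapiro K i x) = x := by
  obtain ⟨c, rfl⟩ := cohMk_surjective _ i x
  rw [shapiro, cohDesc_cohMk, LinearMap.comp_apply, map_cohMk]
  congr 1
  refine Subtype.ext (funext fun g => ?_)
  have hP : ∀ j, Fin.partialProd (fun a => (g a : 𝒢)) j = (Fin.partialProd g j : K) := by
    intro j
    induction j using Fin.induction with
    | zero => simp
    | succ j ih => rw [Fin.partialProd_succ, Fin.partialProd_succ, ih]; rfl
  change (1 : ℤ) • c.1 (fun j =>
    (shapT K (1⁻¹ * Fin.partialProd (fun a => (g a : 𝒢)) j.castSucc))⁻¹ *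
      shapT K (1⁻¹ * Fin.partialProd (fun a => (g a : 𝒢)) j.succ)) = c.1 g
  rw [one_smul]
  refine congr_arg c.1 (funext fun j => ?_)
  rw [inv_one, one_mul, one_mul, hP, hP, shapT_coe, shapT_coe, Fin.partialProd_succ]
  group

end Shapiro

section Graded

variable {k G : Type} [CommRing k] [Group G]

/-- The total cohomology `⨁ₘ Hᵐ(G, A)`. -/
abbrev totCoh (A : Rep.{0} k G) : Type := DirectSum ℕ fun m => groupCohomology A m

/-- The map on total cohomology induced by a morphism of coefficients. -/
noncomputable def totMap {A B : Rep.{0} k G} (φ : A ⟶ B) : totCoh A →ₗ[k] totCoh B :=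
  DirectSum.lmap fun m => ((groupCohomology.functor k G m).map φ).hom

/-- The cup product `x ↦ x ∪ b` with a class `b ∈ Hʲ(G, B)`, on total cohomology. -/
noncomputable def totCup {A B C : Rep.{0} k G} (β : A →ₗ[k] B →ₗ[k] C)
    (hβ : ∀ g a b, C.ρ g (β a b) = β (A.ρ g a) (B.ρ g b)) (j : ℕ) (b : groupCohomology B j) :
    totCoh A →ₗ[k] totCoh C :=
  DirectSum.toModule k ℕ _ fun m =>
    DirectSum.lof k ℕ (fun m => groupCohomology C m) (m + j) ∘ₗ (cup β hβ m j).flip b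

end Graded
end DHecke

namespace DHecke

set_option linter.unusedSectionVars false

section Topologies

/-- The quotient topology on `PGL(n, A)`. -/
instance {A : Type} [CommRing A] [TopologicalSpace A] : TopologicalSpace PGL(2, A) :=
  inferInstanceAs (TopologicalSpace (GL (Fin 2) A ⧸ Subgroup.center (GL (Fin 2) A)))

instance {A : Type} [CommRing A] [TopologicalSpace A] [IsTopologicalRing A] :
    IsTopologicalGroup PGL(2, A) :=
  inferInstanceAs (IsTopologicalGroup (GL (Fin 2) A ⧸ Subgroup.center (GL (Fin 2) A)))

/-- The quotient topology on the projective line. -/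
instance {L : Type} [Field L] [TopologicalSpace L] : TopologicalSpace (ℙ L (Fin 2 → L)) :=
  inferInstanceAs (TopologicalSpace (Quotient (projectivizationSetoid L (Fin 2 → L))))

variable {L : Type} [Field L] [TopologicalSpace L]

theorem isQuotientMap_mk' : Topology.IsQuotientMap (Projectivization.mk' L (V := Fin 2 → L)) :=
  isQuotientMap_quot_mk

theorem GL_smul_apply {A : Type} [CommRing A] (g : GL (Fin 2) A) (v : Fin 2 → A) (i : Fin 2) :
    (g • v) i = g i 0 * v 0 + g i 1 * v 1 := by
  change ((g : Matrix (Fin 2) (Fin 2) A).mulVec v) i = _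
  simp [Matrix.mulVec, dotProduct]

theorem continuous_GL_entry {A X : Type} [CommRing A] [TopologicalSpace A] [TopologicalSpace X]
    {f : X → GL (Fin 2) A} (hf : Continuous f) (i j : Fin 2) : Continuous fun x => f x i j :=
  (Units.continuous_val.comp hf).matrix_elem i j

variable [IsTopologicalRing L]

theorem continuous_pgl_smul (g : PGL(2, L)) : Continuous fun x : ℙ L (Fin 2 → L) => g • x := by
  induction g using Matrix.ProjGenLinGroup.induction_on with | mk g =>
  refine isQuotientMap_mk'.continuous_iff.2 ?_
  have : Continuous fun v : {v : Fin 2 → L // v ≠ 0} =>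
      (⟨g • v.1, (smul_ne_zero_iff_ne g).2 v.2⟩ : {v : Fin 2 → L // v ≠ 0}) := by
    refine Continuous.subtype_mk (continuous_pi fun i => ?_) _
    simp only [GL_smul_apply]
    have h0 : ∀ j : Fin 2, Continuous fun v : {v : Fin 2 → L // v ≠ 0} => v.1 j := fun j =>
      (continuous_apply j).comp continuous_subtype_val
    exact (continuous_const.mul (h0 0)).add (continuous_const.mul (h0 1))
  exact isQuotientMap_mk'.continuous.comp this

/-- Translation by an element of `PGL₂(L)`, as a continuous map. -/
def pglTranslate (g : PGL(2, L)) : C(ℙ L (Fin 2 → L), ℙ L (Fin 2 → L)) :=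
  ⟨fun x => g • x, continuous_pgl_smul g⟩

end Topologies

section Steinberg

variable (L : Type) [Field L] [TopologicalSpace L] [IsTopologicalRing L]
variable (R : Type) [CommRing R]

/-- The representation of `PGL₂(L)` on the locally constant functions on the projective line. -/
noncomputable def lcRep : Representation R PGL(2, L) (LocallyConstant (ℙ L (Fin 2 → L)) R) where
  toFun g := LocallyConstant.comapₗ R (pglTranslate g⁻¹)
  map_one' := by ext f x; simp [pglTranslate]
  map_mul' g h := by ext f x; simp [pglTranslate, mul_smul]

/-- The submodule of constant functions. -/
def constFns : Submodule R (LocallyConstant (ℙ L (Fin 2 → L)) R) :=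
  LinearMap.range (LocallyConstant.constₗ R)

/-- The Steinberg module `C⁰(ℙ¹(L), R) / R`. -/
abbrev St : Type := LocallyConstant (ℙ L (Fin 2 → L)) R ⧸ constFns L R

/-- The Steinberg representation of `PGL₂(L)`. -/
noncomputable def stAction : Representation R PGL(2, L) (St L R) :=
  (lcRep L R).quotient (constFns L R) (by
    rintro g _ ⟨c, rfl⟩
    exact ⟨c, rfl⟩)

/-- The Steinberg representation, as an object of the category of representations. -/
noncomputable abbrev stRep : Rep.{0} R PGL(2, L) := Rep.of (stAction L R)

/-- Reduction `St(ℤ) → St(ℤ/N)` of coefficients. -/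
noncomputable def stRed (N : ℕ) : St L ℤ →ₗ[ℤ] St L (ZMod N) :=
  Submodule.mapQ (constFns L ℤ) ((constFns L (ZMod N)).restrictScalars ℤ)
    (LocallyConstant.mapₗ ℤ (Int.castAddHom (ZMod N)).toIntLinearMap) (by
      rintro _ ⟨c, rfl⟩
      exact ⟨(c : ZMod N), rfl⟩)


theorem stRed_mk (N : ℕ) (f : LocallyConstant (ℙ L (Fin 2 → L)) ℤ) :
    stRed L N (Submodule.Quotient.mk f) =
      Submodule.Quotient.mk (f.map fun z : ℤ => (z : ZMod N)) := rfl

theorem stRed_surjective (N : ℕ) : Function.Surjective (stRed L N) := by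
  intro x
  obtain ⟨f, rfl⟩ := Submodule.Quotient.mk_surjective _ x
  choose s hs using ZMod.intCast_surjective (n := N)
  refine ⟨Submodule.Quotient.mk (f.map s), ?_⟩
  rw [stRed_mk]
  congr 1
  ext x
  exact hs (f x)

theorem exists_of_stRed_eq_zero (N : ℕ) (x : St L ℤ) (hx : stRed L N x = 0) :
    ∃ y : St L ℤ, x = (N : ℤ) • y := by
  obtain ⟨f, rfl⟩ := Submodule.Quotient.mk_surjective _ x
  rw [stRed_mk] at hx
  obtain ⟨c, hc⟩ := (Submodule.Quotient.mk_eq_zero _).1 hx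
  obtain ⟨c, rfl⟩ := ZMod.intCast_surjective c
  have hdvd : ∀ x, (N : ℤ) ∣ f x - c := by
    intro x
    have := LocallyConstant.congr_fun hc x
    have h1 : ((c : ℤ) : ZMod N) = ((f x : ℤ) : ZMod N) := this
    exact (ZMod.intCast_eq_intCast_iff_dvd_sub _ _ _).1 h1
  refine ⟨Submodule.Quotient.mk (f.map fun z => (z - c) / N), ?_⟩
  rw [← Submodule.Quotient.mk_smul, Submodule.Quotient.eq]
  refine ⟨c, ?_⟩
  ext x
  have h2 := Int.mul_ediv_cancel' (hdvd x)
  change c = f x - (N : ℤ) * ((f x - c) / N)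
  rw [h2]
  ring

/-- The extension of a homomorphism `St(ℤ) → ℤ/N` to `St(ℤ/N) = St(ℤ) ⊗ ℤ/N`. -/
noncomputable def stExt (N : ℕ) (φ : St L ℤ →ₗ[ℤ] ZMod N) : St L (ZMod N) →ₗ[ℤ] ZMod N :=
  (LinearMap.ker (stRed L N)).liftQ φ (fun x hx => by
    obtain ⟨y, rfl⟩ := exists_of_stRed_eq_zero L N x hx
    rw [LinearMap.mem_ker, map_smul]
    simp) ∘ₗ ((stRed L N).quotKerEquivOfSurjective (stRed_surjective L N)).symm.toLinearMap

theorem stExt_stRed (N : ℕ) (φ : St L ℤ →ₗ[ℤ] ZMod N) (x : St L ℤ) :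
    stExt L N φ (stRed L N x) = φ x := by
  have : ((stRed L N).quotKerEquivOfSurjective (stRed_surjective L N)).symm (stRed L N x)
      = Submodule.Quotient.mk x := by
    rw [LinearEquiv.symm_apply_eq]; rfl
  simp only [stExt, LinearMap.comp_apply, LinearEquiv.coe_coe, this]
  exact Submodule.liftQ_apply _ _ _

theorem stRed_stAction (N : ℕ) (g : PGL(2, L)) (x : St L ℤ) :
    stRed L N (stAction L ℤ g x) = stAction L (ZMod N) g (stRed L N x) := by
  obtain ⟨f, rfl⟩ := Submodule.Quotient.mk_surjective _ x
  rfl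

variable {L}

/-- The pairing `(Φ, x) ↦ (a ↦ Φ(a)(x))` of `Hom_ℤ(St(ℤ), ℤ/N)`-valued functions with `St(ℤ/N)`,
with values in the `ℤ/N`-valued functions. -/
noncomputable def stPair {𝒢 H : Type} [Group 𝒢] [Group H] (N : ℕ) (δ : H →* 𝒢) (K : Subgroup 𝒢)
    (ι : H →* PGL(2, L)) (ε : H →* ℤˣ) :
    fnRep (ZMod N) δ K ((stAction L ℤ).comp ι) ε →ₗ[ZMod N]
      Rep.res ι (stRep L (ZMod N)) →ₗ[ZMod N] fnRep (ZMod N) δ K (.trivial ℤ H ℤ) ε :=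
  LinearMap.mk₂ (ZMod N)
    (fun (Φ : fnSpace (ZMod N) (St L ℤ) K) (x : St L (ZMod N)) =>
      (⟨fun a => LinearMap.toSpanSingleton ℤ (ZMod N) (stExt L N (Φ.1 a) x), fun a k hk => by
        beta_reduce; rw [Φ.2 a k hk]⟩ : fnSpace (ZMod N) ℤ K))
    (fun Φ Φ' x => by
      obtain ⟨x, rfl⟩ := stRed_surjective L N x
      refine Subtype.ext (funext fun a => LinearMap.ext_ring ?_)
      change (1 : ℤ) • stExt L N (Φ.1 a + Φ'.1 a) _ =
        (1 : ℤ) • stExt L N (Φ.1 a) _ + (1 : ℤ) • stExt L N (Φ'.1 a) _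
      simp only [stExt_stRed, one_smul, LinearMap.add_apply])
    (fun c Φ x => by
      obtain ⟨x, rfl⟩ := stRed_surjective L N x
      refine Subtype.ext (funext fun a => LinearMap.ext_ring ?_)
      change (1 : ℤ) • stExt L N (c • Φ.1 a) _ = c • (1 : ℤ) • stExt L N (Φ.1 a) _
      simp only [stExt_stRed, one_smul, LinearMap.smul_apply])
    (fun Φ x x' => by
      refine Subtype.ext (funext fun a => LinearMap.ext_ring ?_)
      change (1 : ℤ) • stExt L N (Φ.1 a) (x + x') =
        (1 : ℤ) • stExt L N (Φ.1 a) x + (1 : ℤ) • stExt L N (Φ.1 a) x'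
      simp only [map_add, one_smul])
    (fun c Φ x => by
      obtain ⟨c, rfl⟩ := ZMod.intCast_surjective c
      refine Subtype.ext (funext fun a => LinearMap.ext_ring ?_)
      change (1 : ℤ) • stExt L N (Φ.1 a) ((c : ZMod N) • x) =
        (c : ZMod N) • (1 : ℤ) • stExt L N (Φ.1 a) x
      rw [Int.cast_smul_eq_zsmul, Int.cast_smul_eq_zsmul, map_smul, one_smul, one_smul])

theorem stPair_equivariant {𝒢 H : Type} [Group 𝒢] [Group H] (N : ℕ) (δ : H →* 𝒢) (K : Subgroup 𝒢)
    (ι : H →* PGL(2, L)) (ε : H →* ℤˣ) (γ : H)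
    (Φ : fnRep (ZMod N) δ K ((stAction L ℤ).comp ι) ε) (x : Rep.res ι (stRep L (ZMod N))) :
    (fnRep (ZMod N) δ K (.trivial ℤ H ℤ) ε).ρ γ (stPair N δ K ι ε Φ x) =
      stPair N δ K ι ε ((fnRep (ZMod N) δ K ((stAction L ℤ).comp ι) ε).ρ γ Φ)
        ((Rep.res ι (stRep L (ZMod N))).ρ γ x) := by
  obtain ⟨x, rfl⟩ := stRed_surjective L N x
  refine Subtype.ext (funext fun a => LinearMap.ext_ring ?_)
  change (ε γ : ℤ) • (1 : ℤ) • stExt L N (Φ.1 ((δ γ)⁻¹ * a)) _ =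
    (1 : ℤ) • stExt L N ((ε γ : ℤ) • (Φ.1 ((δ γ)⁻¹ * a) ∘ₗ stAction L ℤ (ι γ⁻¹)))
      (stAction L (ZMod N) (ι γ) (stRed L N x))
  rw [← stRed_stAction, stExt_stRed, stExt_stRed, one_smul, one_smul, LinearMap.smul_apply,
    LinearMap.comp_apply, ← Module.End.mul_apply, ← map_mul, ← map_mul, inv_mul_cancel, map_one,
    map_one, Module.End.one_apply]

end Steinberg

end DHecke

set_option linter.unusedSectionVars false

namespace DHecke

section Extension

/-- The upper triangular matrix `(t₁ u; 0 t₂)`. -/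
def borel {A : Type} [CommRing A] (t₁ t₂ : Aˣ) (u : A) : GL (Fin 2) A where
  val := !![(t₁ : A), u; 0, (t₂ : A)]
  inv := !![((t₁⁻¹ : Aˣ) : A), -((t₁⁻¹ : Aˣ) : A) * u * ((t₂⁻¹ : Aˣ) : A); 0, ((t₂⁻¹ : Aˣ) : A)]
  val_inv := by
    ext i j; fin_cases i <;> fin_cases j <;> simp [Matrix.mul_apply, ← mul_assoc]
  inv_val := by
    ext i j; fin_cases i <;> fin_cases j <;> simp [Matrix.mul_apply, mul_assoc]

variable {L : Type} [Field L] [TopologicalSpace L] [IsTopologicalRing L]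
variable {R : Type} [CommRing R]

/-- The module of pairs `(Φ, r)` of a locally constant function `Φ : GL₂(L) → R` and `r ∈ R` such
that `Φ(g (t₁ u; 0 t₂)) = Φ(g) + r ℓ(t₁)`. -/
def extTilde (ℓ : Lˣ →* Multiplicative R) :
    Submodule R (LocallyConstant (GL (Fin 2) L) R × R) where
  carrier := {x | ∀ g t₁ t₂ u, x.1 (g * borel t₁ t₂ u) = x.1 g + x.2 * (ℓ t₁).toAdd}
  zero_mem' := by intro g t₁ t₂ u; simp
  add_mem' {x y} hx hy g t₁ t₂ u := by
    simp only [Prod.fst_add, Prod.snd_add, LocallyConstant.coe_add, Pi.add_apply, hx g t₁ t₂ u,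
      hy g t₁ t₂ u]
    ring
  smul_mem' c x hx g t₁ t₂ u := by
    simp only [Prod.smul_fst, Prod.smul_snd, LocallyConstant.coe_smul, Pi.smul_apply, smul_eq_mul,
      hx g t₁ t₂ u]
    ring

/-- Left translation on `GL₂(L)`. -/
def glTranslate (g : GL (Fin 2) L) : C(GL (Fin 2) L, GL (Fin 2) L) :=
  ⟨fun x => g * x, continuous_const.mul continuous_id⟩

/-- The action `g • (Φ, r) = (Φ(g⁻¹ ·), r)` of `GL₂(L)`. -/
def glAction (L : Type) [Field L] [TopologicalSpace L] [IsTopologicalRing L]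
    (R : Type) [CommRing R] :
    Representation R (GL (Fin 2) L) (LocallyConstant (GL (Fin 2) L) R × R) where
  toFun g := (LocallyConstant.comapₗ R (glTranslate g⁻¹)).prodMap LinearMap.id
  map_one' := by
    refine LinearMap.ext fun x => Prod.ext (LocallyConstant.ext fun y => ?_) rfl
    change x.1 (1⁻¹ * y) = x.1 y
    simp
  map_mul' g h := by
    refine LinearMap.ext fun x => Prod.ext (LocallyConstant.ext fun y => ?_) rfl
    change x.1 ((g * h)⁻¹ * y) = x.1 (h⁻¹ * (g⁻¹ * y))
    simp [mul_assoc]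

/-- The action of `GL₂(L)` on `extTilde ℓ`. -/
def extTildeAction (ℓ : Lˣ →* Multiplicative R) :
    Representation R (GL (Fin 2) L) (extTilde ℓ) :=
  (glAction L R).subrepresentation (extTilde ℓ) (fun h x hx g t₁ t₂ u => by
    change x.1 (h⁻¹ * (g * _)) = x.1 (h⁻¹ * g) + x.2 * _
    rw [← mul_assoc]
    exact hx _ _ _ _)

/-- The submodule of pairs `(Φ, 0)` with `Φ` constant. -/
def extConst (ℓ : Lˣ →* Multiplicative R) : Submodule R (extTilde ℓ) where
  carrier := {x | x.1.2 = 0 ∧ ∃ c, ∀ g, x.1.1 g = c}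
  zero_mem' := ⟨rfl, 0, fun _ => rfl⟩
  add_mem' := by
    rintro x y ⟨hx, c, hc⟩ ⟨hy, d, hd⟩
    exact ⟨by simp [hx, hy], c + d, fun g => by simp [hc, hd]⟩
  smul_mem' := by
    rintro a x ⟨hx, c, hc⟩
    exact ⟨by simp [hx], a * c, fun g => by simp [hc]⟩

/-- The quotient of `extTilde ℓ` by the constant functions. -/
abbrev Ext (ℓ : Lˣ →* Multiplicative R) : Type := extTilde ℓ ⧸ extConst ℓ

/-- The action of `PGL₂(L)` on `Ext ℓ`. -/
def extAction (ℓ : Lˣ →* Multiplicative R) : Representation R PGL(2, L) (Ext ℓ) :=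
  Matrix.ProjGenLinGroup.lift
    ((extTildeAction ℓ).quotient (extConst ℓ) (by
      rintro g x ⟨hx, c, hc⟩
      exact ⟨hx, c, fun h => hc _⟩))
    (by
      ext z : 1
      refine LinearMap.ext fun x => ?_
      obtain ⟨x, rfl⟩ := Submodule.Quotient.mk_surjective _ x
      refine (Submodule.Quotient.eq _).2 ⟨sub_self _, -(x.1.2 * (ℓ z).toAdd), fun g => ?_⟩
      change x.1.1 ((Matrix.GeneralLinearGroup.scalar (Fin 2) z)⁻¹ * g) - x.1.1 g = _
      have h1 : (Matrix.GeneralLinearGroup.scalar (Fin 2) z)⁻¹ * g = g * borel z⁻¹ z⁻¹ 0 := by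
        have h2 : (Matrix.GeneralLinearGroup.scalar (Fin 2) z)⁻¹ = borel z⁻¹ z⁻¹ 0 := by
          refine inv_eq_of_mul_eq_one_right ?_
          ext i j; fin_cases i <;> fin_cases j <;> simp [borel]
        rw [← h2, ← map_inv]
        exact Matrix.GeneralLinearGroup.scalar_commute _ g
      rw [h1, x.2]
      simp)

/-- The object of the category of representations defined by `extAction`. -/
abbrev extRep (ℓ : Lˣ →* Multiplicative R) : Rep.{0} R PGL(2, L) := Rep.of (extAction ℓ)

/-- The point `∞ = [1 : 0]` of the projective line. -/
def ptInf (L : Type) [Field L] : ℙ L (Fin 2 → L) :=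
  Projectivization.mk L ![1, 0] (fun h => one_ne_zero (congr_fun h 0))

/-- The projection `g ↦ g • ∞`. -/
def prInf : C(GL (Fin 2) L, ℙ L (Fin 2 → L)) :=
  ⟨fun g => Matrix.ProjGenLinGroup.mk g • ptInf L, by
    have : Continuous fun g : GL (Fin 2) L => (⟨g • ![1, 0], (smul_ne_zero_iff_ne g).2
        (fun h => one_ne_zero (congr_fun h 0))⟩ : {v : Fin 2 → L // v ≠ 0}) := by
      refine Continuous.subtype_mk (continuous_pi fun i => ?_) _
      simp only [GL_smul_apply]
      exact ((continuous_GL_entry continuous_id i 0).mul continuous_const).add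
        ((continuous_GL_entry continuous_id i 1).mul continuous_const)
    exact isQuotientMap_mk'.continuous.comp this⟩

theorem prInf_mul_borel (g : GL (Fin 2) L) (t₁ t₂ : Lˣ) (u : L) :
    prInf (g * borel t₁ t₂ u) = prInf g := by
  refine (Projectivization.mk_eq_mk_iff L _ _ _ _).2 ⟨t₁, ?_⟩
  change t₁ • g • (![1, 0] : Fin 2 → L) = (g * borel t₁ t₂ u) • (![1, 0] : Fin 2 → L)
  rw [mul_smul]
  ext i
  fin_cases i <;> simp [GL_smul_apply, borel, Units.smul_def, mul_comm]

theorem exists_borel_of_prInf_eq (g h : GL (Fin 2) L) (hgh : prInf g = prInf h) :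
    ∃ t₁ t₂ u, g = h * borel t₁ t₂ u := by
  obtain ⟨a, ha⟩ := (Projectivization.mk_eq_mk_iff L _ _ _ _).1 hgh
  have h0 : a • h • (![1, 0] : Fin 2 → L) = g • ![1, 0] := ha
  obtain ⟨b, hb⟩ : ∃ b, b = h⁻¹ * g := ⟨_, rfl⟩
  have h1 : b • (![1, 0] : Fin 2 → L) = a • ![1, 0] := by
    rw [hb, mul_smul, ← h0, smul_comm h⁻¹ a, inv_smul_smul]
  have h00 := congr_fun h1 0
  have h10 := congr_fun h1 1
  simp only [GL_smul_apply, Units.smul_def] at h00 h10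
  simp at h00 h10
  have hdet : (b : Matrix (Fin 2) (Fin 2) L).det ≠ 0 := b.det_ne_zero
  rw [Matrix.det_fin_two, h00, h10] at hdet
  have h11 : b 1 1 ≠ 0 := fun h => by rw [h] at hdet; simp at hdet
  refine ⟨a, Units.mk0 _ h11, b 0 1, ?_⟩
  rw [← inv_mul_eq_iff_eq_mul, ← hb]
  ext i j
  fin_cases i <;> fin_cases j <;> simp [borel, h00, h10]

/-- The matrix `(0 -1; 1 0)`. -/
def weyl (A : Type) [CommRing A] : GL (Fin 2) A where
  val := !![0, -1; 1, 0]
  inv := !![0, 1; -1, 0]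
  val_inv := by ext i j; fin_cases i <;> fin_cases j <;> simp [Matrix.mul_apply]
  inv_val := by ext i j; fin_cases i <;> fin_cases j <;> simp [Matrix.mul_apply]

/-- The matrix `(1 0; c 1)`. -/
def lowerMat (c : L) : GL (Fin 2) L :=
  weyl L * Matrix.GeneralLinearGroup.upperRightHom (-c) * (weyl L)⁻¹

/-- The matrix `(c -1; 1 0)`. -/
def upperMat (c : L) : GL (Fin 2) L :=
  Matrix.GeneralLinearGroup.upperRightHom c * weyl L

theorem continuous_lowerMat : Continuous (lowerMat (L := L)) :=
  (continuous_const.mul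
    (Matrix.GeneralLinearGroup.continuous_upperRightHom.comp continuous_neg)).mul continuous_const

theorem continuous_upperMat : Continuous (upperMat (L := L)) :=
  Matrix.GeneralLinearGroup.continuous_upperRightHom.mul continuous_const

theorem prInf_lowerMat (v : {v : Fin 2 → L // v ≠ 0}) (h : v.1 0 ≠ 0) :
    prInf (lowerMat (v.1 1 / v.1 0)) = Projectivization.mk' L v := by
  refine (Projectivization.mk_eq_mk_iff' L _ _ _ _).2 ⟨(v.1 0)⁻¹, ?_⟩
  change (v.1 0)⁻¹ • v.1 = lowerMat (v.1 1 / v.1 0) • (![1, 0] : Fin 2 → L)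
  rw [lowerMat, mul_smul, mul_smul, eq_comm]
  have h1 : (weyl L)⁻¹ • (![1, 0] : Fin 2 → L) = ![0, -1] := by
    rw [inv_smul_eq_iff]
    ext i; fin_cases i <;> simp [GL_smul_apply, weyl]
  rw [h1]
  ext i
  fin_cases i <;> simp [GL_smul_apply, weyl, h]
  field_simp

theorem prInf_upperMat (v : {v : Fin 2 → L // v ≠ 0}) (h : v.1 1 ≠ 0) :
    prInf (upperMat (v.1 0 / v.1 1)) = Projectivization.mk' L v := by
  refine (Projectivization.mk_eq_mk_iff' L _ _ _ _).2 ⟨(v.1 1)⁻¹, ?_⟩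
  change (v.1 1)⁻¹ • v.1 = upperMat (v.1 0 / v.1 1) • (![1, 0] : Fin 2 → L)
  rw [upperMat, mul_smul, eq_comm]
  ext i
  fin_cases i <;> simp [GL_smul_apply, weyl, h]
  field_simp

theorem coord_ne_zero (v : {v : Fin 2 → L // v ≠ 0}) : v.1 0 ≠ 0 ∨ v.1 1 ≠ 0 := by
  by_contra! h
  exact v.2 (by ext i; fin_cases i <;> simp [h.1, h.2])

theorem prInf_surjective : Function.Surjective (prInf (L := L)) := by
  intro x
  obtain ⟨v, rfl⟩ := isQuotientMap_mk'.surjective x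
  rcases coord_ne_zero v with h | h
  · exact ⟨_, prInf_lowerMat v h⟩
  · exact ⟨_, prInf_upperMat v h⟩

/-- A function on the projective line whose pullback to `GL₂(L)` is locally constant is locally
constant. -/
theorem isLocallyConstant_of_comp_prInf [ContinuousInv₀ L] [T1Space L]
    (f : ℙ L (Fin 2 → L) → R) (hf : IsLocallyConstant (f ∘ prInf)) : IsLocallyConstant f := by
  intro s
  refine isQuotientMap_mk'.isOpen_preimage.1 ?_
  refine isOpen_iff_mem_nhds.2 fun v hv => ?_
  have hc : ∀ j : Fin 2, Continuous fun v : {v : Fin 2 → L // v ≠ 0} => v.1 j := fun j =>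
    (continuous_apply j).comp continuous_subtype_val
  rcases coord_ne_zero v with h | h
  · have h1 : ContinuousAt (fun v : {v : Fin 2 → L // v ≠ 0} => lowerMat (v.1 1 / v.1 0)) v :=
      continuous_lowerMat.continuousAt.comp ((hc 1).continuousAt.div (hc 0).continuousAt h)
    have h2 := h1.preimage_mem_nhds ((hf s).mem_nhds (x := lowerMat (v.1 1 / v.1 0)) (by
      change f (prInf _) ∈ s
      rw [prInf_lowerMat v h]
      exact hv))
    filter_upwards [h2, (hc 0).continuousAt.eventually_ne h] with w hw hw0
    have hw' : f (prInf (lowerMat (w.1 1 / w.1 0))) ∈ s := hw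
    rwa [prInf_lowerMat w hw0] at hw'
  · have h1 : ContinuousAt (fun v : {v : Fin 2 → L // v ≠ 0} => upperMat (v.1 0 / v.1 1)) v :=
      continuous_upperMat.continuousAt.comp ((hc 0).continuousAt.div (hc 1).continuousAt h)
    have h2 := h1.preimage_mem_nhds ((hf s).mem_nhds (x := upperMat (v.1 0 / v.1 1)) (by
      change f (prInf _) ∈ s
      rw [prInf_upperMat v h]
      exact hv))
    filter_upwards [h2, (hc 1).continuousAt.eventually_ne h] with w hw hw0
    have hw' : f (prInf (upperMat (w.1 0 / w.1 1))) ∈ s := hw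
    rwa [prInf_upperMat w hw0] at hw'

/-- The map `pr^* : St(R) → Ext ℓ`, `f ↦ (f ∘ pr, 0)`. -/
noncomputable def stToExt (ℓ : Lˣ →* Multiplicative R) : stRep L R ⟶ extRep ℓ :=
  Rep.ofHom
    { toLinearMap := Submodule.mapQ (constFns L R) (extConst ℓ)
        (LinearMap.codRestrict (extTilde ℓ)
          (LinearMap.inl R _ R ∘ₗ LocallyConstant.comapₗ R prInf) (fun f g t₁ t₂ u => by
            simp [prInf_mul_borel])) (by
          rintro _ ⟨c, rfl⟩
          exact ⟨rfl, c, fun _ => rfl⟩)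
      isIntertwining' := fun g => by
        induction g using Matrix.ProjGenLinGroup.induction_on with | mk g =>
        refine LinearMap.ext fun x => ?_
        obtain ⟨f, rfl⟩ := Submodule.Quotient.mk_surjective _ x
        refine congr_arg (Submodule.Quotient.mk (p := extConst ℓ)) (Subtype.ext
          (Prod.ext (LocallyConstant.ext fun y => ?_) rfl))
        change f ((Matrix.ProjGenLinGroup.mk g)⁻¹ • Matrix.ProjGenLinGroup.mk y • ptInf L) =
          f (Matrix.ProjGenLinGroup.mk (g⁻¹ * y) • ptInf L)
        rw [map_mul, map_inv, mul_smul] }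

/-- The map `Ext ℓ → R`, `(Φ, r) ↦ r`. -/
noncomputable def extToTriv (ℓ : Lˣ →* Multiplicative R) :
    extRep ℓ ⟶ Rep.trivial R PGL(2, L) R :=
  Rep.ofHom
    { toLinearMap := (extConst ℓ).liftQ (LinearMap.snd R _ R ∘ₗ (extTilde ℓ).subtype)
        (fun _ hx => hx.1)
      isIntertwining' := fun g => by
        induction g using Matrix.ProjGenLinGroup.induction_on with | mk g =>
        refine LinearMap.ext fun x => ?_
        obtain ⟨f, rfl⟩ := Submodule.Quotient.mk_surjective _ x
        rfl }

/-- The sequence `0 → St(R) → Ext ℓ → R → 0`. -/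
noncomputable def extSeq (ℓ : Lˣ →* Multiplicative R) : ShortComplex (Rep.{0} R PGL(2, L)) where
  f := stToExt ℓ
  g := extToTriv ℓ
  zero := by
    refine Rep.hom_ext (Representation.IntertwiningMap.ext (LinearMap.ext fun x => ?_))
    obtain ⟨f, rfl⟩ := Submodule.Quotient.mk_surjective _ x
    rfl

theorem stToExt_injective (ℓ : Lˣ →* Multiplicative R) : Function.Injective (stToExt ℓ).hom := by
  refine (injective_iff_map_eq_zero (stToExt ℓ).hom.toLinearMap).2 fun x hx => ?_
  obtain ⟨f, rfl⟩ := Submodule.Quotient.mk_surjective _ x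
  obtain ⟨-, c, hc⟩ := (Submodule.Quotient.mk_eq_zero (extConst ℓ)).1 hx
  refine (Submodule.Quotient.mk_eq_zero _).2 ⟨c, LocallyConstant.ext fun x => ?_⟩
  obtain ⟨g, rfl⟩ := prInf_surjective x
  exact (hc g).symm

theorem stToExt_exact [ContinuousInv₀ L] [T1Space L] (ℓ : Lˣ →* Multiplicative R) (x : Ext ℓ)
    (hx : (extToTriv ℓ).hom x = 0) : ∃ y, (stToExt ℓ).hom y = x := by
  obtain ⟨⟨⟨Φ, r⟩, hΦ⟩, rfl⟩ := Submodule.Quotient.mk_surjective _ x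
  obtain rfl : r = 0 := hx
  have h1 : ∀ g, Φ (Function.surjInv prInf_surjective (prInf g)) = Φ g := by
    intro g
    obtain ⟨t₁, t₂, u, h⟩ := exists_borel_of_prInf_eq
      (Function.surjInv prInf_surjective (prInf g)) g (Function.surjInv_eq _ _)
    rw [h]
    have := hΦ g t₁ t₂ u
    simpa using this
  have h2 : (fun x => Φ (Function.surjInv prInf_surjective x)) ∘ prInf = Φ := funext h1
  refine ⟨Submodule.Quotient.mk ⟨fun x => Φ (Function.surjInv prInf_surjective x),
    isLocallyConstant_of_comp_prInf _ (by rw [h2]; exact Φ.isLocallyConstant)⟩, ?_⟩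
  refine congr_arg (Submodule.Quotient.mk (p := extConst ℓ)) (Subtype.ext
    (Prod.ext (LocallyConstant.ext fun g => ?_) rfl))
  exact h1 g

end Extension

section Splitting

variable {L : Type} [Field L] {Γ₀ : Type} [LinearOrderedCommGroupWithZero Γ₀] [Valued L Γ₀]
variable {R : Type} [CommRing R]

open Classical in
/-- The function `a ↦ ℓ(a)`, extended by `0` to `a = 0`. -/
noncomputable def ellFn (ℓ : Lˣ →* Multiplicative R) (a : L) : R :=
  if h : a = 0 then 0 else (ℓ (Units.mk0 a h)).toAdd

theorem ellFn_eventually (ℓ : Lˣ →* Multiplicative R) (hℓ : IsLocallyConstant ℓ) (a : L)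
    (ha : a ≠ 0) : ∀ᶠ b in nhds a, ellFn ℓ b = ellFn ℓ a := by
  obtain ⟨U, hU, h1⟩ := Units.isEmbedding_val₀.isInducing.isOpen_iff.1
    (hℓ.isOpen_fiber (ℓ (Units.mk0 a ha)))
  have h2 : a ∈ U := by
    have : Units.mk0 a ha ∈ Units.val ⁻¹' U := by rw [h1]; rfl
    exact this
  filter_upwards [hU.mem_nhds h2, isOpen_ne.mem_nhds ha] with b hb hb0
  have h3 : Units.mk0 b hb0 ∈ Units.val ⁻¹' U := hb
  rw [h1] at h3
  rw [ellFn, ellFn, dif_neg hb0, dif_neg ha, show ℓ (Units.mk0 b hb0) = ℓ (Units.mk0 a ha) from h3]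

theorem ellFn_mul (ℓ : Lˣ →* Multiplicative R) (a : L) (ha : a ≠ 0) (t : Lˣ) :
    ellFn ℓ (a * t) = ellFn ℓ a + (ℓ t).toAdd := by
  have h : a * t ≠ 0 := mul_ne_zero ha t.ne_zero
  rw [ellFn, ellFn, dif_neg h, dif_neg ha, ← toAdd_mul, ← map_mul]
  congr 2
  ext
  rfl

theorem val_lt_eventually (a c : L) (h : Valued.v c < Valued.v a) :
    ∀ᶠ d in nhds c, Valued.v d < Valued.v a := by
  have h1 := (Valued.isOpen_ball L (Valued.v.restrict a)).mem_nhds (x := c)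
    (Valued.v.restrict_lt_iff.2 h)
  filter_upwards [h1] with d hd
  exact Valued.v.restrict_lt_iff.1 hd

theorem val_le_eventually (a c : L) (hc : c ≠ 0) (h : Valued.v a ≤ Valued.v c) :
    ∀ᶠ b in nhds a, Valued.v b ≤ Valued.v c := by
  have h1 := (Valued.isOpen_closedBall L (r := Valued.v.restrict c) (by simp [hc])).mem_nhds (x := a)
    (Valued.v.restrict_le_iff.2 h)
  filter_upwards [h1] with d hd
  exact Valued.v.restrict_le_iff.1 hd

theorem ne_zero_of_not_lt (g : GL (Fin 2) L) (h : ¬ Valued.v (g 1 0) < Valued.v (g 0 0)) :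
    g 1 0 ≠ 0 := by
  intro h0
  rw [h0, map_zero, not_lt, le_zero_iff, map_eq_zero] at h
  refine g.det_ne_zero ?_
  rw [Matrix.det_fin_two, h0, h]
  simp

open Classical in
/-- The function `(a b; c d) ↦ ℓ(a)` if `ord(a) < ord(c)`, and `ℓ(c)` otherwise. -/
noncomputable def splitFn (ℓ : Lˣ →* Multiplicative R) (g : GL (Fin 2) L) : R :=
  if Valued.v (g 1 0) < Valued.v (g 0 0) then ellFn ℓ (g 0 0) else ellFn ℓ (g 1 0)

theorem splitFn_isLocallyConstant (ℓ : Lˣ →* Multiplicative R) (hℓ : IsLocallyConstant ℓ) :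
    IsLocallyConstant (splitFn ℓ) := by
  refine (IsLocallyConstant.iff_eventually_eq _).2 fun g => ?_
  have hc : ∀ i j : Fin 2, Filter.Tendsto (fun g : GL (Fin 2) L => g i j) (nhds g)
      (nhds (g i j)) := fun i j => (continuous_GL_entry continuous_id i j).continuousAt
  by_cases h : Valued.v (g 1 0) < Valued.v (g 0 0)
  · have ha : g 0 0 ≠ 0 := fun h0 => by rw [h0, map_zero] at h; exact not_lt_zero h
    filter_upwards [(hc 1 0).eventually (val_lt_eventually _ _ h),
      (hc 0 0).eventually (Valued.locally_const ((map_ne_zero _).2 ha)),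
      (hc 0 0).eventually (ellFn_eventually ℓ hℓ _ ha)] with x h1 h2 h3
    rw [splitFn, splitFn, if_pos h, if_pos (h1.trans_eq (Eq.symm h2)), h3]
  · have hc0 := ne_zero_of_not_lt g h
    filter_upwards [(hc 0 0).eventually (val_le_eventually _ _ hc0 (not_lt.1 h)),
      (hc 1 0).eventually (Valued.locally_const ((map_ne_zero _).2 hc0)),
      (hc 1 0).eventually (ellFn_eventually ℓ hℓ _ hc0)] with x h1 h2 h3
    rw [splitFn, splitFn, if_neg h, if_neg (not_lt.2 (h1.trans_eq (Eq.symm h2))), h3]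

theorem splitFn_mul_borel (ℓ : Lˣ →* Multiplicative R) (g : GL (Fin 2) L) (t₁ t₂ : Lˣ) (u : L) :
    splitFn ℓ (g * borel t₁ t₂ u) = splitFn ℓ g + (ℓ t₁).toAdd := by
  have h : ∀ i, (g * borel t₁ t₂ u) i 0 = g i 0 * t₁ := fun i => by
    simp [borel, Matrix.mul_apply]
  have ht : 0 < Valued.v (t₁ : L) := zero_lt_iff.2 ((map_ne_zero _).2 t₁.ne_zero)
  simp only [splitFn, h, map_mul, mul_lt_mul_iff_left₀ ht]
  split_ifs with h1
  · exact ellFn_mul ℓ _ (fun h0 => by rw [h0, map_zero] at h1; exact not_lt_zero h1) _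
  · exact ellFn_mul ℓ _ (ne_zero_of_not_lt g h1) _

theorem extToTriv_surjective (ℓ : Lˣ →* Multiplicative R) (hℓ : IsLocallyConstant ℓ) :
    Function.Surjective (extToTriv ℓ).hom := by
  intro r
  have hmem : ((⟨splitFn ℓ, splitFn_isLocallyConstant ℓ hℓ⟩ : LocallyConstant (GL (Fin 2) L) R),
      (1 : R)) ∈ extTilde ℓ := fun g t₁ t₂ u => by
    change splitFn ℓ _ = splitFn ℓ _ + 1 * _
    rw [splitFn_mul_borel, one_mul]
  let x : Ext ℓ := Submodule.Quotient.mk ⟨_, hmem⟩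
  refine ⟨r • x, ?_⟩
  have h1 : (extToTriv ℓ).hom x = 1 := rfl
  exact ((extToTriv ℓ).hom.toLinearMap.map_smul r x).trans ((congr_arg (r • ·) h1).trans (mul_one r))

theorem extSeq_shortExact (ℓ : Lˣ →* Multiplicative R) (hℓ : IsLocallyConstant ℓ) :
    (extSeq ℓ).ShortExact where
  exact := (forget₂ (Rep.{0} R PGL(2, L)) (ModuleCat R)).reflects_exact_of_faithful _ <|
    (ShortComplex.moduleCat_exact_iff _).2 fun x hx => stToExt_exact ℓ x hx
  mono_f := (Rep.mono_iff_injective _).2 (stToExt_injective ℓ)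
  epi_g := (Rep.epi_iff_surjective _).2 (extToTriv_surjective ℓ hℓ)

/-- The class in `H¹(PGL₂(L), St(R))` of the extension `0 → St(R) → Ext ℓ → R → 0`. -/
noncomputable def bClass (ℓ : Lˣ →* Multiplicative R) (hℓ : IsLocallyConstant ℓ) :
    groupCohomology (stRep L R) 1 :=
  groupCohomology.δ (extSeq_shortExact ℓ hℓ) 0 1 rfl
    ((groupCohomology.H0Iso (Rep.trivial R PGL(2, L) R)).inv ⟨1, fun _ => rfl⟩)

end Splitting
end DHecke

namespace DHecke


section Local

variable {F : Type} [Field F] [NumberField F]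

/-- The homomorphism `GL₂(𝒪ᵥ) → PGL₂(Fᵥ)`. -/
noncomputable def locMk (v : HeightOneSpectrum (𝓞 F)) :
    GL (Fin 2) (v.adicCompletionIntegers F) →* PGL(2, v.adicCompletion F) :=
  Matrix.ProjGenLinGroup.mk.comp
    (Matrix.GeneralLinearGroup.map (algebraMap (v.adicCompletionIntegers F) (v.adicCompletion F)))

/-- The maximal compact subgroup `PGL₂(𝒪ᵥ)` of `PGL₂(Fᵥ)`. -/
noncomputable def maxCpt (v : HeightOneSpectrum (𝓞 F)) : Subgroup PGL(2, v.adicCompletion F) :=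
  (locMk v).range

/-- The invertible matrices which are upper triangular modulo the ideal `J`. -/
def gamma0 {A : Type} [CommRing A] (J : Ideal A) : Subgroup (GL (Fin 2) A) where
  carrier := {k | k 1 0 ∈ J}
  one_mem' := by simp
  mul_mem' {k k'} hk hk' := by
    simp only [Set.mem_ofPred_eq, Units.val_mul, Matrix.mul_apply, Fin.sum_univ_two] at *
    exact J.add_mem (J.mul_mem_right _ hk) (J.mul_mem_left _ hk')
  inv_mem' {k} hk := by
    simp only [Set.mem_ofPred_eq] at *
    rw [Matrix.coe_units_inv, Matrix.inv_def, Matrix.adjugate_fin_two]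
    simp only [Matrix.smul_apply, Matrix.of_apply, Matrix.cons_val', Matrix.cons_val_zero,
      Matrix.cons_val_one, smul_eq_mul]
    exact J.mul_mem_left _ (J.neg_mem hk)

/-- The image in `PGL₂(Fᵥ)` of the group of matrices in `GL₂(𝒪ᵥ)` which are upper triangular
modulo `𝔫`. -/
noncomputable def locK0 (v : HeightOneSpectrum (𝓞 F)) (𝔫 : Ideal (𝓞 F)) :
    Subgroup PGL(2, v.adicCompletion F) :=
  (gamma0 (𝔫.map (algebraMap (𝓞 F) (v.adicCompletionIntegers F)))).map (locMk v)

theorem locK0_le (v : HeightOneSpectrum (𝓞 F)) (𝔫 : Ideal (𝓞 F)) : locK0 v 𝔫 ≤ maxCpt v := by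
  rintro _ ⟨k, -, rfl⟩
  exact ⟨k, rfl⟩

theorem locK0_mono (v : HeightOneSpectrum (𝓞 F)) {𝔪 𝔫 : Ideal (𝓞 F)} (h : 𝔪 ≤ 𝔫) :
    locK0 v 𝔪 ≤ locK0 v 𝔫 :=
  Subgroup.map_mono fun _ hk => Ideal.map_mono h hk

theorem locK0_of_not_dvd (v : HeightOneSpectrum (𝓞 F)) (𝔫 : Ideal (𝓞 F)) (h : ¬ v.asIdeal ∣ 𝔫) :
    locK0 v 𝔫 = maxCpt v := by
  refine le_antisymm (locK0_le v 𝔫) ?_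
  rintro _ ⟨k, rfl⟩
  refine ⟨k, ?_, rfl⟩
  obtain ⟨x, hx, hxv⟩ := SetLike.not_le_iff_exists.1 (fun h' => h (Ideal.dvd_iff_le.2 h'))
  have h1 : IsUnit (algebraMap (𝓞 F) (v.adicCompletionIntegers F) x) := by
    rw [HeightOneSpectrum.adicCompletionIntegers.isUnit_iff_valued_eq_one]
    refine (HeightOneSpectrum.valuedAdicCompletion_eq_valuation' v (algebraMap (𝓞 F) F x)).trans ?_
    exact (v.valuation_eq_one_iff_notMem).2 hxv
  have h2 : 𝔫.map (algebraMap (𝓞 F) (v.adicCompletionIntegers F)) = ⊤ :=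
    Ideal.eq_top_of_isUnit_mem _ (Ideal.mem_map_of_mem _ hx) h1
  have h3 : k 1 0 ∈ (⊤ : Ideal (v.adicCompletionIntegers F)) := trivial
  rwa [← h2] at h3

theorem mem_range_of_integral (v : HeightOneSpectrum (𝓞 F)) (h : GL (Fin 2) (v.adicCompletion F))
    (h1 : ∀ i j, h i j ∈ v.adicCompletionIntegers F)
    (h2 : ∀ i j, h⁻¹ i j ∈ v.adicCompletionIntegers F) :
    Matrix.ProjGenLinGroup.mk h ∈ maxCpt v := by
  let φ := algebraMap (v.adicCompletionIntegers F) (v.adicCompletion F)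
  have hφ : Function.Injective φ := Subtype.val_injective
  let M : Matrix (Fin 2) (Fin 2) (v.adicCompletionIntegers F) := fun i j => ⟨h i j, h1 i j⟩
  let M' : Matrix (Fin 2) (Fin 2) (v.adicCompletionIntegers F) := fun i j => ⟨h⁻¹ i j, h2 i j⟩
  have hM : φ.mapMatrix M = (h : Matrix _ _ _) := rfl
  have hM' : φ.mapMatrix M' = ((h⁻¹ : GL (Fin 2) (v.adicCompletion F)) : Matrix _ _ _) := rfl
  have hinj : Function.Injective (φ.mapMatrix (m := Fin 2)) := fun X Y hXY =>
    Matrix.map_injective hφ hXY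
  refine ⟨⟨M, M', hinj ?_, hinj ?_⟩, ?_⟩
  · rw [map_mul, hM, hM', map_one, Units.mul_inv]
  · rw [map_mul, hM, hM', map_one, Units.inv_mul]
  · exact congr_arg Matrix.ProjGenLinGroup.mk (Units.ext hM)

/-- The group `K ∩ g K g⁻¹`, where `K = PGL₂(𝒪ᵥ)`. -/
noncomputable def locKx (v : HeightOneSpectrum (𝓞 F)) (g : PGL(2, v.adicCompletion F)) :
    Subgroup PGL(2, v.adicCompletion F) :=
  maxCpt v ⊓ (maxCpt v).map (MulAut.conj g).toMonoidHom

theorem inv_mul_mul_mem_of_mem_locKx (v : HeightOneSpectrum (𝓞 F)) (g : PGL(2, v.adicCompletion F)) :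
    ∀ k ∈ locKx v g, g⁻¹ * k * g ∈ maxCpt v := by
  rintro _ ⟨-, k, hk, rfl⟩
  simpa [mul_assoc] using hk

theorem one_inv_mul_mul_mem_of_mem_locKx (v : HeightOneSpectrum (𝓞 F))
    (g : PGL(2, v.adicCompletion F)) : ∀ k ∈ locKx v g, 1⁻¹ * k * 1 ∈ maxCpt v := by
  intro k hk
  simpa using hk.1

theorem finite_quotient_span (v : HeightOneSpectrum (𝓞 F)) (d : 𝓞 F) (hd : d ≠ 0) :
    Finite (v.adicCompletionIntegers F ⧸
      Ideal.span {algebraMap (𝓞 F) (v.adicCompletionIntegers F) d}) := by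
  have h0 : Finite (𝓞 F ⧸ Ideal.span {d}) :=
    Ideal.finiteQuotientOfFreeOfNeBot _ (by simpa using hd)
  have hle : Ideal.span {d} ≤ (Ideal.span {algebraMap (𝓞 F) (v.adicCompletionIntegers F) d}).comap
      (algebraMap (𝓞 F) (v.adicCompletionIntegers F)) := by
    rw [Ideal.span_singleton_le_iff_mem]
    exact Ideal.mem_span_singleton_self _
  refine Finite.of_surjective (Ideal.quotientMap _ _ hle) ?_
  intro x
  obtain ⟨x, rfl⟩ := Ideal.Quotient.mk_surjective x
  let D : v.adicCompletion F := algebraMap F (v.adicCompletion F) (algebraMap (𝓞 F) F d)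
  have hF : ∀ y : F, Valued.v (algebraMap F (v.adicCompletion F) y) = v.valuation F y :=
    HeightOneSpectrum.valuedAdicCompletion_eq_valuation' v
  have hD : D ≠ 0 := by simpa [D] using hd
  have hopen := (Valued.isOpen_ball (v.adicCompletion F) (Valued.v.restrict D)).preimage
    (continuous_id.sub (continuous_const (y := (x : v.adicCompletion F))))
  obtain ⟨y, hy⟩ := (HeightOneSpectrum.denseRange_algebraMap F v).exists_mem_open hopen
    ⟨x, by simpa using (zero_lt_iff.2 ((map_ne_zero _).2 hD))⟩
  have hy1 : Valued.v (algebraMap F (v.adicCompletion F) y - x) < Valued.v D :=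
    Valued.v.restrict_lt_iff.1 hy
  have hD1 : Valued.v D ≤ 1 := (hF _).trans_le (v.valuation_le_one d)
  have hy2 : v.valuation F y ≤ 1 := by
    rw [← hF]
    have : algebraMap F (v.adicCompletion F) y =
      (algebraMap F (v.adicCompletion F) y - x) + x := by ring
    rw [this]
    exact (Valued.v.map_add _ _).trans (max_le (hy1.le.trans hD1) x.2)
  have hvd : v.valuation F (algebraMap (𝓞 F) F d) ≠ 0 :=
    (map_ne_zero _).2 (by simpa using hd)
  obtain ⟨n, hn⟩ := v.exists_valuation_sub_lt_of_integer hy2 (Units.mk0 _ hvd)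
  have hn1 : Valued.v (x - algebraMap F (v.adicCompletion F) (algebraMap (𝓞 F) F n)) ≤
      Valued.v D := by
    rw [Valuation.map_sub_swap]
    have : algebraMap F (v.adicCompletion F) (algebraMap (𝓞 F) F n) - x =
      algebraMap F (v.adicCompletion F) (algebraMap (𝓞 F) F n - y) +
        (algebraMap F (v.adicCompletion F) y - x) := by rw [map_sub]; ring
    rw [this]
    refine (Valued.v.map_add _ _).trans (max_le ?_ hy1.le)
    rw [hF, hF]
    exact hn.le
  refine ⟨Ideal.Quotient.mk _ n, ?_⟩
  rw [Ideal.quotientMap_mk, eq_comm, Ideal.Quotient.mk_eq_mk_iff_sub_mem, Ideal.mem_span_singleton]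
  exact (HeightOneSpectrum.adicCompletionIntegers.integers F v).dvd_iff_le.2 hn1

theorem exists_integral_mul (v : HeightOneSpectrum (𝓞 F)) {ι : Type} [Fintype ι]
    (a : ι → v.adicCompletion F) : ∃ d : 𝓞 F, d ≠ 0 ∧ ∀ i,
      algebraMap (𝓞 F) (v.adicCompletion F) d * a i ∈ v.adicCompletionIntegers F := by
  classical
  choose b hb hb' using fun i =>
    HeightOneSpectrum.adicCompletion.mul_nonZeroDivisor_mem_adicCompletionIntegers v (a i)
  refine ⟨∏ i, b i, Finset.prod_ne_zero_iff.2 fun i _ => nonZeroDivisors.ne_zero (hb i),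
    fun i => ?_⟩
  rw [← Finset.prod_erase_mul _ _ (Finset.mem_univ i), map_mul, mul_assoc, mul_comm _ (a i)]
  exact mul_mem (HeightOneSpectrum.coe_mem_adicCompletionIntegers v _) (hb' i)

theorem locKx_relIndex_ne_zero (v : HeightOneSpectrum (𝓞 F)) (g : PGL(2, v.adicCompletion F)) :
    (locKx v g).relIndex (maxCpt v) ≠ 0 := by
  rw [locKx, Subgroup.inf_relIndex_left]
  induction g using Matrix.ProjGenLinGroup.induction_on with | mk h =>
  let O := v.adicCompletionIntegers F
  let L := v.adicCompletion F
  let φ : O →+* L := algebraMap O L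
  obtain ⟨d, hd, hd'⟩ := exists_integral_mul v
    (fun x : (Fin 2 × Fin 2) ⊕ (Fin 2 × Fin 2) =>
      Sum.elim (fun x => h x.1 x.2) (fun x => h⁻¹ x.1 x.2) x)
  let I : Ideal O := Ideal.span {algebraMap (𝓞 F) O (d * d)}
  have hI : Finite (O ⧸ I) := finite_quotient_span v _ (mul_ne_zero hd hd)
  let N : Subgroup (GL (Fin 2) O) :=
    (Matrix.GeneralLinearGroup.map (n := Fin 2) (Ideal.Quotient.mk I)).ker
  have hN : N.relIndex ⊤ ≠ 0 := by
    rw [Subgroup.relIndex_top_right]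
    have : N.FiniteIndex := Subgroup.finiteIndex_ker _
    exact this.index_ne_zero
  have h1 : (N.map (locMk v)).relIndex (maxCpt v) ≠ 0 := by
    rw [maxCpt, MonoidHom.range_eq_map, Subgroup.relIndex_map_map]
    rw [top_sup_eq]
    exact fun h0 => hN (Subgroup.relIndex_eq_zero_of_le_left le_sup_left h0)
  refine fun h0 => h1 (Subgroup.relIndex_eq_zero_of_le_left ?_ h0)
  rintro _ ⟨n, hn, rfl⟩
  have key : ∀ n ∈ N, ∀ i j, (h⁻¹ * Matrix.GeneralLinearGroup.map φ n * h) i j ∈ O := by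
    intro n hn i j
    have hn' : ∀ k l, ∃ x : O, n k l - (1 : Matrix (Fin 2) (Fin 2) O) k l =
        algebraMap (𝓞 F) O (d * d) * x := fun k l => by
      have h2 := congr_arg (fun M : GL (Fin 2) (O ⧸ I) => M k l) (MonoidHom.mem_ker.1 hn)
      have h3 : Ideal.Quotient.mk I (n k l) = Ideal.Quotient.mk I ((1 : Matrix (Fin 2) (Fin 2) O) k l) := by
        refine h2.trans ?_
        change (1 : Matrix (Fin 2) (Fin 2) (O ⧸ I)) k l = _
        simp only [Matrix.one_apply]
        split_ifs <;> simp
      exact Ideal.mem_span_singleton.1 ((Ideal.Quotient.mk_eq_mk_iff_sub_mem _ _).1 h3)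
    choose X hX using hn'
    let c : L := algebraMap (𝓞 F) L d
    have hM : (Matrix.GeneralLinearGroup.map φ n : Matrix (Fin 2) (Fin 2) L) =
        1 + (c * c) • (Matrix.of fun k l => (X k l : L)) := by
      refine Matrix.ext fun k l => ?_
      have h2 := congr_arg φ (hX k l)
      have h3 : φ ((1 : Matrix (Fin 2) (Fin 2) O) k l) = (1 : Matrix (Fin 2) (Fin 2) L) k l := by
        simp only [Matrix.one_apply]
        split_ifs <;> simp
      rw [map_sub, h3, map_mul, map_mul, map_mul, sub_eq_iff_eq_add'] at h2
      exact h2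
    have h4 : ((h⁻¹ * Matrix.GeneralLinearGroup.map φ n * h : GL (Fin 2) L) :
        Matrix (Fin 2) (Fin 2) L) = 1 + (c • ((h⁻¹ : GL (Fin 2) L) : Matrix (Fin 2) (Fin 2) L)) *
          (Matrix.of fun k l => (X k l : L)) * (c • (h : Matrix (Fin 2) (Fin 2) L)) := by
      rw [Units.val_mul, Units.val_mul, hM]
      simp only [mul_add, add_mul, mul_one, Units.inv_mul, Matrix.smul_mul, Matrix.mul_smul,
        smul_smul]
    have h5 : ∀ k l, (c • ((h⁻¹ : GL (Fin 2) L) : Matrix (Fin 2) (Fin 2) L)) k l ∈ O :=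
      fun k l => hd' (.inr (k, l))
    have h6 : ∀ k l, (c • (h : Matrix (Fin 2) (Fin 2) L)) k l ∈ O := fun k l => hd' (.inl (k, l))
    rw [h4, Matrix.add_apply, Matrix.mul_apply]
    refine add_mem ?_ (sum_mem fun l _ => mul_mem ?_ (h6 _ _))
    · rw [Matrix.one_apply]
      split_ifs
      exacts [one_mem _, zero_mem _]
    · rw [Matrix.mul_apply]
      exact sum_mem fun k _ => mul_mem (h5 _ _) (X k l).2
  rw [Subgroup.mem_map]
  refine ⟨Matrix.ProjGenLinGroup.mk (h⁻¹ * Matrix.GeneralLinearGroup.map φ n * h),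
    mem_range_of_integral v _ (key n hn) ?_, ?_⟩
  · have := key n⁻¹ (N.inv_mem hn)
    simpa [mul_assoc] using this
  · simp [locMk, mul_assoc, φ]
    rfl

end Local

section Adelic

variable {F : Type} [Field F] [NumberField F]

variable (F) in
/-- The group of points of `PGL₂` over the finite adeles away from `S`. -/
abbrev adelic (S : Set (HeightOneSpectrum (𝓞 F))) : Type :=
  Πʳ v : {v : HeightOneSpectrum (𝓞 F) // v ∉ S}, [PGL(2, v.1.adicCompletion F), maxCpt v.1]

theorem eventually_mem_maxCpt (γ : PGL(2, F)) : ∀ᶠ v : HeightOneSpectrum (𝓞 F) in Filter.cofinite,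
    Matrix.ProjGenLinGroup.map (algebraMap F (v.adicCompletion F)) γ ∈ maxCpt v := by
  induction γ using Matrix.ProjGenLinGroup.induction_on with | mk h =>
  have h0 : ∀ x : F, ∀ᶠ v : HeightOneSpectrum (𝓞 F) in Filter.cofinite,
      algebraMap F (v.adicCompletion F) x ∈ v.adicCompletionIntegers F := fun x =>
    (FiniteAdeleRing.algebraMap (𝓞 F) F x).2
  have h1 : ∀ᶠ v : HeightOneSpectrum (𝓞 F) in Filter.cofinite, ∀ i j,
      algebraMap F (v.adicCompletion F) (h i j) ∈ v.adicCompletionIntegers F :=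
    Filter.eventually_all.2 fun i => Filter.eventually_all.2 fun j => h0 _
  have h2 : ∀ᶠ v : HeightOneSpectrum (𝓞 F) in Filter.cofinite, ∀ i j,
      algebraMap F (v.adicCompletion F) (h⁻¹ i j) ∈ v.adicCompletionIntegers F :=
    Filter.eventually_all.2 fun i => Filter.eventually_all.2 fun j => h0 _
  filter_upwards [h1, h2] with v h1 h2
  exact mem_range_of_integral v (Matrix.GeneralLinearGroup.map (algebraMap F _) h) h1 h2

/-- The diagonal embedding of `PGL₂(F)`. -/
noncomputable def diagEmb (S : Set (HeightOneSpectrum (𝓞 F))) : PGL(2, F) →* adelic F S where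
  toFun γ := ⟨fun v => Matrix.ProjGenLinGroup.map (algebraMap F (v.1.adicCompletion F)) γ,
    Subtype.val_injective.tendsto_cofinite.eventually (eventually_mem_maxCpt γ)⟩
  map_one' := RestrictedProduct.ext _ _ fun v =>
    map_one (Matrix.ProjGenLinGroup.map (algebraMap F (v.1.adicCompletion F)))
  map_mul' γ γ' := RestrictedProduct.ext _ _ fun v =>
    map_mul (Matrix.ProjGenLinGroup.map (algebraMap F (v.1.adicCompletion F))) γ γ'

/-- The projection to the component at a prime outside `S`. -/
noncomputable def localComp (S : Set (HeightOneSpectrum (𝓞 F))) (𝔮 : HeightOneSpectrum (𝓞 F)) (h : 𝔮 ∉ S) :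
    adelic F S →* PGL(2, 𝔮.adicCompletion F) :=
  RestrictedProduct.evalMonoidHom (fun v : {v // v ∉ S} => PGL(2, v.1.adicCompletion F)) ⟨𝔮, h⟩

/-- The projection forgetting the components at the primes of `T`. -/
noncomputable def forgetComp {S T : Set (HeightOneSpectrum (𝓞 F))} (h : S ⊆ T) : adelic F S →* adelic F T :=
  RestrictedProduct.mapAlongMonoidHom (fun v : {v // v ∉ S} => PGL(2, v.1.adicCompletion F))
    (fun v : {v // v ∉ T} => PGL(2, v.1.adicCompletion F))
    (fun v => ⟨v.1, fun hv => v.2 (h hv)⟩)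
    (Function.Injective.tendsto_cofinite fun _ _ h => Subtype.ext (congr_arg (fun x => x.1) h))
    (fun _ => MonoidHom.id _) (.of_forall fun _ _ h => h)

/-- The level `K₀(𝔫)`, away from `S`. -/
noncomputable def level (S : Set (HeightOneSpectrum (𝓞 F))) (𝔫 : Ideal (𝓞 F)) :
    Subgroup (adelic F S) :=
  ⨅ (v : HeightOneSpectrum (𝓞 F)) (h : v ∉ S), (locK0 v 𝔫).comap (localComp S v h)

theorem mem_level {S : Set (HeightOneSpectrum (𝓞 F))} {𝔫 : Ideal (𝓞 F)} {a : adelic F S} :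
    a ∈ level S 𝔫 ↔ ∀ v (h : v ∉ S), localComp S v h a ∈ locK0 v 𝔫 := by
  simp [level, Subgroup.mem_iInf]

/-- The subgroup of `K₀(𝔫)` (away from `S`) of elements whose component at `𝔮` lies in
`K ∩ g K g⁻¹`, where `K = PGL₂(𝒪_𝔮)`. -/
noncomputable def levelX (S : Set (HeightOneSpectrum (𝓞 F))) (𝔫 : Ideal (𝓞 F))
    (𝔮 : HeightOneSpectrum (𝓞 F)) (h𝔮 : 𝔮 ∉ S) (g : PGL(2, 𝔮.adicCompletion F)) :
    Subgroup (adelic F S) :=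
  level S 𝔫 ⊓ (locKx 𝔮 g).comap (localComp S 𝔮 h𝔮)

section

variable (S : Set (HeightOneSpectrum (𝓞 F))) (𝔫 : Ideal (𝓞 F))
    (𝔮 : HeightOneSpectrum (𝓞 F)) (h𝔮 : 𝔮 ∉ S) (g : PGL(2, 𝔮.adicCompletion F))

instance finite_level_quotient :
    Finite (level S 𝔫 ⧸ (levelX S 𝔫 𝔮 h𝔮 g).subgroupOf (level S 𝔫)) := by
  have h1 : level S 𝔫 ≤ (maxCpt 𝔮).comap (localComp S 𝔮 h𝔮) := fun a ha =>
    locK0_le 𝔮 𝔫 (mem_level.1 ha 𝔮 h𝔮)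
  have h2 := Subgroup.relIndex_comap_ne_zero (localComp S 𝔮 h𝔮) (locKx_relIndex_ne_zero 𝔮 g)
  have h3 : (levelX S 𝔫 𝔮 h𝔮 g).relIndex (level S 𝔫) ≠ 0 := by
    rw [levelX, Subgroup.inf_relIndex_left]
    exact fun h0 => h2 (Subgroup.relIndex_eq_zero_of_le_right h1 h0)
  have : ((levelX S 𝔫 𝔮 h𝔮 g).subgroupOf (level S 𝔫)).FiniteIndex := ⟨h3⟩
  infer_instance

noncomputable instance fintype_level_quotient :
    Fintype (level S 𝔫 ⧸ (levelX S 𝔫 𝔮 h𝔮 g).subgroupOf (level S 𝔫)) := Fintype.ofFinite _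

/-- The projection of `levelX` to the component at `𝔮`. -/
noncomputable def levelXComp : levelX S 𝔫 𝔮 h𝔮 g →* locKx 𝔮 g :=
  (localComp S 𝔮 h𝔮).subgroupComap (locKx 𝔮 g) |>.comp (Subgroup.inclusion inf_le_right)

open Classical in
/-- The inclusion of the factor at `𝔮`. -/
noncomputable def single (y : PGL(2, 𝔮.adicCompletion F)) : adelic F S :=
  RestrictedProduct.mulSingle (fun v : {v // v ∉ S} => maxCpt v.1) ⟨𝔮, h𝔮⟩ y

theorem comp_single (y : PGL(2, 𝔮.adicCompletion F)) : localComp S 𝔮 h𝔮 (single S 𝔮 h𝔮 y) = y := by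
  classical
  exact RestrictedProduct.mulSingle_eq_same (fun v : {v // v ∉ S} => maxCpt v.1) ⟨𝔮, h𝔮⟩ y

theorem comp_single_of_ne (y : PGL(2, 𝔮.adicCompletion F)) (v : HeightOneSpectrum (𝓞 F))
    (hv : v ∉ S) (h : v ≠ 𝔮) : localComp S v hv (single S 𝔮 h𝔮 y) = 1 := by
  classical
  exact RestrictedProduct.mulSingle_eq_of_ne (fun v : {v // v ∉ S} => maxCpt v.1) (i := ⟨𝔮, h𝔮⟩)
    (j := ⟨v, hv⟩) y (fun h' => h (congr_arg Subtype.val h'))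

theorem single_mem {𝔮} {g : PGL(2, 𝔮.adicCompletion F)} (h𝔮 : 𝔮 ∉ S) (h𝔫 : ¬ 𝔮.asIdeal ∣ 𝔫)
    (y : PGL(2, 𝔮.adicCompletion F)) (hy : ∀ k ∈ locKx 𝔮 g, y⁻¹ * k * y ∈ maxCpt 𝔮) :
    ∀ k ∈ levelX S 𝔫 𝔮 h𝔮 g, (single S 𝔮 h𝔮 y)⁻¹ * k * single S 𝔮 h𝔮 y ∈ level S 𝔫 := by
  intro k hk
  refine mem_level.2 fun v hv => ?_
  rw [map_mul, map_mul, map_inv]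
  by_cases h : v = 𝔮
  · subst h
    rw [comp_single, locK0_of_not_dvd _ _ h𝔫]
    exact hy _ hk.2
  · rw [comp_single_of_ne S 𝔮 h𝔮 y v hv h]
    simpa using mem_level.1 hk.1 v hv

end

end Adelic
end DHecke

namespace DHecke


section Operators

variable {F : Type} [Field F] [NumberField F]

/-- The map from `PGL₂(F)` to the product of the `PGL₂(Fᵥ)` over the infinite places `v`. -/
noncomputable def diagInf (F : Type) [Field F] [NumberField F] :
    PGL(2, F) →* ((v : InfinitePlace F) → PGL(2, v.Completion)) :=
  MonoidHom.pi fun v => Matrix.ProjGenLinGroup.map (algebraMap F v.Completion)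

/-- The map from `PGL₂(F)` to `PGL₂(Fᵥ)`. -/
noncomputable def toLoc (v : HeightOneSpectrum (𝓞 F)) : PGL(2, F) →* PGL(2, v.adicCompletion F) :=
  Matrix.ProjGenLinGroup.map (algebraMap F (v.adicCompletion F))

variable (N : ℕ) (ε : ((v : InfinitePlace F) → PGL(2, v.Completion)) →* ℤˣ)

/-- For `S₀ = ∅`: the representation of `PGL₂(F)` on the space of functions from the group of
points over the finite adeles away from `S` to `ℤ/N` which are right invariant under `K`. -/
noncomputable abbrev trivCoeff (S : Set (HeightOneSpectrum (𝓞 F))) (K : Subgroup (adelic F S)) :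
    Rep.{0} (ZMod N) PGL(2, F) :=
  fnRep (ZMod N) (diagEmb S) K (.trivial ℤ PGL(2, F) ℤ) (ε.comp (diagInf F))

/-- For `S₀ = {𝔭}`: the representation of `PGL₂(F)` on the space of functions from the group of
points over the finite adeles away from `S` to `Hom(St_𝔭(ℤ), ℤ/N)` which are right invariant
under `K`. -/
noncomputable abbrev stCoeff (S : Set (HeightOneSpectrum (𝓞 F))) (K : Subgroup (adelic F S))
    (𝔭 : HeightOneSpectrum (𝓞 F)) : Rep.{0} (ZMod N) PGL(2, F) :=
  fnRep (ZMod N) (diagEmb S) K ((stAction (𝔭.adicCompletion F) ℤ).comp (toLoc 𝔭))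
    (ε.comp (diagInf F))

/-- The image of a class `α ∈ Hⁱ(K_{𝔮,x}, ℤ/N)` under inflation, the isomorphism of Shapiro's lemma
and restriction to `PGL₂(F)`. -/
noncomputable def globalClass (S : Set (HeightOneSpectrum (𝓞 F))) (𝔫 : Ideal (𝓞 F))
    {𝔮 : HeightOneSpectrum (𝓞 F)} (h𝔮 : 𝔮 ∉ S) (g : PGL(2, 𝔮.adicCompletion F)) (i : ℕ)
    (α : continuousCohomology i (trivTop (ZMod N) (locKx 𝔮 g))) :
    groupCohomology (fnRep (ZMod N) (diagEmb S) (levelX S 𝔫 𝔮 h𝔮 g)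
      (.trivial ℤ PGL(2, F) ℤ) 1) i :=
  groupCohomology.map (diagEmb S) (fnRes (ZMod N) (diagEmb S) (levelX S 𝔫 𝔮 h𝔮 g)) i
    (shapiro (levelX S 𝔫 𝔮 h𝔮 g) i
      (groupCohomology.map (levelXComp S 𝔫 𝔮 h𝔮 g)
        (A := Rep.trivial (ZMod N) (locKx 𝔮 g) (ZMod N))
        (B := Rep.trivial (ZMod N) (levelX S 𝔫 𝔮 h𝔮 g) (ZMod N)) (𝟙 _) i
        (contCompare (ZMod N) (locKx 𝔮 g) i α)))

/-- The composition of right translation by `y ∈ PGL₂(F_𝔮)`, cup product with the class of `α` and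
corestriction. -/
noncomputable def heckeOp (S : Set (HeightOneSpectrum (𝓞 F))) {𝔫 : Ideal (𝓞 F)}
    {𝔮 : HeightOneSpectrum (𝓞 F)} (h𝔮 : 𝔮 ∉ S) (h𝔫 : ¬ 𝔮.asIdeal ∣ 𝔫)
    {g : PGL(2, 𝔮.adicCompletion F)} {i : ℕ}
    (α : continuousCohomology i (trivTop (ZMod N) (locKx 𝔮 g)))
    (y : PGL(2, 𝔮.adicCompletion F)) (hy : ∀ k ∈ locKx 𝔮 g, y⁻¹ * k * y ∈ maxCpt 𝔮)
    {W : Type} [AddCommGroup W] (ρ : Representation ℤ PGL(2, F) W) (ε : PGL(2, F) →* ℤˣ) :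
    totCoh (fnRep (ZMod N) (diagEmb S) (level S 𝔫) ρ ε) →ₗ[ZMod N]
      totCoh (fnRep (ZMod N) (diagEmb S) (level S 𝔫) ρ ε) :=
  totMap (fnCores (K' := levelX S 𝔫 𝔮 h𝔮 g) (diagEmb S) ρ ε) ∘ₗ
    totCup (fnMul (diagEmb S) (levelX S 𝔫 𝔮 h𝔮 g) ρ ε)
      (fnMul_equivariant (diagEmb S) (levelX S 𝔫 𝔮 h𝔮 g) ρ ε) i (globalClass N S 𝔫 h𝔮 g i α) ∘ₗ
    totMap (fnTrans (diagEmb S) ρ ε (single S 𝔮 h𝔮 y) (single_mem S 𝔫 h𝔮 h𝔫 y hy))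

/-- The cup product with the restriction to `PGL₂(F)` of the class attached to `ℓ`. -/
noncomputable def cOp (S : Set (HeightOneSpectrum (𝓞 F))) (K : Subgroup (adelic F S))
    (𝔭 : HeightOneSpectrum (𝓞 F))
    (ℓ : (𝔭.adicCompletion F)ˣ →* Multiplicative (ZMod N)) (hℓ : IsLocallyConstant ℓ) :
    totCoh (stCoeff N ε S K 𝔭) →ₗ[ZMod N] totCoh (trivCoeff N ε S K) :=
  totCup (stPair N (diagEmb S) K (toLoc 𝔭) (ε.comp (diagInf F)))
    (stPair_equivariant N (diagEmb S) K (toLoc 𝔭) (ε.comp (diagInf F))) 1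
    (groupCohomology.map (toLoc 𝔭) (𝟙 _) 1 (bClass ℓ hℓ))

/-- Evaluation at an element `v` of `St_𝔭(ℤ)` fixed by the Iwahori subgroup:
`Φ ↦ (a ↦ Φ(a^𝔭)(a_𝔭 v))`. -/
noncomputable def evCoeff {𝔫 : Ideal (𝓞 F)} {𝔭 : HeightOneSpectrum (𝓞 F)} (h𝔭 : 𝔭.asIdeal ∣ 𝔫)
    (v : St (𝔭.adicCompletion F) ℤ)
    (hv : ∀ k ∈ locK0 𝔭 𝔭.asIdeal, stAction (𝔭.adicCompletion F) ℤ k v = v) :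
    stCoeff N ε {𝔭} (level {𝔭} 𝔫) 𝔭 ⟶ trivCoeff N ε ∅ (level ∅ 𝔫) :=
  Rep.ofHom
    { toFun := fun (Φ : fnSpace (ZMod N) (St (𝔭.adicCompletion F) ℤ) (level {𝔭} 𝔫)) =>
        (⟨fun a => LinearMap.toSpanSingleton ℤ (ZMod N)
          (Φ.1 (forgetComp (Set.empty_subset {𝔭}) a)
            (stAction (𝔭.adicCompletion F) ℤ (localComp ∅ 𝔭 (Set.notMem_empty 𝔭) a) v)),
          fun a k hk => by
            have h1 : forgetComp (Set.empty_subset {𝔭}) k ∈ level {𝔭} 𝔫 :=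
              mem_level.2 fun w hw => mem_level.1 hk w (Set.notMem_empty w)
            have h2 := hv _ (locK0_mono 𝔭 (Ideal.dvd_iff_le.1 h𝔭)
              (mem_level.1 hk 𝔭 (Set.notMem_empty 𝔭)))
            beta_reduce
            rw [map_mul, map_mul, map_mul, Φ.2 _ _ h1, Module.End.mul_apply, h2]⟩ :
          fnSpace (ZMod N) ℤ (level ∅ 𝔫))
      map_add' := fun Φ Ψ => by ext; simp
      map_smul' := fun c Φ => by ext; simp
      isIntertwining' := fun γ => by
        refine LinearMap.ext fun Φ => Subtype.ext (funext fun a => LinearMap.ext_ring ?_)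
        change (1 : ℤ) • ((ε.comp (diagInf F) γ : ℤˣ) : ℤ) • Φ.1 ((diagEmb {𝔭} γ)⁻¹ *
            forgetComp (Set.empty_subset {𝔭}) a)
              (stAction (𝔭.adicCompletion F) ℤ (toLoc 𝔭 γ⁻¹) (stAction (𝔭.adicCompletion F) ℤ
                (localComp ∅ 𝔭 (Set.notMem_empty 𝔭) a) v)) =
          ((ε.comp (diagInf F) γ : ℤˣ) : ℤ) • (1 : ℤ) • Φ.1
            (forgetComp (Set.empty_subset {𝔭}) ((diagEmb ∅ γ)⁻¹ * a))
              (stAction (𝔭.adicCompletion F) ℤ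
                (localComp ∅ 𝔭 (Set.notMem_empty 𝔭) ((diagEmb ∅ γ)⁻¹ * a)) v)
        rw [one_smul, one_smul, map_mul, map_mul, map_mul, Module.End.mul_apply, ← map_inv,
          ← map_inv]
        rfl }

/-- The map on cohomology induced by evaluation at an element of `St_𝔭(ℤ)` fixed by the Iwahori
subgroup. -/
noncomputable def evOp {𝔫 : Ideal (𝓞 F)} {𝔭 : HeightOneSpectrum (𝓞 F)} (h𝔭 : 𝔭.asIdeal ∣ 𝔫)
    (v : St (𝔭.adicCompletion F) ℤ)
    (hv : ∀ k ∈ locK0 𝔭 𝔭.asIdeal, stAction (𝔭.adicCompletion F) ℤ k v = v) :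
    totCoh (stCoeff N ε {𝔭} (level {𝔭} 𝔫) 𝔭) →ₗ[ZMod N] totCoh (trivCoeff N ε ∅ (level ∅ 𝔫)) :=
  totMap (evCoeff N ε h𝔭 v hv)

theorem notMem_singleton {p : ℕ} {𝔭 𝔮 : HeightOneSpectrum (𝓞 F)} (h𝔭 : (p : 𝓞 F) ∈ 𝔭.asIdeal)
    (h𝔮 : (p : 𝓞 F) ∉ 𝔮.asIdeal) : 𝔮 ∉ ({𝔭} : Set (HeightOneSpectrum (𝓞 F))) := by
  rintro rfl
  exact h𝔮 h𝔭

/-- `heckeOp` on the cohomology with coefficients in `stCoeff`, for `S₀ = S = {𝔭}`. -/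
noncomputable abbrev heckeSt {𝔫 : Ideal (𝓞 F)} {𝔭 𝔮 : HeightOneSpectrum (𝓞 F)}
    (h𝔮𝔭 : 𝔮 ∉ ({𝔭} : Set (HeightOneSpectrum (𝓞 F)))) (h𝔫 : ¬ 𝔮.asIdeal ∣ 𝔫)
    {g : PGL(2, 𝔮.adicCompletion F)} {i : ℕ}
    (α : continuousCohomology i (trivTop (ZMod N) (locKx 𝔮 g)))
    (y : PGL(2, 𝔮.adicCompletion F)) (hy : ∀ k ∈ locKx 𝔮 g, y⁻¹ * k * y ∈ maxCpt 𝔮) :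
    totCoh (stCoeff N ε {𝔭} (level {𝔭} 𝔫) 𝔭) →ₗ[ZMod N]
      totCoh (stCoeff N ε {𝔭} (level {𝔭} 𝔫) 𝔭) :=
  heckeOp N {𝔭} h𝔮𝔭 h𝔫 α y hy ((stAction (𝔭.adicCompletion F) ℤ).comp (toLoc 𝔭))
    (ε.comp (diagInf F))

/-- `heckeOp` on the cohomology with coefficients in `trivCoeff`, for `S₀ = ∅`. -/
noncomputable abbrev heckeTriv (S : Set (HeightOneSpectrum (𝓞 F))) {𝔫 : Ideal (𝓞 F)}
    {𝔮 : HeightOneSpectrum (𝓞 F)} (h𝔮 : 𝔮 ∉ S) (h𝔫 : ¬ 𝔮.asIdeal ∣ 𝔫)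
    {g : PGL(2, 𝔮.adicCompletion F)} {i : ℕ}
    (α : continuousCohomology i (trivTop (ZMod N) (locKx 𝔮 g)))
    (y : PGL(2, 𝔮.adicCompletion F)) (hy : ∀ k ∈ locKx 𝔮 g, y⁻¹ * k * y ∈ maxCpt 𝔮) :
    totCoh (trivCoeff N ε S (level S 𝔫)) →ₗ[ZMod N] totCoh (trivCoeff N ε S (level S 𝔫)) :=
  heckeOp N S h𝔮 h𝔫 α y hy (.trivial ℤ PGL(2, F) ℤ) (ε.comp (diagInf F))

end Operators
end DHecke

/-! A derived Hecke operator is a translation, followed by a cup product with a class of degree `i`,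
followed by a sum over cosets. Both halves of the theorem are checked against these three factors
one at a time. The operators h and h' are the cases `y = g` and `y = 1` of `heckeOp`, so one proof
serves both.

For (a), translation and coset sum act on the adelic variable of a function, while the pairing that
defines `cOp` acts on its values. The class b has coefficients that do not see the level. Naturality
of the cup product (`totMap_totCup_id`, with `fnTrans_stPair` and `fnCores_stPair`) therefore moves
`cOp` past both. What remains is to interchange two cup products, with a class of degree `i` and
with a class of degree 1. By `stPair_fnMul` both iterated products come from the same trilinear map,
so the interchange is graded commutativity and costs the sign (-1)^i. This is `totCup_swap`. It is
proved by an explicit cochain, which works because a 1-cocycle is a crossed homomorphism.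

For (b), evaluation is a map of coefficients: pull functions back along the projection that forgets
the component at 𝔭, then evaluate at a_𝔭 v. It commutes with translation at 𝔮 because 𝔮 ≠ 𝔭
(`fnTrans_fnEv`). It commutes with the coset sum because the index at 𝔮 is not affected by
forgetting 𝔭, and because v is fixed by the 𝔭-component of the level (`fnCores_fnEv`). It is
multiplicative (`fnEv_fnMul`), so it turns the cup product with the class of α away from 𝔭 into the
cup product with the pullback of that class. No sign appears, as no second class of positive degree
is involved.

The substance of (b) is that this pullback is the class of α at full level (`cohMap_globalClass`).
Both classes come from Shapiro's lemma, whose cocycles depend on a choice of coset representatives,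
and the choices for the two adelic groups are unrelated. Each choice amounts to a map from the
adelic group to K_{𝔮,x} that is equivariant for the level, and two such maps yield homotopic
pullbacks of homogeneous cochains. The homotopy is the classical prism operator (`altSum_prism`),
and its invariance makes it a cochain with the right coefficients (`cohMk_eq_of_equivariant`). -/

namespace DHecke

/-! ### Naturality of the cup product on total cohomology. -/

section CupProducts
variable {k G : Type} [CommRing k] [Group G]

/-- The map on cohomology induced by a morphism of coefficients. -/
noncomputable def cohMap {A B : Rep.{0} k G} (φ : A ⟶ B) (i : ℕ) :
    groupCohomology A i →ₗ[k] groupCohomology B i :=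
  ((groupCohomology.functor k G i).map φ).hom

theorem cohMap_cohMk {A B : Rep.{0} k G} (φ : A ⟶ B) (i : ℕ) (x : cocyc A i) :
    cohMap φ i (cohMk A i x) =
      cohMk B i ⟨fun g => φ.hom (x.1 g), map_mem_cocyc (MonoidHom.id G) φ i x⟩ :=
  map_cohMk (MonoidHom.id G) φ i x

theorem cohMap_id (A : Rep.{0} k G) (i : ℕ) (x : groupCohomology A i) :
    cohMap (𝟙 A) i x = x := by
  obtain ⟨x, rfl⟩ := cohMk_surjective A i x
  exact cohMap_cohMk _ _ _

theorem cohMap_cohMap {A B C : Rep.{0} k G} (φ : A ⟶ B) (ψ : B ⟶ C) (i : ℕ)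
    (x : groupCohomology A i) : cohMap ψ i (cohMap φ i x) = cohMap (φ ≫ ψ) i x := by
  obtain ⟨x, rfl⟩ := cohMk_surjective A i x
  rw [cohMap_cohMk, cohMap_cohMk, cohMap_cohMk]
  rfl

/-- The cup product is natural with respect to morphisms of pairings. -/
theorem map_cup {A B C A' B' C' : Rep.{0} k G} (β : A →ₗ[k] B →ₗ[k] C)
    (hβ : ∀ g a b, C.ρ g (β a b) = β (A.ρ g a) (B.ρ g b)) (β' : A' →ₗ[k] B' →ₗ[k] C')
    (hβ' : ∀ g a b, C'.ρ g (β' a b) = β' (A'.ρ g a) (B'.ρ g b))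
    (φ : A ⟶ A') (ψ : B ⟶ B') (χ : C ⟶ C')
    (h : ∀ a b, χ.hom (β a b) = β' (φ.hom a) (ψ.hom b)) (i j : ℕ)
    (x : groupCohomology A i) (y : groupCohomology B j) :
    cohMap χ (i + j) (cup β hβ i j x y) =
      cup β' hβ' i j (cohMap φ i x)
        (cohMap ψ j y) := by
  obtain ⟨f, rfl⟩ := cohMk_surjective A i x
  obtain ⟨g, rfl⟩ := cohMk_surjective B j y
  rw [cup_cohMk, cohMap_cohMk, cohMap_cohMk, cohMap_cohMk, cup_cohMk]
  congr 1
  refine Subtype.ext (funext fun z => ?_)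
  refine (h _ _).trans (congr_arg (β' _) ?_)
  -- The cochain formula translates the second factor by x₁⋯xᵢ, so `ψ` has to be moved past this
  -- action.
  exact congr($(ψ.hom.isIntertwining' _) _)

theorem totMap_lof {A B : Rep.{0} k G} (φ : A ⟶ B) (m : ℕ) (x : groupCohomology A m) :
    totMap φ (DirectSum.lof k ℕ (fun m => groupCohomology A m) m x) =
      DirectSum.lof k ℕ (fun m => groupCohomology B m) m
        (cohMap φ m x) := by
  exact DirectSum.lmap_lof (fun m => cohMap φ m) m x

theorem totCup_lof {A B C : Rep.{0} k G} (β : A →ₗ[k] B →ₗ[k] C)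
    (hβ : ∀ g a b, C.ρ g (β a b) = β (A.ρ g a) (B.ρ g b)) (j : ℕ) (b : groupCohomology B j)
    (m : ℕ) (x : groupCohomology A m) :
    totCup β hβ j b (DirectSum.lof k ℕ (fun m => groupCohomology A m) m x) =
      DirectSum.lof k ℕ (fun m => groupCohomology C m) (m + j) (cup β hβ m j x b) := by
  rw [totCup, DirectSum.toModule_lof]
  rfl

theorem totCoh_induction {A : Rep.{0} k G} {M : Type*} [AddCommGroup M] [Module k M]
    {f g : totCoh A →ₗ[k] M}
    (h : ∀ m x, f (DirectSum.lof k ℕ (fun m => groupCohomology A m) m x) =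
      g (DirectSum.lof k ℕ (fun m => groupCohomology A m) m x)) (x : totCoh A) : f x = g x := by
  have : f = g := DirectSum.linearMap_ext k fun m => LinearMap.ext fun x => h m x
  rw [this]

theorem totMap_totMap {A B C : Rep.{0} k G} (φ : A ⟶ B) (ψ : B ⟶ C) (x : totCoh A) :
    totMap ψ (totMap φ x) = totMap (φ ≫ ψ) x := by
  refine totCoh_induction (f := totMap ψ ∘ₗ totMap φ) (fun m x => ?_) x
  rw [LinearMap.comp_apply, totMap_lof, totMap_lof, totMap_lof, cohMap_cohMap]

/-- Needed in this generality for evaluation, where the second coefficient module changes along with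
the first. -/
theorem totMap_totCup {A B C A' B' C' : Rep.{0} k G} (β : A →ₗ[k] B →ₗ[k] C)
    (hβ : ∀ g a b, C.ρ g (β a b) = β (A.ρ g a) (B.ρ g b)) (β' : A' →ₗ[k] B' →ₗ[k] C')
    (hβ' : ∀ g a b, C'.ρ g (β' a b) = β' (A'.ρ g a) (B'.ρ g b))
    (φ : A ⟶ A') (ψ : B ⟶ B') (χ : C ⟶ C')
    (h : ∀ a b, χ.hom (β a b) = β' (φ.hom a) (ψ.hom b)) (j : ℕ)
    (b : groupCohomology B j) (x : totCoh A) :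
    totMap χ (totCup β hβ j b x) =
      totCup β' hβ' j (cohMap ψ j b) (totMap φ x) := by
  refine totCoh_induction (f := totMap χ ∘ₗ totCup β hβ j b)
    (g := totCup β' hβ' j (cohMap ψ j b) ∘ₗ totMap φ)
    (fun m x => ?_) x
  rw [LinearMap.comp_apply, LinearMap.comp_apply, totCup_lof, totMap_lof, totMap_lof, totCup_lof,
    map_cup β hβ β' hβ' φ ψ χ h]

/-- The case of a fixed second coefficient module. It applies to cup products with b, whose
Steinberg coefficients are the same at every level. -/
theorem totMap_totCup_id {A B C A' C' : Rep.{0} k G} (β : A →ₗ[k] B →ₗ[k] C)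
    (hβ : ∀ g a b, C.ρ g (β a b) = β (A.ρ g a) (B.ρ g b)) (β' : A' →ₗ[k] B →ₗ[k] C')
    (hβ' : ∀ g a b, C'.ρ g (β' a b) = β' (A'.ρ g a) (B.ρ g b))
    (φ : A ⟶ A') (χ : C ⟶ C') (h : ∀ a b, χ.hom (β a b) = β' (φ.hom a) b) (j : ℕ)
    (b : groupCohomology B j) (x : totCoh A) :
    totMap χ (totCup β hβ j b x) = totCup β' hβ' j b (totMap φ x) := by
  rw [totMap_totCup β hβ β' hβ' φ (𝟙 B) χ h, cohMap_id]

/-- The two orders of a triple cup product land in degrees m + i + 1 and m + 1 + i, which are equal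
only propositionally. Comparing inside the direct sum avoids transport, and testing on infinite
sequences lets cochains of both degrees be evaluated at the same argument. -/
theorem lof_cohMk_eq {C : Rep.{0} k G} {n n' l : ℕ} (hn : n = n') (hl : l + 1 = n)
    (X : cocyc C n) (Y : cocyc C n') (Z : (Fin l → G) → C)
    (h : ∀ y : ℕ → G, X.1 (fun a => y a) - Y.1 (fun a => y a) = dCoch C l Z (fun a => y a)) :
    DirectSum.lof k ℕ (fun m => groupCohomology C m) n (cohMk C n X) =
      DirectSum.lof k ℕ (fun m => groupCohomology C m) n' (cohMk C n' Y) := by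
  subst hn
  congr 1
  rw [← sub_eq_zero, ← map_sub, cohMk_eq_zero_iff]
  exact mem_cobdry_of hl Z _ h

/-- This is the cocycle condition in degree 1, read as the law of a crossed homomorphism. -/
theorem cocyc_one_mul (B : Rep.{0} k G) (b : cocyc B 1) (g h : G) :
    b.1 (fun _ => g * h) = b.1 (fun _ => g) + B.ρ g (b.1 fun _ => h) := by
  have h1 : dCoch B 1 b.1 = 0 := b.2
  -- Only the first two terms of the sequence matter, and they are `g` and `h`.
  have h2 := dCoch_nat B b.1 (fun n => if n = 0 then g else h)
  rw [h1] at h2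
  have e : ∀ y : ℕ → G, (fun a : Fin 1 => y a) = fun _ => y 0 := fun y =>
    funext fun a => by rw [Subsingleton.elim a 0]; rfl
  rw [Finset.sum_range_succ, Finset.sum_range_one, e (cN 0 _), e (cN 1 _), e fun a => if a + 1 = 0 then g else h] at h2
  simp only [Pi.zero_apply, cN] at h2
  simp at h2
  rw [eq_comm, ← sub_eq_zero, eq_comm, h2]
  abel

/-! ### Graded commutativity against a class of degree 1. -/

section Swap

variable {M B : Rep.{0} k G}

/-- The cochain `(x₁, …, xᵢ) ↦ a(x₁, …, xᵢ) ⊗ b(x₁ ⋯ xᵢ)`, which relates `a ∪ b` and `b ∪ a`. -/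
noncomputable def swapCoch {i : ℕ} (a : (Fin i → G) → M) (b : (Fin 1 → G) → B) :
    (Fin i → G) → Rep.of (M.ρ.tprod B.ρ) :=
  fun x => a x ⊗ₜ[k] b fun _ => (List.ofFn x).prod

theorem swapCoch_nat {i : ℕ} (a : (Fin i → G) → M) (b : (Fin 1 → G) → B) (y : ℕ → G) :
    swapCoch a b (fun j => y j) = a (fun j => y j) ⊗ₜ[k] b fun _ => pN y i := rfl

/-- The cocycle condition of `a` removes all inner contractions, and the crossed homomorphism law
for `b` splits b(y₀⋯yᵢ) both after the first factor and before the last. The terms containing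
b(y₀⋯yᵢ) itself cancel. What survives is a ∪ b, up to (-1)^i, and b ∪ a with its factors exchanged.
-/
theorem swapCoch_d {i : ℕ} (a : cocyc M i) (b : cocyc B 1) (y : ℕ → G) :
    dCoch (Rep.of (M.ρ.tprod B.ρ)) i (swapCoch a.1 b.1) (fun j => y j) =
      (-1 : k) ^ i • (a.1 (fun j => y j) ⊗ₜ[k] B.ρ (pN y i) (b.1 fun _ => y i)) -
        M.ρ (y 0) (a.1 fun j => y (j + 1)) ⊗ₜ[k] b.1 fun _ => y 0 := by
  have ha : dCoch M i a.1 = 0 := a.2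
  have h1 := dCoch_nat M a.1 y
  rw [ha, Finset.sum_range_succ] at h1
  have e3 : (a.1 fun j => cN i y j) = a.1 fun j => y j := by
    refine congr_arg a.1 (funext fun j => ?_)
    simp [cN, j.2]
  rw [e3] at h1
  rw [dCoch_nat, Finset.sum_range_succ]
  -- Contracting two neighbours among y₀, …, yᵢ keeps the full product, so these terms share one
  -- second tensor factor. The contraction of index `i` instead drops yᵢ and is treated in `e4`.
  have e1 : ∀ m ∈ Finset.range i, (-1 : k) ^ (m + 1) • swapCoch a.1 b.1 (fun j => cN m y j) =
      ((-1 : k) ^ (m + 1) • a.1 fun j => cN m y j) ⊗ₜ[k] b.1 fun _ => pN y (i + 1) := by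
    intro m hm
    rw [swapCoch_nat, pN_cN_of_lt y i m (Finset.mem_range.1 hm), TensorProduct.smul_tmul']
  rw [Finset.sum_congr rfl e1, ← TensorProduct.sum_tmul]
  -- The equation da = 0, solved for its inner terms.
  have e2 : ∑ m ∈ Finset.range i, ((-1 : k) ^ (m + 1) • a.1 fun j => cN m y j) =
      - M.ρ (y 0) (a.1 fun j => y (j + 1)) - (-1 : k) ^ (i + 1) • a.1 fun j => y j := by
    rw [eq_sub_iff_add_eq, eq_neg_iff_add_eq_zero, add_comm]
    exact h1.symm
  have e4 : swapCoch a.1 b.1 (fun j => cN i y j) = a.1 (fun j => y j) ⊗ₜ[k] b.1 fun _ => pN y i := by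
    rw [swapCoch_nat, pN_cN_of_ge y i i le_rfl, e3]
  have e5 : (Rep.of (M.ρ.tprod B.ρ)).ρ (y 0) (swapCoch a.1 b.1 fun j => y (j + 1)) =
      M.ρ (y 0) (a.1 fun j => y (j + 1)) ⊗ₜ[k]
        (b.1 (fun _ => pN y (i + 1)) - b.1 fun _ => y 0) := by
    rw [pN_succ', cocyc_one_mul, add_sub_cancel_left]
    rfl
  have e6 : (b.1 fun _ => pN y (i + 1)) = (b.1 fun _ => pN y i) +
      B.ρ (pN y i) (b.1 fun _ => y i) := by
    rw [pN_succ, cocyc_one_mul]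
  rw [e2, e4, e5, e6]
  simp only [TensorProduct.tmul_add, TensorProduct.tmul_sub, TensorProduct.sub_tmul,
    TensorProduct.neg_tmul, ← TensorProduct.smul_tmul', pow_succ (-1 : k) i, mul_neg, mul_one,
    neg_smul]
  abel

end Swap

/-- Graded commutativity `(m ∪ a) ∪ b = (-1)ⁱ (m ∪ b) ∪ a` of the cup product for classes `a` of
degree `i` and `b` of degree `1`. -/
theorem totCup_swap {A M B A' C' C : Rep.{0} k G}
    (β₁ : A →ₗ[k] M →ₗ[k] A') (h₁ : ∀ g a b, A'.ρ g (β₁ a b) = β₁ (A.ρ g a) (M.ρ g b))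
    (β₂ : A' →ₗ[k] B →ₗ[k] C) (h₂ : ∀ g a b, C.ρ g (β₂ a b) = β₂ (A'.ρ g a) (B.ρ g b))
    (β₃ : A →ₗ[k] B →ₗ[k] C') (h₃ : ∀ g a b, C'.ρ g (β₃ a b) = β₃ (A.ρ g a) (B.ρ g b))
    (β₄ : C' →ₗ[k] M →ₗ[k] C) (h₄ : ∀ g a b, C.ρ g (β₄ a b) = β₄ (C'.ρ g a) (M.ρ g b))
    (h : ∀ x m b, β₂ (β₁ x m) b = β₄ (β₃ x b) m) (i : ℕ) (a : groupCohomology M i)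
    (b : groupCohomology B 1) (x : totCoh A) :
    totCup β₂ h₂ 1 b (totCup β₁ h₁ i a x) =
      (-1 : k) ^ i • totCup β₄ h₄ i a (totCup β₃ h₃ 1 b x) := by
  refine totCoh_induction (f := totCup β₂ h₂ 1 b ∘ₗ totCup β₁ h₁ i a)
    (g := (-1 : k) ^ i • totCup β₄ h₄ i a ∘ₗ totCup β₃ h₃ 1 b) (fun m x => ?_) x
  rw [LinearMap.smul_apply, LinearMap.comp_apply, LinearMap.comp_apply, totCup_lof, totCup_lof,
    totCup_lof, totCup_lof]
  obtain ⟨x, rfl⟩ := cohMk_surjective _ _ x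
  obtain ⟨a, rfl⟩ := cohMk_surjective _ _ a
  obtain ⟨b, rfl⟩ := cohMk_surjective _ _ b
  rw [cup_cohMk, cup_cohMk, cup_cohMk, cup_cohMk, ← map_smul, ← map_smul]
  -- The common trilinear map, regarded as a pairing of `A` with M ⊗ B, so that `x` can be cupped
  -- with the homotopy `swapCoch`.
  let τ : A →ₗ[k] Rep.of (M.ρ.tprod B.ρ) →ₗ[k] C :=
    (TensorProduct.uncurry (.id k) M B C) ∘ₗ (LinearMap.compr₂ β₁ β₂)
  have hτ : ∀ a m b, τ a (m ⊗ₜ[k] b) = β₂ (β₁ a m) b := fun _ _ _ => rfl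
  have hτ' : ∀ g a d, C.ρ g (τ a d) = τ (A.ρ g a) ((Rep.of (M.ρ.tprod B.ρ)).ρ g d) := by
    intro g a d
    induction d using TensorProduct.induction_on with
    | zero => simp only [map_zero]
    | tmul m b =>
      rw [hτ, h₂, h₁, ← hτ]
      rfl
    | add d d' h h' => simp only [map_add, h, h']
  -- The Leibniz rule past `x` contributes (-1)^m, and `swapCoch_d` puts (-1)^i on the a ∪ b term.
  -- The factor (-1)^(m+i) normalizes the coefficient of (x ∪ a) ∪ b to 1 and leaves -(-1)^i on the
  -- other term.
  refine lof_cohMk_eq (l := m + i) (by omega) rfl _ _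
    ((-1 : k) ^ (m + i) • cupCoch τ m i x.1 (swapCoch a.1 b.1)) fun y => ?_
  have hx : dCoch A m x.1 = 0 := x.2
  rw [map_smul, Pi.smul_apply, leibniz τ hτ', hx, swapCoch_d a b (fun j => y (m + j))]
  have e : ∀ (y : ℕ → G) (c : ℕ), (fun a : Fin 1 => y (c + a)) = fun _ => y c := fun y c =>
    funext fun a => by rw [Subsingleton.elim a 0]; rfl
  change β₂ (β₁ (x.1 fun a => y a) (M.ρ (pN y m) (a.1 fun j => y (m + j))))
      (B.ρ (pN y (m + i)) (b.1 fun a => y (m + i + a))) -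
    (-1 : k) ^ i • β₄ (β₃ (x.1 fun a => y a) (B.ρ (pN y m) (b.1 fun j => y (m + j))))
      (M.ρ (pN y (m + 1)) (a.1 fun j => y (m + 1 + j))) = _
  rw [e, e, ← h]
  have e1 : ∀ u v, (Rep.of (M.ρ.tprod B.ρ)).ρ (pN y m) (u ⊗ₜ[k] v) =
    M.ρ (pN y m) u ⊗ₜ[k] B.ρ (pN y m) v := fun _ _ => rfl
  have e2 : pN y (m + i) = pN y m * pN (fun j => y (m + j)) i := by
    clear * -
    induction i with
    | zero => simp [pN]
    | succ i ih => rw [← add_assoc, pN_succ, ih, pN_succ, mul_assoc]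
  have e3 : (fun j : Fin i => y (m + 1 + j)) = fun j : Fin i => y (m + (j + 1)) := by
    ext j; congr 1; omega
  rw [map_sub, map_smul, map_sub, map_smul, e1, e1, hτ, hτ, e2, e3, map_mul, pN_succ, map_mul]
  simp only [Pi.zero_apply, map_zero, LinearMap.zero_apply, zero_add, smul_sub, smul_smul,
    Module.End.mul_apply, add_zero]
  have e4 : (-1 : k) ^ (m + i) * ((-1) ^ m * (-1) ^ i) = 1 := by
    rw [← pow_add, ← pow_add, Even.neg_one_pow ⟨m + i, by omega⟩]
  have e5 : (-1 : k) ^ (m + i) * (-1) ^ m = (-1) ^ i := by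
    rw [← pow_add, add_right_comm, pow_add, Even.neg_one_pow ⟨m, rfl⟩, one_mul]
  rw [e4, e5, one_smul]

end CupProducts
end DHecke

namespace DHecke

/-! ### The prism homotopy on homogeneous cochains. -/

section Prism

variable {X Y R : Type} [CommRing R]

/-- The sequence `x, t 0, t 1, …`. -/
def consSeq (x : X) (t : ℕ → X) : ℕ → X
  | 0 => x
  | n + 1 => t n

/-- The sequence `t` without its term of index `m`. -/
def skipSeq (m : ℕ) (t : ℕ → X) (j : ℕ) : X := if j < m then t j else t (j + 1)

/-- The homogeneous coboundary, for a function `φ` of the first `n` terms of a sequence. -/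
def altSum (n : ℕ) (φ : (ℕ → X) → R) (t : ℕ → X) : R :=
  ∑ m ∈ Finset.range (n + 1), (-1 : R) ^ m * φ (skipSeq m t)

/-- A function of sequences depends only on the first `n` terms. -/
def DependsOnFirst (n : ℕ) (φ : (ℕ → X) → R) : Prop :=
  ∀ s t : ℕ → X, (∀ j < n, s j = t j) → φ s = φ t

theorem DependsOnFirst.comp_consSeq {n : ℕ} {φ : (ℕ → X) → R} (h : DependsOnFirst (n + 1) φ)
    (x : X) : DependsOnFirst n fun s => φ (consSeq x s) := by
  refine fun s t hst => h _ _ fun j hj => ?_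
  cases j with
  | zero => rfl
  | succ j => exact hst j (by omega)

theorem consSeq_head_tail (t : ℕ → X) : consSeq (t 0) (fun j => t (j + 1)) = t := by
  funext j
  cases j <;> rfl

theorem comp_consSeq (T : X → Y) (x : X) (t : ℕ → X) :
    T ∘ consSeq x t = consSeq (T x) (T ∘ t) := by
  funext j
  cases j <;> rfl

theorem skipSeq_zero (t : ℕ → X) : skipSeq 0 t = fun j => t (j + 1) := rfl

theorem skipSeq_succ_consSeq (m : ℕ) (x : X) (t : ℕ → X) :
    skipSeq (m + 1) (consSeq x t) = consSeq x (skipSeq m t) := by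
  funext j
  cases j with
  | zero => simp [skipSeq, consSeq]
  | succ j => simp [skipSeq, consSeq]

/-- Omitting the first point leaves φ(t). Every other omission happens behind `x`, and its index
shift costs a sign. This recursion drives the inductions below. -/
theorem altSum_consSeq (n : ℕ) (φ : (ℕ → X) → R) (x : X) (t : ℕ → X) :
    altSum (n + 1) φ (consSeq x t) = φ t - altSum n (fun s => φ (consSeq x s)) t := by
  rw [altSum, Finset.sum_range_succ', add_comm, sub_eq_add_neg, altSum, ← Finset.sum_neg_distrib]
  congr 1
  · rw [pow_zero, one_mul, skipSeq_zero]
    rfl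
  · refine Finset.sum_congr rfl fun m _ => ?_
    rw [skipSeq_succ_consSeq, pow_succ]
    ring

/-- The prism operator: the homotopy between the pullbacks along `T₁` and `T₂`. -/
def prism (T₁ T₂ : X → Y) : ℕ → ((ℕ → Y) → R) → (ℕ → X) → R
  | 0, _, _ => 0
  | n + 1, φ, t => φ (consSeq (T₁ (t 0)) (T₂ ∘ t)) -
      prism T₁ T₂ n (fun s => φ (consSeq (T₁ (t 0)) s)) fun j => t (j + 1)

theorem prism_sub (T₁ T₂ : X → Y) (n : ℕ) (φ ψ : (ℕ → Y) → R) (t : ℕ → X) :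
    prism T₁ T₂ n (fun s => φ s - ψ s) t = prism T₁ T₂ n φ t - prism T₁ T₂ n ψ t := by
  induction n generalizing φ ψ t with
  | zero => simp [prism]
  | succ n ih =>
    simp only [prism, ih]
    ring

theorem prism_zero (T₁ T₂ : X → Y) (n : ℕ) (t : ℕ → X) :
    prism T₁ T₂ n (fun _ => (0 : R)) t = 0 := by
  induction n generalizing t with
  | zero => rfl
  | succ n ih => simp only [prism, ih, sub_zero]

/-- Each prism term repeats one point, once under `T₁` and once under `T₂`, so `n` points of `X`
supply the n + 1 arguments of `φ`. -/
theorem prism_congr (T₁ T₂ : X → Y) {n : ℕ} {φ : (ℕ → Y) → R} (hφ : DependsOnFirst (n + 1) φ) :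
    DependsOnFirst n (prism T₁ T₂ n φ) := by
  induction n generalizing φ with
  | zero => exact fun _ _ _ => rfl
  | succ n ih =>
    intro s t h
    have h0 : s 0 = t 0 := h 0 (by omega)
    rw [prism, prism, h0]
    congr 1
    · refine hφ _ _ fun j hj => ?_
      cases j with
      | zero => rfl
      | succ j => exact congr_arg T₂ (h j (by omega))
    · exact ih (hφ.comp_consSeq _) _ _ fun j hj => h (j + 1) (by omega)

/-- This is how an invariance of `φ` is inherited by its prism when `T₁` and `T₂` are equivariant.
-/
theorem prism_comp (T₁ T₂ : X → Y) (n : ℕ) (φ : (ℕ → Y) → R) (a : X → X) (b : Y → Y)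
    (h₁ : ∀ x, T₁ (a x) = b (T₁ x)) (h₂ : ∀ x, T₂ (a x) = b (T₂ x)) (t : ℕ → X) :
    prism T₁ T₂ n φ (a ∘ t) = prism T₁ T₂ n (fun s => φ (b ∘ s)) t := by
  induction n generalizing φ t with
  | zero => rfl
  | succ n ih =>
    simp only [prism, comp_consSeq, Function.comp_apply, h₁]
    have h3 : T₂ ∘ a ∘ t = b ∘ T₂ ∘ t := funext fun j => h₂ _
    rw [h3]
    congr 1
    exact ih _ fun j => t (j + 1)

/-- The recursion for `prism` splits off the first point, and omitting a later point commutes with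
applying `T₂`. -/
theorem altSum_prism_consSeq (T₁ T₂ : X → Y) (n : ℕ) (φ : (ℕ → Y) → R) (x : X) (t : ℕ → X) :
    altSum n (fun s => prism T₁ T₂ (n + 1) φ (consSeq x s)) t =
      altSum n (fun s => φ (consSeq (T₁ x) (consSeq (T₂ x) s))) (T₂ ∘ t) -
        altSum n (prism T₁ T₂ n fun s => φ (consSeq (T₁ x) s)) t := by
  rw [altSum, altSum, altSum, ← Finset.sum_sub_distrib]
  refine Finset.sum_congr rfl fun m _ => ?_
  have : T₂ ∘ skipSeq m t = skipSeq m (T₂ ∘ t) := by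
    funext j
    simp only [Function.comp_apply, skipSeq]
    split_ifs <;> rfl
  rw [prism, comp_consSeq, this, ← mul_sub]
  rfl

/-- Unfolded, the prism of `φ` is the sum of (-1)^m φ(T₁t₀, …, T₁tₘ, T₂tₘ, …, T₂tₙ₋₁). In dP + Pd
the faces of neighbouring prisms cancel and only the two ends remain. The formal proof is an
induction that freezes the first argument of `φ` at T₁t₀. -/
theorem altSum_prism (T₁ T₂ : X → Y) (n : ℕ) (φ : (ℕ → Y) → R) (hφ : DependsOnFirst (n + 1) φ)
    (t : ℕ → X) :
    altSum n (prism T₁ T₂ n φ) t + prism T₁ T₂ (n + 1) (altSum (n + 1) φ) t =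
      φ (T₂ ∘ t) - φ (T₁ ∘ t) := by
  induction n generalizing φ t with
  | zero =>
    have h1 : altSum 0 (prism T₁ T₂ 0 φ) t = 0 := by simp [altSum, prism]
    have h2 : prism T₁ T₂ 1 (altSum 1 φ) t = altSum 1 φ (consSeq (T₁ (t 0)) (T₂ ∘ t)) := by
      simp [prism]
    rw [h1, h2, zero_add, altSum_consSeq]
    congr 1
    simp only [altSum, zero_add, Finset.sum_range_one, pow_zero, one_mul]
    -- The two sequences agree only in their first term, which is all that `φ` reads.
    refine hφ _ _ fun j hj => ?_
    obtain rfl : j = 0 := by omega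
    rfl
  | succ n ih =>
    have ht : consSeq (t 0) (fun j => t (j + 1)) = t := consSeq_head_tail t
    obtain ⟨x, s, rfl⟩ : ∃ x s, t = consSeq x s := ⟨_, _, ht.symm⟩
    -- Once the first point is split off everywhere, all other contributions cancel against this
    -- instance, except φ at T₂ ∘ t and φ at (T₁x, T₂ ∘ s).
    have key := ih (fun s => φ (consSeq (T₁ x) s)) (hφ.comp_consSeq _) s
    rw [altSum_consSeq, altSum_prism_consSeq]
    have h1 : prism T₁ T₂ (n + 1 + 1) (altSum (n + 1 + 1) φ) (consSeq x s) =
        altSum (n + 1 + 1) φ (consSeq (T₁ x) (consSeq (T₂ x) (T₂ ∘ s))) -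
          prism T₁ T₂ (n + 1) (fun u => altSum (n + 1 + 1) φ (consSeq (T₁ x) u)) s := by
      rw [prism, comp_consSeq]
      rfl
    rw [h1, altSum_consSeq, altSum_consSeq]
    simp only [altSum_consSeq, prism_sub, comp_consSeq]
    linear_combination key

end Prism

/-! ### Independence of the choice of equivariant map in Shapiro's lemma. -/

section Independence

variable {𝒢 H Q R : Type} [Group 𝒢] [Group H] [Group Q] [CommRing R]

/-- The passage from inhomogeneous to homogeneous cochains. Omitting an inner point multiplies the
two ratios that meet there, and omitting the first point gives the term with the group action, which
is trivial here. -/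
theorem altSum_ratios {i : ℕ} (c : (Fin i → Q) → R) (s : ℕ → Q) :
    altSum (i + 1) (fun s : ℕ → Q => c fun j : Fin i => (s j)⁻¹ * s (j + 1)) s =
      dCoch (Rep.trivial R Q R) i c fun j => (s j)⁻¹ * s (j + 1) := by
  rw [dCoch_nat (Rep.trivial R Q R) c fun j => (s j)⁻¹ * s (j + 1), altSum,
    Finset.sum_range_succ', add_comm]
  congr 1
  · rw [pow_zero, one_mul]
    rfl
  · refine Finset.sum_congr rfl fun m _ => ?_
    rw [smul_eq_mul]
    congr 2
    funext j
    simp only [skipSeq, cN, Nat.add_lt_add_iff_right]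
    rcases lt_trichotomy (j : ℕ) m with h | h | h
    · rw [if_pos (by omega), if_pos h, if_pos h]
    · rw [if_pos (by omega), if_neg (by omega), if_neg (by omega), if_pos h]
      group
    · rw [if_neg (by omega), if_neg (by omega), if_neg (by omega), if_neg (by omega)]

/-- At a fixed `a`, a cochain of this shape is a function of the points a⁻¹, a⁻¹δ(y₀), a⁻¹δ(y₀y₁),
…. The action of y₀ replaces a⁻¹ by a⁻¹δ(y₀), which omits the first point, and the contractions omit
the others. The differential thus becomes the homogeneous one. -/
theorem dCoch_fnRep_nat (δ : H →* 𝒢) (K : Subgroup 𝒢) {l : ℕ}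
    (b : (Fin l → H) → fnRep R δ K (.trivial ℤ H ℤ) 1) (ψ : (ℕ → 𝒢) → R)
    (hb : ∀ (y : ℕ → H) a, (b fun j => y j).1 a 1 = ψ fun m => a⁻¹ * δ (pN y m))
    (y : ℕ → H) (a : 𝒢) :
    (dCoch _ l b fun j => y j).1 a 1 = altSum (l + 1) ψ fun m => a⁻¹ * δ (pN y m) := by
  let E : fnRep R δ K (.trivial ℤ H ℤ) 1 →ₗ[R] R :=
    { toFun := fun (Φ : fnSpace R ℤ K) => Φ.1 a 1, map_add' := fun _ _ => rfl,
      map_smul' := fun _ _ => rfl }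
  have hE : ∀ y : ℕ → H, E (b fun j => y j) = ψ fun m => a⁻¹ * δ (pN y m) := fun y => hb y a
  have h0 := congr_arg E (dCoch_nat (fnRep R δ K (.trivial ℤ H ℤ) 1) b y)
  refine h0.trans ?_
  rw [map_add, map_sum, altSum, Finset.sum_range_succ' _ (l + 1)]
  refine (add_comm _ _).trans (congr_arg₂ (· + ·) ?_ ?_)
  · refine Finset.sum_congr rfl fun m _ => ?_
    rw [map_smul, hE, smul_eq_mul]
    congr 2
    funext j
    rw [skipSeq]
    split_ifs with h
    · rw [pN_cN_of_ge y _ _ (by omega)]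
    · rw [pN_cN_of_lt y _ _ (by omega)]
  · have h1 : E ((fnRep R δ K (.trivial ℤ H ℤ) 1).ρ (y 0) (b fun j => y (j + 1))) =
        (b fun j => y (j + 1)).1 ((δ (y 0))⁻¹ * a) 1 := one_smul ℤ _
    rw [h1, hb (fun j => y (j + 1)), pow_zero, one_mul, skipSeq_zero]
    congr 1
    funext j
    rw [pN_succ' y, map_mul]
    group

/-- Two cocycles obtained from the same cocycle of `Q` by means of two maps `𝒢 → Q` which are
equivariant with respect to `κ : K → Q` have the same class. -/
theorem cohMk_eq_of_equivariant (δ : H →* 𝒢) (K : Subgroup 𝒢) (κ : K →* Q) {i : ℕ}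
    (c : cocyc (Rep.trivial R Q R) i) (T₁ T₂ : 𝒢 → Q)
    (h₁ : ∀ (k : K) g, T₁ (k * g) = κ k * T₁ g) (h₂ : ∀ (k : K) g, T₂ (k * g) = κ k * T₂ g)
    (x₁ x₂ : cocyc (fnRep R δ K (.trivial ℤ H ℤ) 1) i)
    (hx₁ : ∀ (y : ℕ → H) a, (x₁.1 fun j => y j).1 a 1 =
      c.1 fun j => (T₁ (a⁻¹ * δ (pN y j)))⁻¹ * T₁ (a⁻¹ * δ (pN y (j + 1))))
    (hx₂ : ∀ (y : ℕ → H) a, (x₂.1 fun j => y j).1 a 1 =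
      c.1 fun j => (T₂ (a⁻¹ * δ (pN y j)))⁻¹ * T₂ (a⁻¹ * δ (pN y (j + 1)))) :
    cohMk _ i x₁ = cohMk _ i x₂ := by
  cases i with
  | zero =>
    -- In degree 0 the cochain `c` has no arguments, so the two cocycles already coincide.
    congr 1
    refine Subtype.ext (funext fun g => ?_)
    obtain ⟨y, rfl⟩ := exists_nat_ext g
    refine Subtype.ext (funext fun a => LinearMap.ext_ring ?_)
    rw [hx₁, hx₂]
    exact congr_arg c.1 (Subsingleton.elim _ _)
  | succ l =>
    let φ : (ℕ → Q) → R := fun s => c.1 fun j => (s j)⁻¹ * s (j + 1)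
    have hφ : DependsOnFirst (l + 1 + 1) φ := fun s t h => by
      refine congr_arg c.1 (funext fun j => ?_)
      rw [h j (by omega), h (j + 1) (by omega)]
    -- Ratios are unchanged by left multiplication.
    have hinv : ∀ q : Q, (fun s : ℕ → Q => φ ((q * ·) ∘ s)) = φ := fun q => funext fun s => by
      refine congr_arg c.1 (funext fun j => ?_)
      simp [mul_assoc]
    have hc : altSum (l + 1 + 1) φ = fun _ => 0 := funext fun s => by
      have h0 : dCoch (Rep.trivial R Q R) (l + 1) c.1 = 0 := c.2
      rw [altSum_ratios c.1 s, h0]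
      rfl
    -- In this order the homotopy formula yields the pullback along `T₁` minus the pullback along
    -- `T₂`.
    let ψ : (ℕ → 𝒢) → R := prism T₂ T₁ (l + 1) φ
    -- Left `K`-invariance of `ψ` becomes right `K`-invariance in `a`, because `ψ` is evaluated at
    -- translates by a⁻¹. This puts the cochain `b` into the coefficient module.
    have hψ : ∀ (k : K) (t : ℕ → 𝒢), ψ (((k : 𝒢) * ·) ∘ t) = ψ t := fun k t => by
      refine (prism_comp T₂ T₁ (l + 1) φ ((k : 𝒢) * ·) (κ k * ·) (h₂ k) (h₁ k) t).trans ?_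
      rw [hinv]
    -- The padding by 1 is harmless: `ψ` reads l + 1 points, which are partial products of at most
    -- `l` entries.
    let e : (Fin l → H) → ℕ → H := fun g j => if h : j < l then g ⟨j, h⟩ else 1
    have he : ∀ (y : ℕ → H), ∀ m ≤ l, pN (e fun j => y j) m = pN y m := fun y m hm => by
      unfold pN
      congr 2
      funext j
      simp [e, lt_of_lt_of_le j.2 hm]
    let b : (Fin l → H) → fnRep R δ K (.trivial ℤ H ℤ) 1 := fun g =>
      (⟨fun a => LinearMap.toSpanSingleton ℤ R (ψ fun m => a⁻¹ * δ (pN (e g) m)), fun a k hk => by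
        beta_reduce
        rw [← hψ ⟨k, hk⟩ fun m => (a * k)⁻¹ * δ (pN (e g) m)]
        congr 2
        funext m
        simp [mul_assoc]⟩ : fnSpace R ℤ K)
    have hb : ∀ (y : ℕ → H) a, (b fun j => y j).1 a 1 = ψ fun m => a⁻¹ * δ (pN y m) := by
      intro y a
      refine (one_smul ℤ _).trans (prism_congr T₂ T₁ hφ _ _ fun j hj => ?_)
      rw [he y j (by omega)]
    rw [← sub_eq_zero, ← map_sub, cohMk_eq_zero_iff]
    refine mem_cobdry_of rfl b _ fun y => ?_
    refine Subtype.ext (funext fun a => LinearMap.ext_ring ?_)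
    rw [dCoch_fnRep_nat δ K b ψ hb y a]
    have h3 := altSum_prism T₂ T₁ (l + 1) φ hφ fun m => a⁻¹ * δ (pN y m)
    -- Since `c` is a cocycle, the term Pd of the homotopy formula vanishes.
    rw [hc, prism_zero, add_zero] at h3
    rw [h3]
    exact congr_arg₂ (· - ·) (hx₁ y a) (hx₂ y a)

end Independence
end DHecke

namespace DHecke

/-! ### Compatibility of the Steinberg pairing with translation, coset sums and products. -/

section SteinbergPairing

variable {𝒢 H L : Type} [Group 𝒢] [Group H] [Field L] [TopologicalSpace L] [IsTopologicalRing L]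
variable (N : ℕ) (δ : H →* 𝒢) (ι : H →* PGL(2, L)) (ε : H →* ℤˣ)

/-- As St(ℤ) → St(ℤ/N) is surjective, this computes every value of the pairing on an integral
vector, without unfolding `stExt`. -/
theorem stPair_stRed (K : Subgroup 𝒢) (Φ : fnRep (ZMod N) δ K ((stAction L ℤ).comp ι) ε)
    (x : St L ℤ) (a : 𝒢) : (stPair N δ K ι ε Φ (stRed L N x)).1 a 1 = Φ.1 a x :=
  (one_smul ℤ _).trans (stExt_stRed L N _ x)

theorem fnTrans_stPair {K K' : Subgroup 𝒢} (y : 𝒢) (hy : ∀ k ∈ K', y⁻¹ * k * y ∈ K)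
    (Φ : fnRep (ZMod N) δ K ((stAction L ℤ).comp ι) ε) (x : Rep.res ι (stRep L (ZMod N))) :
    (fnTrans δ (.trivial ℤ H ℤ) ε y hy).hom (stPair N δ K ι ε Φ x) =
      stPair N δ K' ι ε ((fnTrans δ ((stAction L ℤ).comp ι) ε y hy).hom Φ) x :=
  rfl

/-- The vector `x` does not depend on the adelic variable, so a sum over cosets is a sum in the
first argument of a bilinear pairing. -/
theorem fnCores_stPair {K K' : Subgroup 𝒢} [Fintype (K ⧸ K'.subgroupOf K)]
    (Φ : fnRep (ZMod N) δ K' ((stAction L ℤ).comp ι) ε) (x : Rep.res ι (stRep L (ZMod N))) :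
    (fnCores (K := K) δ (.trivial ℤ H ℤ) ε).hom (stPair N δ K' ι ε Φ x) =
      stPair N δ K ι ε ((fnCores δ ((stAction L ℤ).comp ι) ε).hom Φ) x := by
  obtain ⟨x, rfl⟩ := stRed_surjective L N x
  refine Subtype.ext (funext fun a => LinearMap.ext_ring ?_)
  refine Eq.trans ?_ (stPair_stRed N δ ι ε K _ x a).symm
  refine (LinearMap.sum_apply _ _ _).trans (Eq.trans ?_ (LinearMap.sum_apply _ _ _).symm)
  exact Finset.sum_congr rfl fun c _ => stPair_stRed N δ ι ε K' Φ x _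

/-- Scalars pass through evaluation at `x`. This is the trilinear identity demanded by
`totCup_swap`. -/
theorem stPair_fnMul (K : Subgroup 𝒢) (Φ : fnRep (ZMod N) δ K ((stAction L ℤ).comp ι) ε)
    (Ψ : fnRep (ZMod N) δ K (.trivial ℤ H ℤ) 1) (x : Rep.res ι (stRep L (ZMod N))) :
    stPair N δ K ι ε (fnMul δ K ((stAction L ℤ).comp ι) ε Φ Ψ) x =
      fnMul δ K (.trivial ℤ H ℤ) ε (stPair N δ K ι ε Φ x) Ψ := by
  obtain ⟨x, rfl⟩ := stRed_surjective L N x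
  refine Subtype.ext (funext fun a => LinearMap.ext_ring ?_)
  refine (stPair_stRed N δ ι ε K _ x a).trans ?_
  exact congr_arg (Ψ.1 a 1 * ·) (stPair_stRed N δ ι ε K Φ x a).symm

end SteinbergPairing

/-! ### Evaluation at a fixed vector, for abstract groups. -/

section Evaluation

variable {𝒢 𝒢' H P W R : Type} [Group 𝒢] [Group 𝒢'] [Group H] [Group P] [AddCommGroup W]
  [CommRing R]

/-- Pullback of functions along `f : 𝒢 → 𝒢'`. -/
def fnPull (R : Type) [CommRing R] {δ : H →* 𝒢} {δ' : H →* 𝒢'} (f : 𝒢 →* 𝒢')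
    (hf : ∀ γ, f (δ γ) = δ' γ) {K : Subgroup 𝒢} {K' : Subgroup 𝒢'} (hK : ∀ k ∈ K, f k ∈ K') :
    fnRep R δ' K' (.trivial ℤ H ℤ) 1 ⟶ fnRep R δ K (.trivial ℤ H ℤ) 1 :=
  Rep.ofHom
    { toFun := fun Φ : fnSpace R ℤ K' => (⟨fun a => Φ.1 (f a), fun a k hk => by
        beta_reduce; rw [map_mul, Φ.2 _ _ (hK k hk)]⟩ : fnSpace R ℤ K)
      map_add' := fun _ _ => rfl
      map_smul' := fun _ _ => rfl
      isIntertwining' := fun γ => by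
        refine LinearMap.ext fun Φ => Subtype.ext (funext fun a => LinearMap.ext_ring ?_)
        change (1 : ℤ) • Φ.1 ((δ' γ)⁻¹ * f a) 1 = (1 : ℤ) • Φ.1 (f ((δ γ)⁻¹ * a)) 1
        rw [map_mul, map_inv, hf] }

/-- Pullback of functions along `f : 𝒢 → 𝒢'`, followed by evaluation at the translates of a
vector `v`: `Φ ↦ (a ↦ Φ(f(a))(ρ(π(a)) v))`. -/
noncomputable def fnEv (R : Type) [CommRing R] {δ : H →* 𝒢} {δ' : H →* 𝒢'} (f : 𝒢 →* 𝒢')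
    (hf : ∀ γ, f (δ γ) = δ' γ) (ρ : Representation ℤ P W) (π : 𝒢 →* P) {ι : H →* P}
    (hπ : ∀ γ, π (δ γ) = ι γ) (ε : H →* ℤˣ) {K : Subgroup 𝒢} {K' : Subgroup 𝒢'}
    (hK : ∀ k ∈ K, f k ∈ K') (v : W) (hv : ∀ k ∈ K, ρ (π k) v = v) :
    fnRep R δ' K' (ρ.comp ι) ε ⟶ fnRep R δ K (.trivial ℤ H ℤ) ε :=
  Rep.ofHom
    { toFun := fun Φ : fnSpace R W K' =>
        (⟨fun a => LinearMap.toSpanSingleton ℤ R (Φ.1 (f a) (ρ (π a) v)), fun a k hk => by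
          beta_reduce
          rw [map_mul, map_mul, map_mul, Φ.2 _ _ (hK k hk), Module.End.mul_apply, hv k hk]⟩ :
          fnSpace R ℤ K)
      map_add' := fun Φ Ψ => by ext; simp
      map_smul' := fun c Φ => by ext; simp
      isIntertwining' := fun γ => by
        refine LinearMap.ext fun Φ => Subtype.ext (funext fun a => LinearMap.ext_ring ?_)
        change (1 : ℤ) • (ε γ : ℤ) • Φ.1 ((δ' γ)⁻¹ * f a) (ρ (ι γ⁻¹) (ρ (π a) v)) =
          (ε γ : ℤ) • (1 : ℤ) • Φ.1 (f ((δ γ)⁻¹ * a)) (ρ (π ((δ γ)⁻¹ * a)) v)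
        rw [one_smul, one_smul, map_mul, map_mul, map_mul, Module.End.mul_apply, map_inv f, map_inv π,
          map_inv ι, hf, hπ] }

section

variable {δ : H →* 𝒢} {δ' : H →* 𝒢'} {f : 𝒢 →* 𝒢'} (hf : ∀ γ, f (δ γ) = δ' γ)
  {ρ : Representation ℤ P W} {π : 𝒢 →* P} {ι : H →* P} (hπ : ∀ γ, π (δ γ) = ι γ) (ε : H →* ℤˣ)
  {K L : Subgroup 𝒢} {K' L' : Subgroup 𝒢'} (hK : ∀ k ∈ K, f k ∈ K') (hL : ∀ k ∈ L, f k ∈ L')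
  {v : W} (hv : ∀ k ∈ K, ρ (π k) v = v) (hvL : ∀ k ∈ L, ρ (π k) v = v)

theorem fnEv_apply (Φ : fnRep R δ' K' (ρ.comp ι) ε) (a : 𝒢) :
    ((fnEv R f hf ρ π hπ ε hK v hv).hom Φ).1 a 1 = Φ.1 (f a) (ρ (π a) v) := one_smul ℤ _

/-- Products are pointwise, and the scalar Ψ(f(a)) comes out of the evaluation. The second factor is
pulled back, which is why the class of α has to be compared on the two groups. -/
theorem fnEv_fnMul (Φ : fnRep R δ' K' (ρ.comp ι) ε) (Ψ : fnRep R δ' K' (.trivial ℤ H ℤ) 1) :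
    (fnEv R f hf ρ π hπ ε hK v hv).hom (fnMul δ' K' (ρ.comp ι) ε Φ Ψ) =
      fnMul δ K (.trivial ℤ H ℤ) ε ((fnEv R f hf ρ π hπ ε hK v hv).hom Φ)
        ((fnPull R f hf hK).hom Ψ) := by
  refine Subtype.ext (funext fun a => LinearMap.ext_ring ?_)
  refine (fnEv_apply hf hπ ε hK hv _ a).trans ?_
  exact congr_arg (Ψ.1 (f a) 1 * ·) (fnEv_apply hf hπ ε hK hv Φ a).symm

/-- As π(y) = 1, translation by `y` does not move the vector ρ(π(a)) v. -/
theorem fnTrans_fnEv {y : 𝒢} {y' : 𝒢'} (hy : ∀ k ∈ L, y⁻¹ * k * y ∈ K)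
    (hy' : ∀ k ∈ L', y'⁻¹ * k * y' ∈ K') (hfy : f y = y') (hπy : π y = 1) :
    fnTrans δ' (ρ.comp ι) ε y' hy' ≫ fnEv R f hf ρ π hπ ε hL v hvL =
      fnEv R f hf ρ π hπ ε hK v hv ≫ fnTrans δ (.trivial ℤ H ℤ) ε y hy := by
  refine Rep.hom_ext (Representation.IntertwiningMap.ext (LinearMap.ext fun Φ =>
    Subtype.ext (funext fun a => LinearMap.ext_ring ?_)))
  change (1 : ℤ) • Φ.1 (f a * y') (ρ (π a) v) = (1 : ℤ) • Φ.1 (f (a * y)) (ρ (π (a * y)) v)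
  rw [map_mul, map_mul π, hfy, hπy, mul_one]

/-- The two sums match term by term: `f` induces a bijection K/L → K'/L', and coset representatives,
being in `K`, fix `v`. -/
theorem fnCores_fnEv [Fintype (K ⧸ L.subgroupOf K)] [Fintype (K' ⧸ L'.subgroupOf K')]
    (hsurj : ∀ k' ∈ K', ∃ k ∈ K, f k = k') (hinj : ∀ k ∈ K, f k ∈ L' → k ∈ L) :
    fnCores δ' (ρ.comp ι) ε ≫ fnEv R f hf ρ π hπ ε hK v hv =
      fnEv R f hf ρ π hπ ε hL v hvL ≫ fnCores δ (.trivial ℤ H ℤ) ε := by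
  refine Rep.hom_ext (Representation.IntertwiningMap.ext (LinearMap.ext fun Φ =>
    Subtype.ext (funext fun a => LinearMap.ext_ring ?_)))
  let fK : K →* K' := (f.comp K.subtype).codRestrict K' fun k => hK k k.2
  -- Injectivity comes from `hinj`, surjectivity from `hsurj`. As `e` is defined through chosen
  -- representatives, these must be compared with given ones modulo `L`.
  let e : K ⧸ L.subgroupOf K → K' ⧸ L'.subgroupOf K' := fun c => (fK c.out : K' ⧸ _)
  have he : Function.Bijective e := by
    constructor
    · intro c c' h
      have h1 : ((fK c.out)⁻¹ * fK c'.out : K') ∈ L'.subgroupOf K' := QuotientGroup.eq.1 h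
      rw [← map_inv, ← map_mul] at h1
      rw [← QuotientGroup.out_eq' c, ← QuotientGroup.out_eq' c']
      exact QuotientGroup.eq.2 (hinj _ (c.out⁻¹ * c'.out).2 h1)
    · intro c'
      obtain ⟨k, hk, hk'⟩ := hsurj c'.out c'.out.2
      refine ⟨((⟨k, hk⟩ : K) : K ⧸ _), ?_⟩
      rw [← QuotientGroup.out_eq' c']
      have h1 : (((⟨k, hk⟩ : K) : K ⧸ L.subgroupOf K).out⁻¹ * (⟨k, hk⟩ : K) : K) ∈
          L.subgroupOf K := QuotientGroup.eq.1 (QuotientGroup.out_eq' _)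
      have h2 := hL _ h1
      refine QuotientGroup.eq.2 (?_ : _ ∈ L')
      rw [Subgroup.subtype_apply, Subgroup.coe_mul, Subgroup.coe_inv, ← hk']
      rw [map_mul, map_inv, map_mul, map_inv] at h2
      exact h2
  refine (fnEv_apply hf hπ ε hK hv _ a).trans ?_
  refine (LinearMap.sum_apply _ _ _).trans (Eq.trans ?_ (LinearMap.sum_apply _ _ _).symm)
  refine (Fintype.sum_bijective e he _ _ fun c => ?_).symm
  refine (fnEv_apply hf hπ ε hL hvL Φ _).trans ?_
  have h1 : ((e c).out⁻¹ * fK c.out : K') ∈ L'.subgroupOf K' :=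
    QuotientGroup.eq.1 (QuotientGroup.out_eq' _)
  rw [map_mul, map_mul π, map_mul ρ, Module.End.mul_apply, hv _ c.out.2]
  refine DFunLike.congr_fun ?_ (ρ (π a) v)
  -- The chosen representative of `e c` differs from the image of that of `c` by an element of `L'`,
  -- under which `Φ` is right invariant.
  refine Eq.trans (congr_arg Φ.1 ?_) (Φ.2 (f a * (e c).out) _ h1)
  change f a * f c.out = f a * (e c).out * (((e c).out : 𝒢')⁻¹ * f c.out)
  group

end

end Evaluation

/-! ### Levels and global classes away from two sets of primes. -/

section Adelic

variable {F : Type} [Field F] [NumberField F] {S T : Set (HeightOneSpectrum (𝓞 F))}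

theorem forgetComp_mem_level (hST : S ⊆ T) (𝔫 : Ideal (𝓞 F)) :
    ∀ k ∈ level S 𝔫, forgetComp hST k ∈ level T 𝔫 :=
  fun _ hk => mem_level.2 fun v hv => mem_level.1 hk v fun h => hv (hST h)

theorem forgetComp_mem_levelX (hST : S ⊆ T) (𝔫 : Ideal (𝓞 F)) {𝔮 : HeightOneSpectrum (𝓞 F)}
    (hS : 𝔮 ∉ S) (hT : 𝔮 ∉ T) (g : PGL(2, 𝔮.adicCompletion F)) :
    ∀ k ∈ levelX S 𝔫 𝔮 hS g, forgetComp hST k ∈ levelX T 𝔫 𝔮 hT g :=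
  fun k hk => ⟨forgetComp_mem_level hST 𝔫 k hk.1, hk.2⟩

/-- The extra condition defining `levelX` concerns the component at 𝔮 alone, and that component
survives because 𝔮 ∉ T. This supplies the injectivity on cosets in `fnCores_fnEv`. -/
theorem mem_levelX_of_forgetComp (hST : S ⊆ T) (𝔫 : Ideal (𝓞 F)) {𝔮 : HeightOneSpectrum (𝓞 F)}
    (hS : 𝔮 ∉ S) (hT : 𝔮 ∉ T) (g : PGL(2, 𝔮.adicCompletion F)) :
    ∀ k ∈ level S 𝔫, forgetComp hST k ∈ levelX T 𝔫 𝔮 hT g → k ∈ levelX S 𝔫 𝔮 hS g :=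
  fun _ hk h => ⟨hk, h.2⟩

/-- Level conditions are imposed prime by prime, so missing components can be filled in by 1. This
supplies the surjectivity on cosets. -/
theorem exists_mem_level_forgetComp (hST : S ⊆ T) (𝔫 : Ideal (𝓞 F)) :
    ∀ k' ∈ level T 𝔫, ∃ k ∈ level S 𝔫, forgetComp hST k = k' := by
  classical
  intro k' hk'
  let x : ∀ v : {v // v ∉ S}, PGL(2, v.1.adicCompletion F) := fun v =>
    if h : v.1 ∈ T then 1 else localComp T v.1 h k'
  have hx : ∀ v, x v ∈ locK0 v.1 𝔫 := by
    intro v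
    by_cases h : v.1 ∈ T
    · simp only [x, dif_pos h]
      exact one_mem _
    · simp only [x, dif_neg h]
      exact mem_level.1 hk' v.1 h
  refine ⟨⟨x, .of_forall fun v => locK0_le v.1 𝔫 (hx v)⟩, mem_level.2 fun v hv => hx ⟨v, hv⟩, ?_⟩
  refine RestrictedProduct.ext _ _ fun v => ?_
  exact dif_neg v.2

theorem forgetComp_single (hST : S ⊆ T) {𝔮 : HeightOneSpectrum (𝓞 F)}
    (hS : 𝔮 ∉ S) (hT : 𝔮 ∉ T) (y : PGL(2, 𝔮.adicCompletion F)) :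
    forgetComp hST (single S 𝔮 hS y) = single T 𝔮 hT y := by
  refine RestrictedProduct.ext _ _ fun v => ?_
  change localComp S v.1 (fun h => v.2 (hST h)) (single S 𝔮 hS y) =
    localComp T v.1 v.2 (single T 𝔮 hT y)
  obtain ⟨v, hv⟩ := v
  by_cases h : v = 𝔮
  · subst h
    rw [comp_single, comp_single]
  · rw [comp_single_of_ne _ _ _ _ _ _ h, comp_single_of_ne _ _ _ _ _ _ h]

theorem map_pN {G G' : Type} [Group G] [Group G'] (f : G →* G') (y : ℕ → G) (m : ℕ) :
    pN (fun j => f (y j)) m = f (pN y m) := by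
  simp only [pN, map_list_prod, List.map_ofFn]
  rfl

theorem forgetComp_diagEmb (hST : S ⊆ T) (γ : PGL(2, F)) :
    forgetComp hST (diagEmb S γ) = diagEmb T γ := rfl

/-- Inflation, Shapiro's lemma and restriction are followed on cocycles. The outcome has the shape
required by `cohMk_eq_of_equivariant`, with the map `shapT` followed by projection to the component
at 𝔮. -/
theorem exists_cocyc_globalClass (N : ℕ) (S : Set (HeightOneSpectrum (𝓞 F))) (𝔫 : Ideal (𝓞 F))
    {𝔮 : HeightOneSpectrum (𝓞 F)} (hS : 𝔮 ∉ S) (g : PGL(2, 𝔮.adicCompletion F)) (i : ℕ)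
    (α : continuousCohomology i (trivTop (ZMod N) (locKx 𝔮 g)))
    (c : cocyc (Rep.trivial (ZMod N) (locKx 𝔮 g) (ZMod N)) i)
    (hc : cohMk _ i c = contCompare (ZMod N) (locKx 𝔮 g) i α) :
    ∃ x : cocyc (fnRep (ZMod N) (diagEmb S) (levelX S 𝔫 𝔮 hS g) (.trivial ℤ PGL(2, F) ℤ) 1) i,
      globalClass N S 𝔫 hS g i α = cohMk _ i x ∧ ∀ (y : ℕ → PGL(2, F)) a,
        (x.1 fun j => y j).1 a 1 = c.1 fun j =>
          (levelXComp S 𝔫 𝔮 hS g (shapT (levelX S 𝔫 𝔮 hS g) (a⁻¹ * diagEmb S (pN y j))))⁻¹ *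
            levelXComp S 𝔫 𝔮 hS g
              (shapT (levelX S 𝔫 𝔮 hS g) (a⁻¹ * diagEmb S (pN y (j + 1)))) := by
  have h1 := map_cohMk (levelXComp S 𝔫 𝔮 hS g)
    (A := Rep.trivial (ZMod N) (locKx 𝔮 g) (ZMod N))
    (B := Rep.trivial (ZMod N) (levelX S 𝔫 𝔮 hS g) (ZMod N)) (𝟙 _) i c
  rw [hc] at h1
  refine ⟨_, ((congr_arg _ (congr_arg (shapiro (levelX S 𝔫 𝔮 hS g) i) h1)).trans
    (congr_arg _ (cohDesc_cohMk _ _ _ _ _))).trans (map_cohMk (diagEmb S)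
      (fnRes (ZMod N) (diagEmb S) (levelX S 𝔫 𝔮 hS g)) i _), fun y a => ?_⟩
  refine (shapCoch_nat (levelX S 𝔫 𝔮 hS g) i (fun x => c.1 (levelXComp S 𝔫 𝔮 hS g ∘ x))
    (fun j => diagEmb S (y j)) a 1).trans ((one_smul ℤ _).trans ?_)
  refine congr_arg c.1 (funext fun j => ?_)
  rw [Function.comp_apply, shapSeq, map_mul, map_inv, map_pN, map_pN]

/-- The global classes attached to `α` away from `S` and away from `T ⊇ S` are compatible. -/
theorem cohMap_globalClass (N : ℕ) (hST : S ⊆ T) (𝔫 : Ideal (𝓞 F)) {𝔮 : HeightOneSpectrum (𝓞 F)}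
    (hS : 𝔮 ∉ S) (hT : 𝔮 ∉ T) (g : PGL(2, 𝔮.adicCompletion F)) (i : ℕ)
    (α : continuousCohomology i (trivTop (ZMod N) (locKx 𝔮 g))) :
    cohMap (fnPull (ZMod N) (forgetComp hST) (forgetComp_diagEmb hST)
      (forgetComp_mem_levelX hST 𝔫 hS hT g)) i (globalClass N T 𝔫 hT g i α) =
    globalClass N S 𝔫 hS g i α := by
  obtain ⟨c, hc⟩ := cohMk_surjective _ i (contCompare (ZMod N) (locKx 𝔮 g) i α)
  obtain ⟨x, hx, hx'⟩ := exists_cocyc_globalClass N S 𝔫 hS g i α c hc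
  obtain ⟨z, hz, hz'⟩ := exists_cocyc_globalClass N T 𝔫 hT g i α c hc
  rw [hx, hz, cohMap_cohMk]
  -- The first map belongs to the pulled-back class, the second to the class away from `S`. They
  -- rest on unrelated coset representatives, but both are equivariant for the projection of
  -- `levelX` away from `S` to the component at 𝔮.
  refine cohMk_eq_of_equivariant (diagEmb S) (levelX S 𝔫 𝔮 hS g) (levelXComp S 𝔫 𝔮 hS g) c
    (fun a => levelXComp T 𝔫 𝔮 hT g (shapT (levelX T 𝔫 𝔮 hT g) (forgetComp hST a)))
    (fun a => levelXComp S 𝔫 𝔮 hS g (shapT (levelX S 𝔫 𝔮 hS g) a))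
    (fun k a => ?_) (fun k a => ?_) _ _ (fun y a => ?_) hx'
  · rw [map_mul]
    -- Forgetting the components in `T` sends `k` into the level away from `T` and leaves its
    -- component at 𝔮 unchanged.
    refine (congr_arg (levelXComp T 𝔫 𝔮 hT g) (shapT_mul (levelX T 𝔫 𝔮 hT g)
      ⟨forgetComp hST k, forgetComp_mem_levelX hST 𝔫 hS hT g k k.2⟩ (forgetComp hST a))).trans ?_
    rw [map_mul]
    rfl
  · rw [shapT_mul, map_mul]
  · refine (hz' y (forgetComp hST a)).trans ?_
    simp only [map_mul, map_inv, forgetComp_diagEmb]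

end Adelic

/-! ### The two commutation relations. -/

section Operators

variable {F : Type} [Field F] [NumberField F]
  (N : ℕ) (ε : ((v : InfinitePlace F) → PGL(2, v.Completion)) →* ℤˣ)

/-- Cup product with the class attached to `ℓ` commutes with derived Hecke operators up to the
sign `(-1)ⁱ`. -/
theorem cOp_heckeOp {S : Set (HeightOneSpectrum (𝓞 F))} {𝔫 : Ideal (𝓞 F)}
    {𝔭 𝔮 : HeightOneSpectrum (𝓞 F)} (h𝔮 : 𝔮 ∉ S) (h𝔫 : ¬ 𝔮.asIdeal ∣ 𝔫)
    {g : PGL(2, 𝔮.adicCompletion F)} {i : ℕ}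
    (α : continuousCohomology i (trivTop (ZMod N) (locKx 𝔮 g)))
    (y : PGL(2, 𝔮.adicCompletion F)) (hy : ∀ k ∈ locKx 𝔮 g, y⁻¹ * k * y ∈ maxCpt 𝔮)
    (ℓ : (𝔭.adicCompletion F)ˣ →* Multiplicative (ZMod N)) (hℓ : IsLocallyConstant ℓ)
    (m : totCoh (stCoeff N ε S (level S 𝔫) 𝔭)) :
    cOp N ε S (level S 𝔫) 𝔭 ℓ hℓ (heckeOp N S h𝔮 h𝔫 α y hy
        ((stAction (𝔭.adicCompletion F) ℤ).comp (toLoc 𝔭)) (ε.comp (diagInf F)) m) =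
      (-1 : ZMod N) ^ i • heckeTriv N ε S h𝔮 h𝔫 α y hy (cOp N ε S (level S 𝔫) 𝔭 ℓ hℓ m) := by
  simp only [cOp, heckeTriv, heckeOp, LinearMap.comp_apply]
  -- The product with b moves inwards: past the coset sum to the level `levelX`, then past the
  -- product with the class of α, where the sign arises, and then past the translation.
  rw [← totMap_totCup_id (stPair N (diagEmb S) (levelX S 𝔫 𝔮 h𝔮 g) (toLoc 𝔭)
      (ε.comp (diagInf F))) (stPair_equivariant N _ _ _ _) _ _ (fnCores _ _ _) (fnCores _ _ _)
      (fnCores_stPair N _ _ _),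
    totCup_swap _ _ _ _ (stPair N (diagEmb S) (levelX S 𝔫 𝔮 h𝔮 g) (toLoc 𝔭)
      (ε.comp (diagInf F))) (stPair_equivariant N _ _ _ _)
      (fnMul (diagEmb S) (levelX S 𝔫 𝔮 h𝔮 g) (.trivial ℤ PGL(2, F) ℤ) (ε.comp (diagInf F)))
      (fnMul_equivariant _ _ _ _) (fun Φ Ψ x => stPair_fnMul N _ _ _ _ Φ Ψ x),
    ← totMap_totCup_id _ _ _ _ (fnTrans _ _ _ _ (single_mem S 𝔫 h𝔮 h𝔫 y hy))
      (fnTrans _ _ _ _ (single_mem S 𝔫 h𝔮 h𝔫 y hy)) (fnTrans_stPair N _ _ _ _ _), map_smul]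

/-- Evaluation at an Iwahori-fixed vector commutes with derived Hecke operators. -/
theorem evOp_heckeOp {𝔫 : Ideal (𝓞 F)} {𝔭 𝔮 : HeightOneSpectrum (𝓞 F)} (h𝔭 : 𝔭.asIdeal ∣ 𝔫)
    (h𝔮𝔭 : 𝔮 ∉ ({𝔭} : Set (HeightOneSpectrum (𝓞 F)))) (h𝔫 : ¬ 𝔮.asIdeal ∣ 𝔫)
    {g : PGL(2, 𝔮.adicCompletion F)} {i : ℕ}
    (α : continuousCohomology i (trivTop (ZMod N) (locKx 𝔮 g)))
    (y : PGL(2, 𝔮.adicCompletion F)) (hy : ∀ k ∈ locKx 𝔮 g, y⁻¹ * k * y ∈ maxCpt 𝔮)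
    (v : St (𝔭.adicCompletion F) ℤ)
    (hv : ∀ k ∈ locK0 𝔭 𝔭.asIdeal, stAction (𝔭.adicCompletion F) ℤ k v = v)
    (m : totCoh (stCoeff N ε {𝔭} (level {𝔭} 𝔫) 𝔭)) :
    evOp N ε h𝔭 v hv (heckeSt N ε h𝔮𝔭 h𝔫 α y hy m) =
      heckeTriv N ε ∅ (Set.notMem_empty 𝔮) h𝔫 α y hy (evOp N ε h𝔭 v hv m) := by
  have hST : (∅ : Set (HeightOneSpectrum (𝓞 F))) ⊆ {𝔭} := Set.empty_subset _
  -- Since 𝔭 divides 𝔫, the component at 𝔭 of the level lies in the Iwahori subgroup.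
  have hvK : ∀ k ∈ level ∅ 𝔫, stAction (𝔭.adicCompletion F) ℤ
      (localComp ∅ 𝔭 (Set.notMem_empty 𝔭) k) v = v := fun k hk =>
    hv _ (locK0_mono 𝔭 (Ideal.dvd_iff_le.1 h𝔭) (mem_level.1 hk 𝔭 (Set.notMem_empty 𝔭)))
  have hvX : ∀ k ∈ levelX ∅ 𝔫 𝔮 (Set.notMem_empty 𝔮) g, stAction (𝔭.adicCompletion F) ℤ
      (localComp ∅ 𝔭 (Set.notMem_empty 𝔭) k) v = v := fun k hk => hvK k hk.1
  have hf : ∀ γ : PGL(2, F), forgetComp hST (diagEmb ∅ γ) = diagEmb {𝔭} γ :=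
    forgetComp_diagEmb hST
  have hπ : ∀ γ, localComp ∅ 𝔭 (Set.notMem_empty 𝔭) (diagEmb ∅ γ) = toLoc 𝔭 γ := fun _ => rfl
  have hev : evCoeff N ε h𝔭 v hv = fnEv (ZMod N) (forgetComp hST) hf
      (stAction (𝔭.adicCompletion F) ℤ) (localComp ∅ 𝔭 (Set.notMem_empty 𝔭)) hπ
      (ε.comp (diagInf F)) (forgetComp_mem_level hST 𝔫) v hvK := rfl
  -- Hence the element supported at 𝔮 has trivial component at 𝔭, as `fnTrans_fnEv` requires.
  have hne : 𝔭 ≠ 𝔮 := fun h => h𝔮𝔭 h.symm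
  simp only [evOp, heckeSt, heckeTriv, heckeOp, LinearMap.comp_apply, hev]
  -- Evaluation moves inwards through the coset sum, the cup product and the translation. In the
  -- middle step the class of α is pulled back and identified by `cohMap_globalClass`.
  rw [totMap_totMap, fnCores_fnEv hf hπ (ε.comp (diagInf F)) (forgetComp_mem_level hST 𝔫)
      (forgetComp_mem_levelX hST 𝔫 (Set.notMem_empty 𝔮) h𝔮𝔭 g) hvK hvX
      (exists_mem_level_forgetComp hST 𝔫)
      (mem_levelX_of_forgetComp hST 𝔫 (Set.notMem_empty 𝔮) h𝔮𝔭 g), ← totMap_totMap,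
    totMap_totCup _ _ _ (fnMul_equivariant _ _ _ _) _ _ _ (fnEv_fnMul hf hπ _ _ hvX),
    cohMap_globalClass, totMap_totMap,
    fnTrans_fnEv hf hπ (ε.comp (diagInf F)) (forgetComp_mem_level hST 𝔫)
      (forgetComp_mem_levelX hST 𝔫 (Set.notMem_empty 𝔮) h𝔮𝔭 g) hvK hvX
      (single_mem ∅ 𝔫 (Set.notMem_empty 𝔮) h𝔫 y hy) (single_mem {𝔭} 𝔫 h𝔮𝔭 h𝔫 y hy)
      (forgetComp_single hST _ _ y) (comp_single_of_ne ∅ 𝔮 _ y 𝔭 _ hne), ← totMap_totMap]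

end Operators
end DHecke

theorem mainTheorem3 (F : Type) [Field F] [NumberField F] (p : ℕ) [Fact p.Prime] (n : ℕ)
    (hn : 1 ≤ n) (𝔭 𝔮 : HeightOneSpectrum (𝓞 F)) (h𝔭p : (p : 𝓞 F) ∈ 𝔭.asIdeal)
    (h𝔮p : (p : 𝓞 F) ∉ 𝔮.asIdeal) (𝔫 : Ideal (𝓞 F)) (h𝔫 : 𝔫 ≠ ⊥) (h𝔭 : 𝔭.asIdeal ∣ 𝔫)
    (h𝔭' : ¬ 𝔭.asIdeal ^ 2 ∣ 𝔫) (h𝔮 : ¬ 𝔮.asIdeal ∣ 𝔫)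
    (ε : ((v : InfinitePlace F) → PGL(2, v.Completion)) →* ℤˣ) (hε : IsLocallyConstant ε)
    (g : PGL(2, 𝔮.adicCompletion F)) (i : ℕ)
    (α : continuousCohomology i (DHecke.trivTop (ZMod (p ^ n)) (DHecke.locKx 𝔮 g))) :
    ((∀ (ℓ : (𝔭.adicCompletion F)ˣ →* Multiplicative (ZMod (p ^ n))) (hℓ : IsLocallyConstant ℓ)
        (m : DHecke.totCoh (DHecke.stCoeff (p ^ n) ε {𝔭} (DHecke.level {𝔭} 𝔫) 𝔭)),
        DHecke.cOp (p ^ n) ε {𝔭} (DHecke.level {𝔭} 𝔫) 𝔭 ℓ hℓ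
            (DHecke.heckeSt (p ^ n) ε (DHecke.notMem_singleton h𝔭p h𝔮p) h𝔮 α g
              (DHecke.inv_mul_mul_mem_of_mem_locKx 𝔮 g) m) =
          (-1 : ZMod (p ^ n)) ^ i •
            DHecke.heckeTriv (p ^ n) ε {𝔭} (DHecke.notMem_singleton h𝔭p h𝔮p) h𝔮 α g
              (DHecke.inv_mul_mul_mem_of_mem_locKx 𝔮 g)
              (DHecke.cOp (p ^ n) ε {𝔭} (DHecke.level {𝔭} 𝔫) 𝔭 ℓ hℓ m)) ∧
      (∀ (v : DHecke.St (𝔭.adicCompletion F) ℤ)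
        (hv : ∀ k ∈ DHecke.locK0 𝔭 𝔭.asIdeal, DHecke.stAction (𝔭.adicCompletion F) ℤ k v = v)
        (m : DHecke.totCoh (DHecke.stCoeff (p ^ n) ε {𝔭} (DHecke.level {𝔭} 𝔫) 𝔭)),
        DHecke.evOp (p ^ n) ε h𝔭 v hv
            (DHecke.heckeSt (p ^ n) ε (DHecke.notMem_singleton h𝔭p h𝔮p) h𝔮 α g
              (DHecke.inv_mul_mul_mem_of_mem_locKx 𝔮 g) m) =
          DHecke.heckeTriv (p ^ n) ε ∅ (Set.notMem_empty 𝔮) h𝔮 α g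
            (DHecke.inv_mul_mul_mem_of_mem_locKx 𝔮 g)
            (DHecke.evOp (p ^ n) ε h𝔭 v hv m))) ∧
    ((∀ (ℓ : (𝔭.adicCompletion F)ˣ →* Multiplicative (ZMod (p ^ n))) (hℓ : IsLocallyConstant ℓ)
        (m : DHecke.totCoh (DHecke.stCoeff (p ^ n) ε {𝔭} (DHecke.level {𝔭} 𝔫) 𝔭)),
        DHecke.cOp (p ^ n) ε {𝔭} (DHecke.level {𝔭} 𝔫) 𝔭 ℓ hℓ
            (DHecke.heckeSt (p ^ n) ε (DHecke.notMem_singleton h𝔭p h𝔮p) h𝔮 α 1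
              (DHecke.one_inv_mul_mul_mem_of_mem_locKx 𝔮 g) m) =
          (-1 : ZMod (p ^ n)) ^ i •
            DHecke.heckeTriv (p ^ n) ε {𝔭} (DHecke.notMem_singleton h𝔭p h𝔮p) h𝔮 α 1
              (DHecke.one_inv_mul_mul_mem_of_mem_locKx 𝔮 g)
              (DHecke.cOp (p ^ n) ε {𝔭} (DHecke.level {𝔭} 𝔫) 𝔭 ℓ hℓ m)) ∧
      (∀ (v : DHecke.St (𝔭.adicCompletion F) ℤ)
        (hv : ∀ k ∈ DHecke.locK0 𝔭 𝔭.asIdeal, DHecke.stAction (𝔭.adicCompletion F) ℤ k v = v)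
        (m : DHecke.totCoh (DHecke.stCoeff (p ^ n) ε {𝔭} (DHecke.level {𝔭} 𝔫) 𝔭)),
        DHecke.evOp (p ^ n) ε h𝔭 v hv
            (DHecke.heckeSt (p ^ n) ε (DHecke.notMem_singleton h𝔭p h𝔮p) h𝔮 α 1
              (DHecke.one_inv_mul_mul_mem_of_mem_locKx 𝔮 g) m) =
          DHecke.heckeTriv (p ^ n) ε ∅ (Set.notMem_empty 𝔮) h𝔮 α 1
            (DHecke.one_inv_mul_mul_mem_of_mem_locKx 𝔮 g)
            (DHecke.evOp (p ^ n) ε h𝔭 v hv m))) :=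
  -- Translation by `g` gives h. Translation by 1, which is the inclusion of function spaces, gives
  -- h'.
  ⟨⟨fun ℓ hℓ m => DHecke.cOp_heckeOp (p ^ n) ε _ h𝔮 α g _ ℓ hℓ m,
    fun v hv m => DHecke.evOp_heckeOp (p ^ n) ε h𝔭 _ h𝔮 α g _ v hv m⟩,
   ⟨fun ℓ hℓ m => DHecke.cOp_heckeOp (p ^ n) ε _ h𝔮 α 1 _ ℓ hℓ m,
    fun v hv m => DHecke.evOp_heckeOp (p ^ n) ε h𝔭 _ h𝔮 α 1 _ v hv m⟩⟩
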